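/- **Setting.** Let $I$ be a finite set, let $A=(a_{ij})_{i,j\in I}$ be an integer matrix with $a_{ii}=2$ or $a_{ii}\in 2\mathbb Z_{\le 0}$, $a_{ij}\le 0$ for $i\ne j$, and $a_{ij}=0\Leftrightarrow a_{ji}=0$ (a Borcherds–Cartan matrix), and let $d_i\in\mathbb Z_{>0}$ be such that $(\alpha_i|\alpha_j):=d_ia_{ij}=d_ja_{ji}$. Put $\mathtt Q^+=\bigoplus_{i\in I}\mathbb Z_{\ge0}\alpha_i$ and $|\sum k_i\alpha_i|=\sum k_i$. Let $\mathbf k=\bigoplus_{n\ge 0}\mathbf k_n$ be a graded commutative ring. Let $\mathcal Q_{i,j}(u,v)=\mathcal Q_{j,i}(v,u)\in\mathbf k[u,v]$ with $\mathcal Q_{i,i}=0$ and, for $i\neq j$, $\mathcal Q_{i,j}=\sum_{d_ip+d_jq\le-(\alpha_i|\alpha_j)}t_{i,j}^{p,q}u^pv^q$ with $t_{i,j}^{p,q}\in\mathbf k_{-2((\alpha_i|\alpha_j)+d_ip+d_jq)}$ and $t_{i,j}^{-a_{ij},0}\in\mathbf k_0^\times$. Let $\mathcal P_i(u,v)=\sum_{p+q\le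 1-a_{ii}/2}w_i^{p,q}u^pv^q$ with $w_i^{p,q}\in\mathbf k_{2d_i(1-p-q-a_{ii}/2)}$ and $w_i^{1-a_{ii}/2,0},\,w_i^{0,1-a_{ii}/2}\in\mathbf k_0^\times$. The Khovanov–Lauda–Rouquier algebra $R(n)$ is the $\mathbf k$-algebra generated by $e(\nu)$ ($\nu\in I^n$), $x_1,\dots,x_n$, $\tau_1,\dots,\tau_{n-1}$ with the relations $e(\nu)e(\nu')=\delta_{\nu\nu'}e(\nu)$, $\sum_\nu e(\nu)=1$, $x_kx_l=x_lx_k$, $x_ke(\nu)=e(\nu)x_k$, $\tau_le(\nu)=e(s_l\nu)\tau_l$, $\tau_k\tau_l=\tau_l\tau_k$ for $|k-l|>1$; $\tau_k^2e(\nu)=\frac{\mathcal P_{\nu_k}(x_{k+1},x_k)-\mathcal P_{\nu_k}(x_k,x_{k+1})}{x_k-x_{k+1}}\tau_ke(\nu)$ if $\nu_k=\nu_{k+1}$ and $\tau_k^2e(\nu)=\mathcal Q_{\nu_k,\nu_{k+1}}(x_k,x_{k+1})e(\nu)$ otherwise; $(\tau_kx_l-x_{s_k(l)}\tau_k)e(\nu)$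 equals $-\mathcal P_{\nu_k}(x_k,x_{k+1})e(\nu)$ if $l=k$, $\nu_k=\nu_{k+1}$, equals $\mathcal P_{\nu_k}(x_k,x_{k+1})e(\nu)$ if $l=k+1$, $\nu_k=\nu_{k+1}$, and is $0$ otherwise; $(\tau_{k+1}\tau_k\tau_{k+1}-\tau_k\tau_{k+1}\tau_k)e(\nu)$ equals $\mathcal P_{\nu_k}(x_k,x_{k+2})\overline{\mathcal Q}_{\nu_k,\nu_{k+1}}(x_k,x_{k+1},x_{k+2})e(\nu)$ if $\nu_k=\nu_{k+2}\ne\nu_{k+1}$, equals $\overline{\mathcal P}'_{\nu_k}(x_k,x_{k+1},x_{k+2})\tau_ke(\nu)+\overline{\mathcal P}''_{\nu_k}(x_k,x_{k+1},x_{k+2})\tau_{k+1}e(\nu)$ if $\nu_k=\nu_{k+1}=\nu_{k+2}$, and is $0$ otherwise. Here $\overline{\mathcal Q}_{i,j}(u,v,w)=\frac{\mathcal Q_{i,j}(u,v)-\mathcal Q_{i,j}(w,v)}{u-w}$ and, with $P=\mathcal P_i$, $\overline{\mathcal P}'_i=\frac{P(v,u)P(u,w)}{(u-v)(u-w)}+\frac{P(u,w)P(v,w)}{(u-w)(v-w)}-\frac{P(u,v)P(v,w)}{(u-v)(v-w)}$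 and $\overline{\mathcal P}''_i=-\frac{P(u,v)P(u,w)}{(u-v)(u-w)}-\frac{P(u,w)P(w,v)}{(u-w)(v-w)}+\frac{P(u,v)P(v,w)}{(u-v)(v-w)}$; all of these are polynomials. $R(n)$ is $\mathbb Z$-graded by $\deg e(\nu)=0$, $\deg x_ke(\nu)=2d_{\nu_k}$, $\deg\tau_le(\nu)=-(\alpha_{\nu_l}|\alpha_{\nu_{l+1}})$ and the grading of $\mathbf k$. For $\beta\in\mathtt Q^+$ with $|\beta|=n$ put $e(\beta)=\sum e(\nu)$ over the $\nu\in I^n$ with $\alpha_{\nu_1}+\dots+\alpha_{\nu_n}=\beta$, and $R(\beta)=e(\beta)R(n)$. There is a homomorphism $R(n)\to R(n+1)$ with $x_k\mapsto x_k$, $\tau_l\mapsto\tau_l$, $e(\nu)\mapsto\sum_{i}e(\nu,i)$. Put $e(n,i)=\sum_{\nu\in I^{n+1},\,\nu_{n+1}=i}e(\nu)$ and $e(\beta,i)=e(\beta+\alpha_i)e(n,i)$; let $R(n,1)\subset R(n+1)$ be the image of $R(n)\otimes_{\mathbf k}R(1)$, i.e. the subalgebra generated by the image of $R(n)$, by $x_{n+1}$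 and by the $e(n,i)$. Let $\mathrm{Mod}(R(\beta))$ be the category of graded left $R(\beta)$-modules with degree-preserving homomorphisms, let $q$ be the shift $(q^mM)_k=M_{k-m}$, put $q_i=q^{d_i}$, and let $$E_i:\mathrm{Mod}(R(\beta+\alpha_i))\to\mathrm{Mod}(R(\beta)),\ M\mapsto e(\beta,i)M,\qquad F_i:\mathrm{Mod}(R(\beta))\to\mathrm{Mod}(R(\beta+\alpha_i)),\ N\mapsto R(\beta+\alpha_i)e(\beta,i)\otimes_{R(\beta)}N .$$ **Theorem.** Let $t_i$ be an indeterminate of degree $2d_i$. 1. If $i\ne j$ and $\beta=\varepsilon+\alpha_i$ with $\varepsilon\in\mathtt Q^+$, then $E_iF_j\cong q_i^{-a_{ij}}F_jE_i$ as functors $\mathrm{Mod}(R(\beta))\to\mathrm{Mod}(R(\beta-\alpha_i+\alpha_j))$. 2. If $\beta=\varepsilon+\alpha_i$ with $\varepsilon\in\mathtt Q^+$, then $E_iF_i\cong q_i^{-a_{ii}}F_iE_i\oplus(\mathrm{Id}\otimes_{\mathbf k}\mathbf k[t_i])$ as endofunctors of $\mathrm{Mod}(R(\beta))$. If $\alpha_i$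 does not occur in $\beta\in\mathtt Q^+$ (so that $F_iE_i=0$ on $\mathrm{Mod}(R(\beta))$), then $E_iF_i\cong\mathrm{Id}\otimes_{\mathbf k}\mathbf k[t_i]$. 3. For every $n\ge1$ the map $x\otimes y\mapsto x\tau_ny$ together with the inclusion of $R(n,1)$ is an isomorphism of $(R(n),R(n))$-bimodules $$\bigl(R(n)\otimes_{R(n-1)}R(n)\bigr)\oplus R(n,1)\ \xrightarrow{\ \sim\ }\ R(n+1).$$ -/

import Mathlib

open CategoryTheory TensorProduct MulOpposite

universe u w

namespace KLR

/-! ### Graded abelian groups, graded modules -/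

section Internal

variable {M : Type*} [AddCommGroup M]

theorem isInternal_of_coaction (deg : ℤ → AddSubgroup M)
    (top : ∀ m : M, m ∈ ⨆ d, deg d) (δ : M →+ (ℤ →₀ M))
    (hδ : ∀ d, ∀ m ∈ deg d, δ m = Finsupp.single d m) : DirectSum.IsInternal deg := by
  classical
  constructor
  · rw [injective_iff_map_eq_zero]
    intro x hx
    have key : ∀ x : DirectSum ℤ (fun d => deg d), ∀ d,
        δ (DirectSum.coeAddMonoidHom deg x) d = (x d : M) := by
      intro x d
      induction x using DirectSum.induction_on with
      | zero => simp
      | of a y =>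
        rw [DirectSum.coeAddMonoidHom_of, hδ a _ y.2]
        by_cases h : a = d
        · subst h; simp
        · rw [Finsupp.single_eq_of_ne' h, DirectSum.of_eq_of_ne _ _ _ (Ne.symm h)]; rfl
      | add x y hx hy => simp [hx, hy]
    ext d
    rw [← key x d, hx]; simp
  · intro m
    have := top m
    induction this using AddSubgroup.iSup_induction' with
    | hp d m hm => exact ⟨DirectSum.of (fun d => deg d) d ⟨m, hm⟩, by simp⟩
    | h1 => exact ⟨0, by simp⟩
    | hadd a b _ _ ha hb =>
      obtain ⟨x, hx⟩ := ha
      obtain ⟨y, hy⟩ := hb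
      exact ⟨x + y, by simp [hx, hy]⟩

theorem exists_coaction {deg : ℤ → AddSubgroup M} (h : DirectSum.IsInternal deg) :
    ∃ δ : M →+ (ℤ →₀ M), ∀ d, ∀ m ∈ deg d, δ m = Finsupp.single d m := by
  classical
  let e := AddEquiv.ofBijective _ h
  refine ⟨(DirectSum.toAddMonoid fun d =>
    (Finsupp.singleAddHom d).comp (deg d).subtype).comp e.symm.toAddMonoidHom, ?_⟩
  intro d m hm
  have : e.symm m = DirectSum.of (fun d => deg d) d ⟨m, hm⟩ := by
    rw [AddEquiv.symm_apply_eq]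
    exact (DirectSum.coeAddMonoidHom_of deg d ⟨m, hm⟩).symm
  simp [this]

theorem mem_iSup_of_isInternal {deg : ℤ → AddSubgroup M} (h : DirectSum.IsInternal deg) (m : M) :
    m ∈ ⨆ d, deg d := by
  classical
  obtain ⟨x, rfl⟩ := h.2 m
  induction x using DirectSum.induction_on with
  | zero => simp
  | of a y =>
    rw [DirectSum.coeAddMonoidHom_of]
    exact AddSubgroup.mem_iSup_of_mem a y.2
  | add x y hx hy => rw [map_add]; exact add_mem hx hy

/-- A degree-compatible retract of a graded group is graded. -/
theorem isInternal_retract {K : Type*} [AddCommGroup K] {deg : ℤ → AddSubgroup M}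
    (h : DirectSum.IsInternal deg) (inc : K →+ M) (ret : M →+ K)
    (hr : ∀ k, ret (inc k) = k) (hd : ∀ d, ∀ m ∈ deg d, inc (ret m) ∈ deg d) :
    DirectSum.IsInternal fun d => (deg d).comap inc := by
  obtain ⟨δ, hδ⟩ := exists_coaction h
  refine isInternal_of_coaction _ ?_ ((Finsupp.mapRange.addMonoidHom ret).comp (δ.comp inc)) ?_
  · intro k
    have : ∀ m : M, ret m ∈ ⨆ d, (deg d).comap inc := by
      intro m
      induction mem_iSup_of_isInternal h m using AddSubgroup.iSup_induction' with
      | hp d m hm => exact AddSubgroup.mem_iSup_of_mem d (hd d m hm)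
      | h1 => simp
      | hadd a b _ _ ha hb => rw [map_add]; exact add_mem ha hb
    rw [← hr k]; exact this _
  · intro d k hk
    simp [hδ d (inc k) hk, hr]

/-- The degree pieces of a balanced tensor product `T` of two graded groups `B`, `N`. -/
def tensorDeg {B N T : Type*} [AddCommGroup B] [AddCommGroup N] [AddCommGroup T]
    (degB : ℤ → AddSubgroup B) (degN : ℤ → AddSubgroup N) (mk : B → N → T) (d : ℤ) :
    AddSubgroup T :=
  AddSubgroup.closure {t | ∃ a c : ℤ, ∃ b ∈ degB a, ∃ n ∈ degN c, a + c = d ∧ t = mk b n}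

theorem tensorDeg_isInternal {B N T : Type*} [AddCommGroup B] [AddCommGroup N] [AddCommGroup T]
    {degB : ℤ → AddSubgroup B} {degN : ℤ → AddSubgroup N}
    (hB : DirectSum.IsInternal degB) (hN : DirectSum.IsInternal degN)
    (mk : B →+ N →+ T) (gen : AddSubgroup.closure {t | ∃ b n, t = mk b n} = ⊤)
    {ι : Type*} (ρ : ι → B →+ B) (lam : ι → N →+ N) (D : ι → ℤ)
    (hρ : ∀ r, ∀ a, ∀ b ∈ degB a, ρ r b ∈ degB (a + D r))
    (hl : ∀ r, ∀ c, ∀ n ∈ degN c, lam r n ∈ degN (D r + c))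
    (hbal : ∀ r b n, mk (ρ r b) n = mk b (lam r n))
    (lift : ∀ f : B →+ N →+ (ℤ →₀ T), (∀ r b n, f (ρ r b) n = f b (lam r n)) →
      ∃ g : T →+ (ℤ →₀ T), ∀ b n, g (mk b n) = f b n) :
    DirectSum.IsInternal (tensorDeg degB degN fun b n => mk b n) := by
  obtain ⟨δB, hδB⟩ := exists_coaction hB
  obtain ⟨δN, hδN⟩ := exists_coaction hN
  let inner : ℤ → B →+ N →+ (ℤ →₀ T) := fun a => AddMonoidHom.mk'
    (fun x => (Finsupp.liftAddHom fun c => (Finsupp.singleAddHom (a + c)).comp (mk x)).comp δN)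
    (by
      intro x y
      ext1 n
      simp only [AddMonoidHom.comp_apply, AddMonoidHom.add_apply]
      generalize δN n = z
      induction z using Finsupp.induction_linear with
      | zero => simp
      | add p q hp hq => rw [map_add _ p q, map_add _ p q, map_add _ p q, hp, hq]; abel
      | single c m => simp)
  let f : B →+ N →+ (ℤ →₀ T) := (Finsupp.liftAddHom inner).comp δB
  have hf : ∀ a b c n, b ∈ degB a → n ∈ degN c → f b n = Finsupp.single (a + c) (mk b n) := by
    intro a b c n hb hn
    simp [f, inner, hδB a b hb, hδN c n hn]
  obtain ⟨g, hg⟩ := lift f (by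
    intro r b n
    induction mem_iSup_of_isInternal hB b using AddSubgroup.iSup_induction' with
    | h1 => simp
    | hadd x y _ _ hx hy => simp [hx, hy]
    | hp a b hb =>
      induction mem_iSup_of_isInternal hN n using AddSubgroup.iSup_induction' with
      | h1 => simp
      | hadd x y _ _ hx hy => simp [hx, hy]
      | hp c n hn =>
        rw [hf _ _ _ _ (hρ r a b hb) hn, hf _ _ _ _ hb (hl r c n hn), hbal, add_assoc])
  refine isInternal_of_coaction _ ?_ g ?_
  · intro t
    have ht : t ∈ AddSubgroup.closure {t | ∃ b n, t = mk b n} := gen ▸ AddSubgroup.mem_top t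
    induction ht using AddSubgroup.closure_induction with
    | zero => simp
    | add x y _ _ hx hy => exact add_mem hx hy
    | neg x _ hx => exact neg_mem hx
    | mem t ht =>
      obtain ⟨b, n, rfl⟩ := ht
      induction mem_iSup_of_isInternal hB b using AddSubgroup.iSup_induction' with
      | h1 => simp
      | hadd x y _ _ hx hy => rw [map_add, AddMonoidHom.add_apply]; exact add_mem hx hy
      | hp a b hb =>
        induction mem_iSup_of_isInternal hN n using AddSubgroup.iSup_induction' with
        | h1 => simp
        | hadd x y _ _ hx hy => rw [map_add]; exact add_mem hx hy
        | hp c n hn =>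
          exact AddSubgroup.mem_iSup_of_mem (a + c)
            (AddSubgroup.subset_closure ⟨a, c, b, hb, n, hn, rfl, rfl⟩)
  · intro d t ht
    induction ht using AddSubgroup.closure_induction with
    | zero => simp
    | add x y _ _ hx hy => simp [hx, hy]
    | neg x _ hx => simp [hx]
    | mem t ht =>
      obtain ⟨a, c, b, hb, n, hn, rfl, rfl⟩ := ht
      rw [hg, hf _ _ _ _ hb hn]

end Internal

section GrMod

variable {A : Type*} [Ring A]

/-- A graded left module over a ring `A` with homogeneous parts `𝒜 d`. -/
structure GrMod (𝒜 : ℤ → AddSubgroup A) where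
  carrier : Type w
  [addCommGroup : AddCommGroup carrier]
  [module : Module A carrier]
  deg : ℤ → AddSubgroup carrier
  isInternal : DirectSum.IsInternal deg
  smul_mem : ∀ {a b : ℤ} {r : A} {m : carrier}, r ∈ 𝒜 a → m ∈ deg b → r • m ∈ deg (a + b)

attribute [instance] GrMod.addCommGroup GrMod.module

variable {𝒜 : ℤ → AddSubgroup A}

/-- Degree preserving homomorphisms. -/
@[ext]
structure GrMod.Hom (M N : GrMod.{w} 𝒜) where
  toLin : M.carrier →ₗ[A] N.carrier
  map_deg : ∀ {d : ℤ} {m : M.carrier}, m ∈ M.deg d → toLin m ∈ N.deg d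

instance GrMod.category : Category (GrMod.{w} 𝒜) where
  Hom M N := GrMod.Hom M N
  id M := ⟨LinearMap.id, fun h => h⟩
  comp f g := ⟨g.toLin ∘ₗ f.toLin, fun h => g.map_deg (f.map_deg h)⟩

/-- The degree shift functor `q ^ s`: `(q ^ s M)_d = M_{d - s}`. -/
def GrMod.shift (𝒜 : ℤ → AddSubgroup A) (s : ℤ) : GrMod.{w} 𝒜 ⥤ GrMod.{w} 𝒜 where
  obj M :=
    { carrier := M.carrier
      deg := fun d => M.deg (d - s)
      isInternal := by
        obtain ⟨δ, hδ⟩ := exists_coaction M.isInternal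
        refine isInternal_of_coaction _ ?_ ((Finsupp.mapDomain.addMonoidHom (· + s)).comp δ) ?_
        · intro m
          induction mem_iSup_of_isInternal M.isInternal m using AddSubgroup.iSup_induction' with
          | hp d m hm =>
            exact AddSubgroup.mem_iSup_of_mem (d + s) (by simpa using hm)
          | h1 => simp
          | hadd a b _ _ ha hb => exact add_mem ha hb
        · intro d m hm
          simp [hδ _ m hm]
      smul_mem := fun {a b r m} hr hm => by
        have := M.smul_mem hr hm
        rwa [← add_sub_assoc] at this }
  map f := ⟨f.toLin, fun h => f.map_deg h⟩

/-- The direct sum of two graded modules. -/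
def GrMod.sum (M N : GrMod.{w} 𝒜) : GrMod.{w} 𝒜 where
  carrier := M.carrier × N.carrier
  deg d := (M.deg d).prod (N.deg d)
  isInternal := by
    obtain ⟨δ, hδ⟩ := exists_coaction M.isInternal
    obtain ⟨ε, hε⟩ := exists_coaction N.isInternal
    refine isInternal_of_coaction _ ?_
      (((Finsupp.mapRange.addMonoidHom (AddMonoidHom.inl _ _)).comp
          (δ.comp (AddMonoidHom.fst _ _))) +
        ((Finsupp.mapRange.addMonoidHom (AddMonoidHom.inr _ _)).comp
          (ε.comp (AddMonoidHom.snd _ _)))) ?_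
    · have h1 : ∀ m : M.carrier,
          ((m, 0) : M.carrier × N.carrier) ∈ ⨆ d, (M.deg d).prod (N.deg d) := by
        intro m
        induction mem_iSup_of_isInternal M.isInternal m using AddSubgroup.iSup_induction' with
        | hp d m hm =>
          exact AddSubgroup.mem_iSup_of_mem d (AddSubgroup.mem_prod.2 ⟨hm, zero_mem _⟩)
        | h1 => exact zero_mem _
        | hadd a b _ _ ha hb => simpa using add_mem ha hb
      have h2 : ∀ m : N.carrier,
          ((0, m) : M.carrier × N.carrier) ∈ ⨆ d, (M.deg d).prod (N.deg d) := by
        intro m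
        induction mem_iSup_of_isInternal N.isInternal m using AddSubgroup.iSup_induction' with
        | hp d m hm =>
          exact AddSubgroup.mem_iSup_of_mem d (AddSubgroup.mem_prod.2 ⟨zero_mem _, hm⟩)
        | h1 => exact zero_mem _
        | hadd a b _ _ ha hb => simpa using add_mem ha hb
      rintro ⟨m, n⟩
      simpa using add_mem (h1 m) (h2 n)
    · rintro d ⟨m, n⟩ h
      obtain ⟨hm, hn⟩ := AddSubgroup.mem_prod.1 h
      simp only [AddMonoidHom.add_apply, AddMonoidHom.comp_apply, AddMonoidHom.coe_fst,
        AddMonoidHom.coe_snd, hδ d m hm, hε d n hn, Finsupp.mapRange.addMonoidHom_apply,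
        Finsupp.mapRange_single]
      rw [← Finsupp.single_add]
      simp
  smul_mem := fun hr hm =>
    AddSubgroup.mem_prod.2 ⟨M.smul_mem hr (AddSubgroup.mem_prod.1 hm).1,
      N.smul_mem hr (AddSubgroup.mem_prod.1 hm).2⟩

/-- The direct sum of two morphisms. -/
def GrMod.sumMap {M M' N N' : GrMod.{w} 𝒜} (f : M ⟶ M') (g : N ⟶ N') : M.sum N ⟶ M'.sum N' :=
  GrMod.Hom.mk (M := M.sum N) (N := M'.sum N') (LinearMap.prodMap f.toLin g.toLin) fun h =>
    AddSubgroup.mem_prod.2 ⟨f.map_deg (AddSubgroup.mem_prod.1 h).1,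
      g.map_deg (AddSubgroup.mem_prod.1 h).2⟩

/-- The direct sum of two functors to graded modules. -/
def directSum {C : Type*} [Category C] (F G : C ⥤ GrMod.{w} 𝒜) : C ⥤ GrMod.{w} 𝒜 where
  obj X := (F.obj X).sum (G.obj X)
  map f := GrMod.sumMap (F.map f) (G.map f)
  map_id X := by rw [F.map_id, G.map_id]; rfl
  map_comp f g := by rw [F.map_comp, G.map_comp]; rfl

end GrMod

section Tensor

variable (S A B N : Type*) [Ring S] [Ring A] [AddCommGroup B] [AddCommGroup N]
  [Module S B] [Module Aᵐᵒᵖ B] [Module A N]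

/-- The relations `(b a) ⊗ n = b ⊗ (a n)`. -/
def balRel : Submodule S (B ⊗[ℤ] N) :=
  Submodule.span S {t | ∃ (b : B) (a : A) (n : N), t = (op a • b) ⊗ₜ[ℤ] n - b ⊗ₜ[ℤ] (a • n)}

/-- The tensor product `B ⊗_A N` over a noncommutative ring `A`, where `B` is an
`(S, A)`-bimodule and `N` is a left `A`-module; it is a left `S`-module. -/
abbrev BalTensor : Type _ := (B ⊗[ℤ] N) ⧸ balRel S A B N

variable {S A B N}

/-- The pure tensor `b ⊗ n` in `B ⊗_A N`. -/
def BalTensor.tmul (b : B) (n : N) : BalTensor S A B N := (balRel S A B N).mkQ (b ⊗ₜ[ℤ] n)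

/-- The biadditive map `(b, n) ↦ b ⊗ n`. -/
def BalTensor.mkHom : B →+ N →+ BalTensor S A B N :=
  AddMonoidHom.mk' (fun b => AddMonoidHom.mk' (fun n => BalTensor.tmul b n)
    (fun x y => by simp [BalTensor.tmul, TensorProduct.tmul_add]))
    (fun x y => by ext n; simp [BalTensor.tmul, TensorProduct.add_tmul])

theorem BalTensor.smul_tmul (b : B) (a : A) (n : N) :
    (BalTensor.tmul (op a • b) n : BalTensor S A B N) = BalTensor.tmul b (a • n) :=
  (Submodule.Quotient.eq _).2 (Submodule.subset_span ⟨b, a, n, rfl⟩)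

theorem BalTensor.lift_exists [SMulCommClass S Aᵐᵒᵖ B] {P : Type*} [AddCommGroup P]
    (f : B →+ N →+ P) (hf : ∀ b (a : A) n, f (op a • b) n = f b (a • n)) :
    ∃ g : BalTensor S A B N →+ P, ∀ b n, g (BalTensor.tmul b n) = f b n := by
  let f' : B ⊗[ℤ] N →+ P := TensorProduct.liftAddHom f (by intro r m n; simp)
  have key : ∀ t ∈ balRel S A B N, f' t = 0 := by
    intro t ht
    induction ht using Submodule.closure_induction with
    | zero => simp
    | add x y _ _ hx hy => simp [hx, hy]
    | smul_mem s t ht =>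
      obtain ⟨b, a, n, rfl⟩ := ht
      rw [smul_sub, TensorProduct.smul_tmul', TensorProduct.smul_tmul', smul_comm s (op a) b]
      simp [f', hf]
  refine ⟨QuotientAddGroup.lift (balRel S A B N).toAddSubgroup f' key, fun b n => ?_⟩
  rfl

theorem BalTensor.closure_tmul :
    AddSubgroup.closure {t : BalTensor S A B N | ∃ (b : B) (n : N), t = (BalTensor.mkHom b : N →+ BalTensor S A B N) n} = ⊤ := by
  rw [eq_top_iff]
  intro t _
  obtain ⟨t, rfl⟩ := Submodule.mkQ_surjective _ t
  induction t using TensorProduct.induction_on with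
  | zero => simp
  | tmul b n => exact AddSubgroup.subset_closure ⟨b, n, rfl⟩
  | add x y hx hy =>
    rw [map_add]; exact add_mem (hx trivial) (hy trivial)

theorem BalTensor.isInternal [SMulCommClass S Aᵐᵒᵖ B] {𝒜 : ℤ → AddSubgroup A}
    (h𝒜 : DirectSum.IsInternal 𝒜)
    {degB : ℤ → AddSubgroup B} {degN : ℤ → AddSubgroup N}
    (hB : DirectSum.IsInternal degB) (hN : DirectSum.IsInternal degN)
    (hρ : ∀ {d a : ℤ} {r : A} {b : B}, r ∈ 𝒜 d → b ∈ degB a → op r • b ∈ degB (a + d))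
    (hl : ∀ {d c : ℤ} {r : A} {n : N}, r ∈ 𝒜 d → n ∈ degN c → r • n ∈ degN (d + c)) :
    DirectSum.IsInternal (tensorDeg degB degN
      (BalTensor.tmul : B → N → BalTensor S A B N)) := by
  refine tensorDeg_isInternal hB hN (BalTensor.mkHom (S := S) (A := A)) BalTensor.closure_tmul
    (ι := {p : ℤ × A // p.2 ∈ 𝒜 p.1})
    (fun r => DistribSMul.toAddMonoidHom B (op r.1.2)) (fun r => DistribSMul.toAddMonoidHom N r.1.2)
    (fun r => r.1.1) (fun r a b hb => hρ r.2 hb) (fun r c n hn => hl r.2 hn)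
    (fun r b n => BalTensor.smul_tmul b r.1.2 n) ?_
  intro f hf
  refine BalTensor.lift_exists f fun b a n => ?_
  induction mem_iSup_of_isInternal h𝒜 a using AddSubgroup.iSup_induction' with
  | hp d m hm => exact hf ⟨(d, m), hm⟩ b n
  | h1 => simp
  | hadd x y _ _ hx hy => simp [add_smul, hx, hy]

end Tensor

section TensorMap

variable (S A B : Type*) [Ring S] [Ring A] [AddCommGroup B] [Module S B] [Module Aᵐᵒᵖ B]
  {N N' : Type*} [AddCommGroup N] [Module A N] [AddCommGroup N'] [Module A N']

/-- The map `b ⊗ n ↦ b ⊗ f(n)`. -/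
def BalTensor.map (f : N →ₗ[A] N') : BalTensor S A B N →ₗ[S] BalTensor S A B N' :=
  (balRel S A B N).mapQ (balRel S A B N')
    (TensorProduct.AlgebraTensorModule.map LinearMap.id f.toAddMonoidHom.toIntLinearMap)
    (by
      rw [balRel, Submodule.span_le]
      rintro _ ⟨b, a, n, rfl⟩
      refine Submodule.subset_span ⟨b, a, f n, ?_⟩
      simp)

theorem BalTensor.map_tmul (f : N →ₗ[A] N') (b : B) (n : N) :
    BalTensor.map S A B f (BalTensor.tmul b n) = BalTensor.tmul b (f n) := rfl

theorem BalTensor.hom_ext {P : Type*} [AddCommGroup P] [Module S P]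
    {f g : BalTensor S A B N →ₗ[S] P}
    (h : ∀ b n, f (BalTensor.tmul b n) = g (BalTensor.tmul b n)) : f = g := by
  refine LinearMap.ext fun t => ?_
  obtain ⟨t, rfl⟩ := Submodule.mkQ_surjective _ t
  induction t using TensorProduct.induction_on with
  | zero => rw [map_zero, map_zero, map_zero]
  | tmul b n => exact h b n
  | add x y hx hy => rw [map_add, map_add, map_add, hx, hy]

theorem tensorDeg_map {B N T B' N' T' : Type*} [AddCommGroup B] [AddCommGroup N] [AddCommGroup T]
    [AddCommGroup B'] [AddCommGroup N'] [AddCommGroup T']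
    {degB : ℤ → AddSubgroup B} {degN : ℤ → AddSubgroup N} {mk : B → N → T}
    {degB' : ℤ → AddSubgroup B'} {degN' : ℤ → AddSubgroup N'} {mk' : B' → N' → T'}
    (F : T →+ T') {e : ℤ} {d : ℤ}
    (h : ∀ a c b n, b ∈ degB a → n ∈ degN c → ∃ b' ∈ degB' (e + a), ∃ n' ∈ degN' c,
      F (mk b n) = mk' b' n') {t : T} (ht : t ∈ tensorDeg degB degN mk d) :
    F t ∈ tensorDeg degB' degN' mk' (e + d) := by
  induction ht using AddSubgroup.closure_induction with
  | zero => rw [map_zero]; exact zero_mem _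
  | add x y _ _ hx hy => rw [map_add]; exact add_mem hx hy
  | neg x _ hx => rw [map_neg]; exact neg_mem hx
  | mem t ht =>
    obtain ⟨a, c, b, hb, n, hn, rfl, rfl⟩ := ht
    obtain ⟨b', hb', n', hn', h'⟩ := h a c b n hb hn
    exact AddSubgroup.subset_closure ⟨e + a, c, b', hb', n', hn', add_assoc _ _ _, h'⟩

theorem tensorDeg_map' {B N T B' N' T' : Type*} [AddCommGroup B] [AddCommGroup N] [AddCommGroup T]
    [AddCommGroup B'] [AddCommGroup N'] [AddCommGroup T']
    {degB : ℤ → AddSubgroup B} {degN : ℤ → AddSubgroup N} {mk : B → N → T}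
    {degB' : ℤ → AddSubgroup B'} {degN' : ℤ → AddSubgroup N'} {mk' : B' → N' → T'}
    (F : T →+ T') {d : ℤ}
    (h : ∀ a c b n, b ∈ degB a → n ∈ degN c → ∃ b' ∈ degB' a, ∃ n' ∈ degN' c,
      F (mk b n) = mk' b' n') {t : T} (ht : t ∈ tensorDeg degB degN mk d) :
    F t ∈ tensorDeg degB' degN' mk' d := by
  have := tensorDeg_map (degB' := degB') (degN' := degN') (mk' := mk') F (e := 0)
    (by simpa using h) ht
  rwa [zero_add] at this

end TensorMap

section EF

variable {A S : Type u} [Ring A] [Ring S]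

/-- A degree preserving ring homomorphism which need not send `1` to `1`;
it sends `1` to an idempotent of degree `0`. -/
structure GrHom (𝒜 : ℤ → AddSubgroup A) (𝒮 : ℤ → AddSubgroup S) extends A →ₙ+* S where
  map_mem' : ∀ {d : ℤ} {a : A}, a ∈ 𝒜 d → toFun a ∈ 𝒮 d

variable {𝒜 : ℤ → AddSubgroup A} {𝒮 : ℤ → AddSubgroup S}

namespace GrHom

variable (φ : GrHom 𝒜 𝒮)

/-- The idempotent `φ(1)`. -/
def idem : S := φ.toNonUnitalRingHom 1

theorem idem_mul_map (a : A) : φ.idem * φ.toNonUnitalRingHom a = φ.toNonUnitalRingHom a := by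
  rw [idem, ← map_mul, one_mul]

theorem map_mul_idem (a : A) : φ.toNonUnitalRingHom a * φ.idem = φ.toNonUnitalRingHom a := by
  rw [idem, ← map_mul, mul_one]

theorem idem_mul_idem : φ.idem * φ.idem = φ.idem := φ.idem_mul_map 1

theorem idem_mem [GradedRing 𝒜] : φ.idem ∈ 𝒮 0 := φ.map_mem' SetLike.GradedOne.one_mem

/-- `ε M = {m | ε m = m}` for `ε = φ(1)`. -/
def cut (M : Type*) [AddCommGroup M] [Module S M] : AddSubgroup M where
  carrier := {m | φ.idem • m = m}
  zero_mem' := smul_zero _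
  add_mem' {a b} ha hb := by
    simp only [Set.mem_ofPred_eq] at *
    rw [smul_add, ha, hb]
  neg_mem' {a} ha := by
    simp only [Set.mem_ofPred_eq] at *
    rw [smul_neg, ha]

/-- The left `A`-module structure `a • m = φ(a) m` on `ε M`. -/
instance cutModule (M : Type*) [AddCommGroup M] [Module S M] : Module A (φ.cut M) where
  smul a m := ⟨φ.toNonUnitalRingHom a • (m : M), by
    change φ.idem • φ.toNonUnitalRingHom a • (m : M) = _
    rw [smul_smul, idem_mul_map]⟩
  one_smul m := Subtype.ext m.2
  mul_smul a b m := Subtype.ext (by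
    change φ.toNonUnitalRingHom (a * b) • (m : M) =
      φ.toNonUnitalRingHom a • φ.toNonUnitalRingHom b • (m : M)
    rw [map_mul, mul_smul])
  smul_zero a := Subtype.ext (smul_zero _)
  smul_add a m n := Subtype.ext (smul_add _ _ _)
  add_smul a b m := Subtype.ext (by
    change φ.toNonUnitalRingHom (a + b) • (m : M) =
      φ.toNonUnitalRingHom a • (m : M) + φ.toNonUnitalRingHom b • (m : M)
    rw [map_add, add_smul])
  zero_smul m := Subtype.ext (by
    change φ.toNonUnitalRingHom 0 • (m : M) = 0
    rw [map_zero, zero_smul])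

/-- The functor `M ↦ φ(1) M` from graded `S`-modules to graded `A`-modules. -/
def restrict [GradedRing 𝒜] : GrMod.{w} 𝒮 ⥤ GrMod.{w} 𝒜 where
  obj M :=
    { carrier := φ.cut M.carrier
      deg := fun d => (M.deg d).comap (φ.cut M.carrier).subtype
      isInternal := isInternal_retract M.isInternal (φ.cut M.carrier).subtype
        (AddMonoidHom.mk' (fun m => (⟨φ.idem • m, by
          change φ.idem • φ.idem • m = _
          rw [smul_smul, idem_mul_idem]⟩ : φ.cut M.carrier))
          (fun a b => Subtype.ext (smul_add _ _ _)))
        (fun k => Subtype.ext k.2)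
        (fun d m hm => by simpa using M.smul_mem φ.idem_mem hm)
      smul_mem := fun hr hm => M.smul_mem (φ.map_mem' hr) hm }
  map {M N} f :=
    { toLin :=
        { toFun := fun m => ⟨f.toLin m.1, by
            change φ.idem • f.toLin m.1 = _
            rw [← map_smul, m.2]⟩
          map_add' := fun a b => Subtype.ext (map_add f.toLin _ _)
          map_smul' := fun a m => Subtype.ext (map_smul f.toLin _ _) }
      map_deg := fun h => f.map_deg h }

/-- The left ideal `S ε = {s | s ε = s}` for `ε = φ(1)`. -/
def leftIdeal : Submodule S S where
  carrier := {s | s * φ.idem = s}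
  zero_mem' := zero_mul _
  add_mem' {a b} ha hb := by
    simp only [Set.mem_ofPred_eq] at *
    rw [add_mul, ha, hb]
  smul_mem' c a ha := by
    simp only [Set.mem_ofPred_eq, smul_eq_mul] at *
    rw [mul_assoc, ha]

/-- The right `A`-module structure `s · a = s φ(a)` on `S ε`. -/
instance leftIdealModule : Module Aᵐᵒᵖ φ.leftIdeal where
  smul a s := ⟨(s : S) * φ.toNonUnitalRingHom a.unop, by
    change _ * φ.idem = _
    rw [mul_assoc, map_mul_idem]⟩
  one_smul s := Subtype.ext s.2
  mul_smul a b s := Subtype.ext (by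
    change (s : S) * φ.toNonUnitalRingHom (b.unop * a.unop) =
      (s * φ.toNonUnitalRingHom b.unop) * φ.toNonUnitalRingHom a.unop
    rw [map_mul, mul_assoc])
  smul_zero a := Subtype.ext (zero_mul _)
  smul_add a s t := Subtype.ext (add_mul _ _ _)
  add_smul a b s := Subtype.ext (by
    change (s : S) * φ.toNonUnitalRingHom (a.unop + b.unop) = _ * _ + _ * _
    rw [map_add, mul_add])
  zero_smul s := Subtype.ext (by
    change (s : S) * φ.toNonUnitalRingHom 0 = 0
    rw [map_zero, mul_zero])

instance : SMulCommClass S Aᵐᵒᵖ φ.leftIdeal where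
  smul_comm s a t := Subtype.ext (mul_assoc s (t : S) _).symm

/-- The degree `d` part of `S ε`. -/
def leftIdealDeg (d : ℤ) : AddSubgroup φ.leftIdeal :=
  (𝒮 d).comap φ.leftIdeal.subtype.toAddMonoidHom

theorem leftIdealDeg_isInternal [GradedRing 𝒜] [GradedRing 𝒮] :
    DirectSum.IsInternal φ.leftIdealDeg :=
  isInternal_retract (DirectSum.Decomposition.isInternal 𝒮) φ.leftIdeal.subtype.toAddMonoidHom
    (AddMonoidHom.mk' (fun s => (⟨s * φ.idem, by
      change s * φ.idem * φ.idem = _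
      rw [mul_assoc, idem_mul_idem]⟩ : φ.leftIdeal)) (fun a b => Subtype.ext (add_mul _ _ _)))
    (fun k => Subtype.ext k.2)
    (fun d m hm => by simpa using SetLike.GradedMul.mul_mem hm φ.idem_mem)

/-- The functor `N ↦ S φ(1) ⊗_A N` from graded `A`-modules to graded `S`-modules. -/
def induct [GradedRing 𝒜] [GradedRing 𝒮] :
    GrMod.{max u w} 𝒜 ⥤ GrMod.{max u w} 𝒮 where
  obj N :=
    { carrier := BalTensor S A φ.leftIdeal N.carrier
      deg := tensorDeg φ.leftIdealDeg N.deg BalTensor.tmul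
      isInternal := BalTensor.isInternal (DirectSum.Decomposition.isInternal 𝒜)
        φ.leftIdealDeg_isInternal N.isInternal
        (fun hr hb => SetLike.GradedMul.mul_mem (A := 𝒮) hb (φ.map_mem' hr)) N.smul_mem
      smul_mem := fun {a b r m} hr hm =>
        tensorDeg_map (degB' := φ.leftIdealDeg) (degN' := N.deg) (mk' := BalTensor.tmul)
          (DistribSMul.toAddMonoidHom _ r)
          (fun _ _ x n hx hn => ⟨r • x, SetLike.GradedMul.mul_mem (A := 𝒮) hr hx, n, hn, rfl⟩) hm }
  map {M N} f :=
    { toLin := BalTensor.map S A φ.leftIdeal f.toLin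
      map_deg := fun hm =>
        tensorDeg_map' (degB' := φ.leftIdealDeg) (degN' := N.deg) (mk' := BalTensor.tmul)
          (BalTensor.map S A φ.leftIdeal f.toLin).toAddMonoidHom
          (fun _ _ x n hx hn => ⟨x, hx, f.toLin n, f.map_deg hn, rfl⟩) hm }
  map_id M := GrMod.Hom.ext (BalTensor.hom_ext S A _ fun _ _ => rfl)
  map_comp f g := GrMod.Hom.ext (BalTensor.hom_ext S A _ fun _ _ => rfl)

end GrHom

end EF

section Poly

open Polynomial

variable {k : Type u} [CommRing k]

/-- The grading of `k[t]` over a graded ring `k`, with `t` of degree `w`. -/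
noncomputable def polyDeg (𝓀 : ℤ → AddSubgroup k) (w : ℤ) (d : ℤ) : AddSubgroup k[X] where
  carrier := {f | ∀ p : ℕ, f.coeff p ∈ 𝓀 (d - w * p)}
  zero_mem' p := by simp
  add_mem' ha hb p := by simpa using add_mem (ha p) (hb p)
  neg_mem' ha p := by simpa using ha p

theorem polyDeg_isInternal (𝓀 : ℤ → AddSubgroup k) [GradedRing 𝓀] (w : ℤ) :
    DirectSum.IsInternal (polyDeg 𝓀 w) := by
  classical
  obtain ⟨δ, hδ⟩ := exists_coaction (DirectSum.Decomposition.isInternal 𝓀)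
  let mono : ℕ → ℤ → k →+ (ℤ →₀ k[X]) := fun p d =>
    (Finsupp.singleAddHom (d + w * p)).comp (Polynomial.monomial p).toAddMonoidHom
  let g : ℕ → k →+ (ℤ →₀ k[X]) := fun p => (Finsupp.liftAddHom (mono p)).comp δ
  let G : k[X] →+ (ℤ →₀ k[X]) :=
    AddMonoidHom.mk' (fun f => f.sum fun p c => g p c)
      (fun a b => Polynomial.sum_add_index a b _ (fun _ => map_zero _) (fun _ _ _ => map_add _ _ _))
  have hG : ∀ p c, G (Polynomial.monomial p c) = g p c := by
    intro p c
    exact Polynomial.sum_monomial_index c _ (map_zero _)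
  have hg : ∀ p d c, c ∈ 𝓀 d → g p c = Finsupp.single (d + w * p) (Polynomial.monomial p c) := by
    intro p d c hc
    simp [g, mono, hδ d c hc]
  refine isInternal_of_coaction _ ?_ G ?_
  · intro f
    induction f using Polynomial.induction_on' with
    | add f g hf hg => exact add_mem hf hg
    | monomial p c =>
      induction mem_iSup_of_isInternal (DirectSum.Decomposition.isInternal 𝓀) c using
          AddSubgroup.iSup_induction' with
      | h1 => simp
      | hadd a b _ _ ha hb => rw [map_add]; exact add_mem ha hb
      | hp d c hc =>
        refine AddSubgroup.mem_iSup_of_mem (d + w * p) fun r => ?_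
        rw [Polynomial.coeff_monomial]
        split_ifs with h
        · subst h; simpa using hc
        · exact zero_mem _
  · intro d f hf
    conv_lhs => rw [f.as_sum_support]
    conv_rhs => rw [f.as_sum_support]
    rw [map_sum, ← Finsupp.singleAddHom_apply, map_sum]
    refine Finset.sum_congr rfl fun p _ => ?_
    rw [hG, hg p _ _ (hf p)]
    simp

variable {A : Type u} [Ring A] [Algebra k A] {𝒜 : ℤ → AddSubgroup A}

/-- A left module over a `k`-algebra `A`, regarded as a `k`-module as well. -/
def Scal (_k _A M : Type*) : Type _ := M

namespace Scal

variable (k A M : Type*) [CommRing k] [Ring A] [Algebra k A] [AddCommGroup M] [Module A M]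

instance : AddCommGroup (Scal k A M) := inferInstanceAs (AddCommGroup M)

instance : Module A (Scal k A M) := inferInstanceAs (Module A M)

/-- `c • m = (c 1_A) • m`. -/
instance : Module k (Scal k A M) := Module.compHom (Scal k A M) (algebraMap k A)

instance : SMulCommClass k A (Scal k A M) where
  smul_comm c a m := by
    change algebraMap k A c • a • m = a • algebraMap k A c • m
    rw [smul_smul, smul_smul, Algebra.commutes]

instance : SMulCommClass A k (Scal k A M) := SMulCommClass.symm _ _ _

instance : IsScalarTower k A (Scal k A M) where
  smul_assoc c a m := by
    change (c • a) • m = algebraMap k A c • a • m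
    rw [smul_smul, Algebra.smul_def]

end Scal

/-- `M ⊗_k k[t]` for a left `A`-module `M` over a `k`-algebra `A`; here `A` acts on the left
factor. -/
abbrev PolyTensor (k A M : Type*) [CommRing k] [Ring A] [Algebra k A] [AddCommGroup M]
    [Module A M] : Type _ := Scal k A M ⊗[k] k[X]

namespace PolyTensor

variable (k A : Type*) [CommRing k] [Ring A] [Algebra k A]
  {M N : Type*} [AddCommGroup M] [Module A M] [AddCommGroup N] [Module A N]

/-- The pure tensor `m ⊗ f`. -/
noncomputable def tmul (m : M) (f : k[X]) : PolyTensor k A M := (show Scal k A M from m) ⊗ₜ[k] f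

theorem smul_tmul (a : A) (m : M) (f : k[X]) : a • tmul k A m f = tmul k A (a • m) f := rfl

/-- The biadditive map `(m, f) ↦ m ⊗ f`. -/
noncomputable def mkHom : M →+ k[X] →+ PolyTensor k A M :=
  AddMonoidHom.mk' (fun m => AddMonoidHom.mk' (fun f => tmul k A m f)
    (fun x y => TensorProduct.tmul_add (show Scal k A M from m) x y))
    (fun x y => AddMonoidHom.ext fun f => TensorProduct.add_tmul (show Scal k A M from x) y f)

theorem balance (m : M) (c : k) (f : k[X]) :
    tmul k A (algebraMap k A c • m) f = tmul k A m (c • f) :=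
  TensorProduct.smul_tmul c (show Scal k A M from m) f

theorem closure_tmul :
    AddSubgroup.closure {t : PolyTensor k A M | ∃ (m : M) (f : k[X]), t = mkHom k A m f} = ⊤ := by
  rw [eq_top_iff]
  intro t _
  induction t using TensorProduct.induction_on with
  | zero => exact zero_mem _
  | tmul b n => exact AddSubgroup.subset_closure ⟨b, n, rfl⟩
  | add x y hx hy => exact add_mem (hx trivial) (hy trivial)

theorem lift_exists {P : Type*} [AddCommGroup P] (f : M →+ k[X] →+ P)
    (hf : ∀ m (c : k) p, f (algebraMap k A c • m) p = f m (c • p)) :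
    ∃ g : PolyTensor k A M →+ P, ∀ m p, g (tmul k A m p) = f m p :=
  ⟨TensorProduct.liftAddHom (M := Scal k A M) f fun c m p => hf m c p, fun m p =>
    TensorProduct.liftAddHom_tmul (M := Scal k A M) _ _ m p⟩

variable {A} in
/-- The map `m ⊗ p ↦ f(m) ⊗ p`. -/
noncomputable def map (f : M →ₗ[A] N) : PolyTensor k A M →ₗ[A] PolyTensor k A N :=
  TensorProduct.AlgebraTensorModule.map
    ({ toFun := f
       map_add' := map_add f
       map_smul' := map_smul f } : Scal k A M →ₗ[A] Scal k A N) (LinearMap.id : k[X] →ₗ[k] k[X])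

theorem map_tmul (f : M →ₗ[A] N) (m : M) (p : k[X]) :
    map k f (tmul k A m p) = tmul k A (f m) p := rfl

variable {k A} in
theorem hom_ext {P : Type*} [AddCommGroup P] [Module A P] {f g : PolyTensor k A M →ₗ[A] P}
    (h : ∀ m p, f (tmul k A m p) = g (tmul k A m p)) : f = g := by
  refine LinearMap.ext fun t => ?_
  induction t using TensorProduct.induction_on with
  | zero => exact (map_zero f).trans (map_zero g).symm
  | tmul b n => exact h b n
  | add x y hx hy => exact (map_add f x y).trans ((congrArg₂ _ hx hy).trans (map_add g x y).symm)

end PolyTensor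

/-- The functor `M ↦ M ⊗_k k[t]` on graded `A`-modules, for a graded `k`-algebra `A` and an
indeterminate `t` of degree `wt`. -/
noncomputable def polyFunctor (𝓀 : ℤ → AddSubgroup k) [GradedRing 𝓀]
    (hk : ∀ {d : ℤ} {c : k}, c ∈ 𝓀 d → algebraMap k A c ∈ 𝒜 d) (wt : ℤ) :
    GrMod.{max u w} 𝒜 ⥤ GrMod.{max u w} 𝒜 where
  obj M :=
    { carrier := PolyTensor k A M.carrier
      deg := tensorDeg M.deg (polyDeg 𝓀 wt) (PolyTensor.tmul k A)
      isInternal := by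
        refine tensorDeg_isInternal M.isInternal (polyDeg_isInternal 𝓀 wt) (PolyTensor.mkHom k A)
          (PolyTensor.closure_tmul k A) (ι := {p : ℤ × k // p.2 ∈ 𝓀 p.1})
          (fun r => DistribSMul.toAddMonoidHom M.carrier (algebraMap k A r.1.2))
          (fun r => DistribSMul.toAddMonoidHom k[X] r.1.2) (fun r => r.1.1)
          (fun r a b hb => by rw [add_comm]; exact M.smul_mem (hk r.2) hb)
          (fun r c f hf p => ?_) (fun r m f => PolyTensor.balance k A m r.1.2 f) ?_
        · have := SetLike.GradedMul.mul_mem r.2 (hf p)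
          rw [← add_sub_assoc] at this
          simpa using this
        · intro f hf
          refine PolyTensor.lift_exists k A f fun m c p => ?_
          induction mem_iSup_of_isInternal (DirectSum.Decomposition.isInternal 𝓀) c using
              AddSubgroup.iSup_induction' with
          | hp d c hc => exact hf ⟨(d, c), hc⟩ m p
          | h1 => simp
          | hadd x y _ _ hx hy => simp only [map_add, add_smul, AddMonoidHom.add_apply, hx, hy]
      smul_mem := fun {a b r m} hr hm =>
        tensorDeg_map (degB' := M.deg) (degN' := polyDeg 𝓀 wt) (mk' := PolyTensor.tmul k A)
          (DistribSMul.toAddMonoidHom _ r)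
          (fun _ _ x n hx hn => ⟨r • x, M.smul_mem hr hx, n, hn, rfl⟩) hm }
  map {M N} f :=
    { toLin := PolyTensor.map k f.toLin
      map_deg := fun hm =>
        tensorDeg_map' (degB' := N.deg) (degN' := polyDeg 𝓀 wt) (mk' := PolyTensor.tmul k A)
          (PolyTensor.map k f.toLin).toAddMonoidHom
          (fun _ _ x n hx hn => ⟨f.toLin x, f.map_deg hx, n, hn, rfl⟩) hm }
  map_id M := GrMod.Hom.ext (PolyTensor.hom_ext fun _ _ => rfl)
  map_comp f g := GrMod.Hom.ext (PolyTensor.hom_ext fun _ _ => rfl)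

end Poly

section Poly2

theorem exists_ringCoaction {k : Type*} [CommRing k] (𝓀 : ℤ → AddSubgroup k) [GradedRing 𝓀] :
    ∃ δ : k →+* AddMonoidAlgebra k ℤ, ∀ d, ∀ c ∈ 𝓀 d, δ c = AddMonoidAlgebra.single d c := by
  have hint := DirectSum.Decomposition.isInternal 𝓀
  obtain ⟨δ, hδ⟩ := exists_coaction hint
  let δ' : k →+ AddMonoidAlgebra k ℤ := AddMonoidAlgebra.coeffAddEquiv.symm.toAddMonoidHom.comp δ
  have h' : ∀ d, ∀ c ∈ 𝓀 d, δ' c = AddMonoidAlgebra.single d c := by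
    intro d c hc
    simp [δ', hδ d c hc]
  refine ⟨{ δ' with map_one' := ?_, map_mul' := ?_ }, h'⟩
  · exact h' 0 1 SetLike.GradedOne.one_mem
  · intro a b
    change δ' (a * b) = δ' a * δ' b
    induction mem_iSup_of_isInternal hint a using AddSubgroup.iSup_induction' with
    | h1 => simp
    | hadd x y _ _ hx hy => rw [add_mul, map_add, map_add, hx, hy, add_mul]
    | hp d a ha =>
      induction mem_iSup_of_isInternal hint b using AddSubgroup.iSup_induction' with
      | h1 => simp
      | hadd x y _ _ hx hy => rw [mul_add, map_add, map_add, hx, hy, mul_add]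
      | hp e b hb =>
        rw [h' _ _ ha, h' _ _ hb, h' _ _ (SetLike.GradedMul.mul_mem ha hb),
          AddMonoidAlgebra.single_mul_single]

theorem mem_of_ringCoaction {k : Type*} [CommRing k] {𝓀 : ℤ → AddSubgroup k} [GradedRing 𝓀]
    {δ : k →+* AddMonoidAlgebra k ℤ} (hδ : ∀ d, ∀ c ∈ 𝓀 d, δ c = AddMonoidAlgebra.single d c)
    (c : k) (d : ℤ) : (δ c).coeff d ∈ 𝓀 d := by
  induction mem_iSup_of_isInternal (DirectSum.Decomposition.isInternal 𝓀) c using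
      AddSubgroup.iSup_induction' with
  | h1 => simp
  | hadd x y _ _ hx hy => simpa using add_mem hx hy
  | hp e c hc =>
    rw [hδ e c hc, AddMonoidAlgebra.coeff_single]
    by_cases h : e = d
    · subst h; rwa [Finsupp.single_eq_same]
    · rw [Finsupp.single_eq_of_ne' h]; exact zero_mem _

theorem coeff_mul_single_add {R : Type*} [Semiring R] (x : AddMonoidAlgebra R ℤ) (e D : ℤ)
    (r : R) : (x * AddMonoidAlgebra.single D r).coeff (e + D) = x.coeff e * r :=
  AddMonoidAlgebra.coeff_mul_single_eq_coeff_mul e fun _ _ => by omega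

open MvPolynomial

variable {k : Type*} [CommRing k]

/-- Homogeneity of degree `N` of a polynomial over a graded ring, the variables having weights
`wt`. -/
def IsHomog (𝓀 : ℤ → AddSubgroup k) {m : ℕ} (wt : Fin m → ℤ) (N : ℤ)
    (f : MvPolynomial (Fin m) k) : Prop :=
  ∀ s : Fin m →₀ ℕ, f.coeff s ∈ 𝓀 (N - ∑ j, wt j * s j)

theorem isHomog_iff (𝓀 : ℤ → AddSubgroup k) [GradedRing 𝓀] {m : ℕ} (wt : Fin m → ℤ) :
    ∃ θ : MvPolynomial (Fin m) k →+* AddMonoidAlgebra (MvPolynomial (Fin m) k) ℤ,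
      ∀ N f, IsHomog 𝓀 wt N f ↔ θ f = AddMonoidAlgebra.single N f := by
  obtain ⟨δ, hδ⟩ := exists_ringCoaction 𝓀
  let κ : k →+* AddMonoidAlgebra (MvPolynomial (Fin m) k) ℤ :=
    (AddMonoidAlgebra.mapRingHom ℤ C).comp δ
  let θ := eval₂Hom κ fun j => AddMonoidAlgebra.single (wt j) (X j : MvPolynomial (Fin m) k)
  have hpow : ∀ s : Fin m →₀ ℕ, (s.prod fun j e =>
      (AddMonoidAlgebra.single (wt j) (X j : MvPolynomial (Fin m) k)) ^ e) =
      AddMonoidAlgebra.single (∑ j, wt j * s j) (monomial s 1) := by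
    intro s
    rw [monomial_eq, C_1, one_mul, Finsupp.prod_fintype _ _ (by simp),
      Finsupp.prod_fintype _ _ (by simp)]
    simp only [AddMonoidAlgebra.single_pow]
    have : ∀ S : Finset (Fin m), ∏ x ∈ S, AddMonoidAlgebra.single (s x • wt x)
        ((X x : MvPolynomial (Fin m) k) ^ s x) =
        AddMonoidAlgebra.single (∑ j ∈ S, wt j * s j) (∏ x ∈ S, X x ^ s x) := by
      classical
      intro S
      induction S using Finset.induction_on with
      | empty => rfl
      | insert a S ha ih =>
        rw [Finset.prod_insert ha, Finset.prod_insert ha, Finset.sum_insert ha, ih,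
          AddMonoidAlgebra.single_mul_single]
        congr 2
        rw [nsmul_eq_mul, mul_comm]
    exact this _
  have hmono : ∀ s c, θ (monomial s c) =
      AddMonoidAlgebra.mapRingHom ℤ C (δ c) *
        AddMonoidAlgebra.single (∑ j, wt j * s j) (monomial s 1) := by
    intro s c
    rw [← hpow]
    simp [θ, κ]
  have hcoeff : ∀ f s N, coeff s ((θ f).coeff N) = (δ (coeff s f)).coeff (N - ∑ j, wt j * s j) := by
    intro f s N
    induction f using MvPolynomial.induction_on' with
    | monomial t c =>
      rw [hmono, ← sub_add_cancel N (∑ j, wt j * t j), coeff_mul_single_add]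
      simp only [coeff_monomial]
      rw [AddMonoidAlgebra.coeff_mapRingHom, coeff_C_mul, coeff_monomial]
      split_ifs with h
      · subst h; simp
      · simp
    | add f g hf hg => simp [hf, hg]
  refine ⟨θ, fun N f => ⟨fun h => ?_, fun h s => ?_⟩⟩
  · ext D s
    rw [hcoeff, hδ _ _ (h s), AddMonoidAlgebra.coeff_single, AddMonoidAlgebra.coeff_single]
    by_cases hD : N = D
    · subst hD; simp
    · rw [Finsupp.single_eq_of_ne' hD, Finsupp.single_eq_of_ne' (by omega)]; simp
  · have := hcoeff f s N
    rw [h, AddMonoidAlgebra.coeff_single, Finsupp.single_eq_same] at this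
    rw [this]
    exact mem_of_ringCoaction hδ _ _

theorem isRegular_X_sub_X {σ : Type*} {a b : σ} (h : a ≠ b) :
    IsRegular (X a - X b : MvPolynomial σ k) := by
  classical
  let f : MvPolynomial σ k →ₐ[k] MvPolynomial σ k :=
    aeval fun c => if c = a then X a + X b else X c
  let g : MvPolynomial σ k →ₐ[k] MvPolynomial σ k :=
    aeval fun c => if c = a then X a - X b else X c
  have hgf : ∀ p, g (f p) = p := by
    intro p
    have : g.comp f = AlgHom.id k _ := by
      ext c : 1
      by_cases hc : c = a
      · subst hc; simp [f, g, h.symm]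
      · simp [f, g, hc]
    exact DFunLike.congr_fun this p
  have hinj : Function.Injective f := Function.LeftInverse.injective hgf
  have hf : f (X a - X b) = X a := by simp [f, h.symm]
  have : IsLeftRegular (X a - X b : MvPolynomial σ k) := by
    intro p q hpq
    apply hinj
    have := congrArg f hpq
    simp only [map_mul, hf] at this
    exact isRegular_X.left this
  exact ⟨this, (Commute.isRightRegular_iff (fun b => mul_comm _ b)).2 this⟩

/-- Exact division: the polynomial `q` with `q * g = f`. -/
noncomputable def exactDiv {σ : Type*} (f g : MvPolynomial σ k) : MvPolynomial σ k :=
  open Classical in if h : ∃ q, q * g = f then h.choose else 0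

theorem exactDiv_mul {σ : Type*} {f g : MvPolynomial σ k} (h : g ∣ f) : exactDiv f g * g = f := by
  have h' : ∃ q, q * g = f := by
    obtain ⟨q, rfl⟩ := h
    exact ⟨q, mul_comm _ _⟩
  rw [exactDiv, dif_pos h']
  exact h'.choose_spec

theorem isHomog_exactDiv {𝓀 : ℤ → AddSubgroup k} [GradedRing 𝓀] {m : ℕ} {wt : Fin m → ℤ}
    {N D : ℤ} {f g : MvPolynomial (Fin m) k} (hf : IsHomog 𝓀 wt (N + D) f)
    (hg : IsHomog 𝓀 wt D g) (hr : IsRegular g) : IsHomog 𝓀 wt N (exactDiv f g) := by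
  by_cases h : g ∣ f
  · obtain ⟨θ, hθ⟩ := isHomog_iff 𝓀 wt
    rw [hθ] at hf hg ⊢
    have h1 := congrArg θ (exactDiv_mul h)
    rw [map_mul, hf, hg] at h1
    refine AddMonoidAlgebra.ext (Finsupp.ext fun e => hr.right ?_)
    change _ * g = _ * g
    have h2 := congrArg (fun t => t.coeff (e + D)) h1
    simp only [coeff_mul_single_add] at h2
    simp only [h2]
    rw [AddMonoidAlgebra.coeff_single, AddMonoidAlgebra.coeff_single]
    by_cases he : N = e
    · subst he; simp [exactDiv_mul h]
    · rw [Finsupp.single_eq_of_ne' he, Finsupp.single_eq_of_ne' (by omega), zero_mul]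
  · intro s
    have h' : ¬ ∃ q, q * g = f := fun ⟨q, hq⟩ => h ⟨q, by rw [← hq, mul_comm]⟩
    rw [exactDiv, dif_neg h']
    simp

theorem IsHomog.mul {𝓀 : ℤ → AddSubgroup k} [GradedRing 𝓀] {m : ℕ} {wt : Fin m → ℤ}
    {N D : ℤ} {f g : MvPolynomial (Fin m) k} (hf : IsHomog 𝓀 wt N f)
    (hg : IsHomog 𝓀 wt D g) : IsHomog 𝓀 wt (N + D) (f * g) := by
  obtain ⟨θ, hθ⟩ := isHomog_iff 𝓀 wt
  rw [hθ] at *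
  rw [map_mul, hf, hg, AddMonoidAlgebra.single_mul_single]

theorem IsHomog.add {𝓀 : ℤ → AddSubgroup k} {m : ℕ} {wt : Fin m → ℤ}
    {N : ℤ} {f g : MvPolynomial (Fin m) k} (hf : IsHomog 𝓀 wt N f)
    (hg : IsHomog 𝓀 wt N g) : IsHomog 𝓀 wt N (f + g) := fun s => by
  simpa using add_mem (hf s) (hg s)

theorem IsHomog.neg {𝓀 : ℤ → AddSubgroup k} {m : ℕ} {wt : Fin m → ℤ}
    {N : ℤ} {f : MvPolynomial (Fin m) k} (hf : IsHomog 𝓀 wt N f) : IsHomog 𝓀 wt N (-f) := fun s => by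
  simpa using hf s

theorem IsHomog.sub {𝓀 : ℤ → AddSubgroup k} {m : ℕ} {wt : Fin m → ℤ}
    {N : ℤ} {f g : MvPolynomial (Fin m) k} (hf : IsHomog 𝓀 wt N f)
    (hg : IsHomog 𝓀 wt N g) : IsHomog 𝓀 wt N (f - g) := fun s => by
  simpa using sub_mem (hf s) (hg s)

theorem isHomog_X {𝓀 : ℤ → AddSubgroup k} [GradedRing 𝓀] {m : ℕ} (wt : Fin m → ℤ) (j : Fin m) :
    IsHomog 𝓀 wt (wt j) (X j) := by
  intro s
  rw [coeff_X]
  split_ifs with h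
  · subst h
    have : wt j - ∑ i, wt i * ((Finsupp.single j 1 : Fin m →₀ ℕ) i : ℤ) = 0 := by
      rw [Finset.sum_eq_single j] <;> simp +contextual [Finsupp.single_apply, eq_comm]
    rw [this]
    exact SetLike.GradedOne.one_mem
  · exact zero_mem _

/-- Substituting variables preserves homogeneity. -/
theorem IsHomog.aeval {𝓀 : ℤ → AddSubgroup k} [GradedRing 𝓀] {m m' : ℕ} {wt : Fin m → ℤ}
    {wt' : Fin m' → ℤ} {N : ℤ} {f : MvPolynomial (Fin m) k} (hf : IsHomog 𝓀 wt N f)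
    (σ : Fin m → Fin m') (h : ∀ j, wt' (σ j) = wt j) :
    IsHomog 𝓀 wt' N (MvPolynomial.aeval (fun j => (X (σ j) : MvPolynomial (Fin m') k)) f) := by
  have hC : ∀ d, ∀ c ∈ 𝓀 d, IsHomog 𝓀 wt' d (C c) := by
    intro d c hc s
    rw [coeff_C]
    split_ifs with h
    · subst h; simpa using hc
    · exact zero_mem _
  have hpow : ∀ (j : Fin m') (e : ℕ), IsHomog 𝓀 wt' (wt' j * e) (X j ^ e) := by
    intro j e
    induction e with
    | zero => simpa using hC 0 1 SetLike.GradedOne.one_mem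
    | succ e ih =>
      have := ih.mul (isHomog_X wt' j)
      rw [pow_succ]
      convert this using 1
      push_cast; ring
  have hprod : ∀ (s : Fin m →₀ ℕ) (S : Finset (Fin m)), IsHomog 𝓀 wt' (∑ j ∈ S, wt j * s j)
      (∏ j ∈ S, (X (σ j) : MvPolynomial (Fin m') k) ^ s j) := by
    classical
    intro s S
    induction S using Finset.induction_on with
    | empty => simpa using hC 0 1 SetLike.GradedOne.one_mem
    | insert a S ha ih =>
      rw [Finset.prod_insert ha, Finset.sum_insert ha, ← h]
      exact (hpow _ _).mul ih
  have key : ∀ S : Finset (Fin m →₀ ℕ), IsHomog 𝓀 wt' N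
      (∑ s ∈ S, MvPolynomial.aeval (fun j => (X (σ j) : MvPolynomial (Fin m') k))
        (monomial s (f.coeff s))) := by
    classical
    intro S
    induction S using Finset.induction_on with
    | empty => intro s; simp
    | insert a S ha ih =>
      rw [Finset.sum_insert ha]
      refine IsHomog.add ?_ ih
      rw [aeval_monomial, Finsupp.prod_fintype _ _ (by simp)]
      have := (hC _ _ (hf a)).mul (hprod a Finset.univ)
      rwa [sub_add_cancel] at this
  have := key f.support
  rwa [← map_sum, ← f.as_sum] at this

theorem X_sub_X_dvd {σ : Type*} [DecidableEq σ] {a b : σ} {f : MvPolynomial σ k}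
    (h : MvPolynomial.aeval (fun c => if c = a then (X b : MvPolynomial σ k) else X c) f = 0) :
    X a - X b ∣ f := by
  have key : ∀ p : MvPolynomial σ k, X a - X b ∣
      p - MvPolynomial.aeval (fun c => if c = a then (X b : MvPolynomial σ k) else X c) p := by
    intro p
    induction p using MvPolynomial.induction_on with
    | C c => simp
    | add p q hp hq =>
      rw [map_add, add_sub_add_comm]
      exact dvd_add hp hq
    | mul_X p c hp =>
      rw [map_mul, aeval_X]
      have h1 : X a - X b ∣ (X c : MvPolynomial σ k) - if c = a then X b else X c := by
        split_ifs with hc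
        · rw [hc]
        · simp
      obtain ⟨u, hu⟩ := hp
      obtain ⟨v, hv⟩ := h1
      refine ⟨u * X c + MvPolynomial.aeval
        (fun c => if c = a then (X b : MvPolynomial σ k) else X c) p * v, ?_⟩
      linear_combination (X c) * hu + MvPolynomial.aeval
        (fun c => if c = a then (X b : MvPolynomial σ k) else X c) p * hv
  have := key f
  rwa [h, sub_zero] at this

end Poly2

section Data

/-- A symmetrizable Borcherds-Cartan matrix `a` indexed by `I`, with positive integers `d i` such
that `diag(d) a` is symmetric. -/
structure BorcherdsCartan (I : Type u) where
  a : I → I → ℤ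
  d : I → ℤ
  a_diag : ∀ i, a i i = 2 ∨ (a i i ≤ 0 ∧ Even (a i i))
  a_off_diag : ∀ i j, i ≠ j → a i j ≤ 0
  a_eq_zero : ∀ i j, a i j = 0 ↔ a j i = 0
  d_pos : ∀ i, 0 < d i
  symm : ∀ i j, d i * a i j = d j * a j i

/-- The symmetric form `(α_i | α_j) = d_i a_ij`. -/
def BorcherdsCartan.form {I : Type u} (C : BorcherdsCartan I) (i j : I) : ℤ := C.d i * C.a i j

open MvPolynomial

/-- The polynomials `Q_ij(u, v) = ∑ t_ij^{pq} u^p v^q` and `P_i(u, v) = ∑ w_i^{pq} u^p v^q` over a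
graded commutative ring `k`; the exponents are `p = s 0` and `q = s 1`. -/
structure Params {k I : Type u} [CommRing k] (C : BorcherdsCartan I) (𝓀 : ℤ → AddSubgroup k) where
  Q : I → I → MvPolynomial (Fin 2) k
  P : I → MvPolynomial (Fin 2) k
  Q_symm : ∀ i j, Q i j = aeval ![X 1, X 0] (Q j i)
  Q_self : ∀ i, Q i i = 0
  Q_support : ∀ i j, i ≠ j → ∀ s, (Q i j).coeff s ≠ 0 → C.d i * s 0 + C.d j * s 1 ≤ - C.form i j
  Q_mem : ∀ i j, i ≠ j → ∀ s,
    (Q i j).coeff s ∈ 𝓀 (-2 * (C.form i j + C.d i * s 0 + C.d j * s 1))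
  Q_unit : ∀ i j, i ≠ j → ∃ c ∈ 𝓀 0, (Q i j).coeff (Finsupp.single 0 (-C.a i j).toNat) * c = 1
  P_support : ∀ i s, (P i).coeff s ≠ 0 → (s 0 + s 1 : ℤ) ≤ 1 - C.a i i / 2
  P_mem : ∀ i s, (P i).coeff s ∈ 𝓀 (2 * C.d i * (1 - s 0 - s 1 - C.a i i / 2))
  P_unit_left : ∀ i, ∃ c ∈ 𝓀 0,
    (P i).coeff (Finsupp.single 0 (1 - C.a i i / 2).toNat) * c = 1
  P_unit_right : ∀ i, ∃ c ∈ 𝓀 0,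
    (P i).coeff (Finsupp.single 1 (1 - C.a i i / 2).toNat) * c = 1

variable {k I : Type u} [CommRing k] {C : BorcherdsCartan I} {𝓀 : ℤ → AddSubgroup k}

namespace Params

variable (p : Params C 𝓀)

/-- `P_i(x_a, x_b)`. -/
noncomputable def Pat {m : ℕ} (i : I) (a b : Fin m) : MvPolynomial (Fin m) k :=
  aeval (fun j => X (![a, b] j)) (p.P i)

/-- `Q_ij(x_a, x_b)`. -/
noncomputable def Qat {m : ℕ} (i j : I) (a b : Fin m) : MvPolynomial (Fin m) k :=
  aeval (fun j => X (![a, b] j)) (p.Q i j)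

/-- `∂ P_i (u, v) = (P_i(v, u) - P_i(u, v)) / (u - v)`. -/
noncomputable def dP (i : I) : MvPolynomial (Fin 2) k :=
  exactDiv (p.Pat i 1 0 - p.Pat i 0 1) (X 0 - X 1)

/-- `(Q_ij(u, v) - Q_ij(w, v)) / (u - w)`. -/
noncomputable def Qbar (i j : I) : MvPolynomial (Fin 3) k :=
  exactDiv (p.Qat i j 0 1 - p.Qat i j 2 1) (X 0 - X 2)

/-- The common denominator `(u - v) (u - w) (v - w)`. -/
noncomputable def vand : MvPolynomial (Fin 3) k := (X 0 - X 1) * (X 0 - X 2) * (X 1 - X 2)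

/-- The numerator of `P'` over the common denominator. -/
noncomputable def num' (i : I) : MvPolynomial (Fin 3) k :=
  p.Pat i 1 0 * p.Pat i 0 2 * (X 1 - X 2) + p.Pat i 0 2 * p.Pat i 1 2 * (X 0 - X 1)
    - p.Pat i 0 1 * p.Pat i 1 2 * (X 0 - X 2)

/-- The numerator of `P''` over the common denominator. -/
noncomputable def num'' (i : I) : MvPolynomial (Fin 3) k :=
  - (p.Pat i 0 1 * p.Pat i 0 2 * (X 1 - X 2)) - p.Pat i 0 2 * p.Pat i 2 1 * (X 0 - X 1)
    + p.Pat i 0 1 * p.Pat i 1 2 * (X 0 - X 2)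

/-- `P'(u,v,w) = P(v,u)P(u,w)/((u-v)(u-w)) + P(u,w)P(v,w)/((u-w)(v-w)) - P(u,v)P(v,w)/((u-v)(v-w))`
for `P = P_i`. -/
noncomputable def Pbar' (i : I) : MvPolynomial (Fin 3) k := exactDiv (p.num' i) vand

/-- `P''(u,v,w) = - P(u,v)P(u,w)/((u-v)(u-w)) - P(u,w)P(w,v)/((u-w)(v-w))
+ P(u,v)P(v,w)/((u-v)(v-w))` for `P = P_i`. -/
noncomputable def Pbar'' (i : I) : MvPolynomial (Fin 3) k := exactDiv (p.num'' i) vand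

theorem aeval_Pat {m : ℕ} (i : I) (a b : Fin m) (σ : Fin m → Fin m) :
    aeval (fun c => (X (σ c) : MvPolynomial (Fin m) k)) (p.Pat i a b) =
      p.Pat i (σ a) (σ b) := by
  rw [Pat, Pat, ← AlgHom.comp_apply]
  congr 1
  ext j : 1
  fin_cases j <;> simp

theorem aeval_Qat {m : ℕ} (i j : I) (a b : Fin m) (σ : Fin m → Fin m) :
    aeval (fun c => (X (σ c) : MvPolynomial (Fin m) k)) (p.Qat i j a b) =
      p.Qat i j (σ a) (σ b) := by
  rw [Qat, Qat, ← AlgHom.comp_apply]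
  congr 1
  ext j : 1
  fin_cases j <;> simp

theorem X_sub_X_dvd' {m : ℕ} {a b : Fin m} {f : MvPolynomial (Fin m) k}
    (h : aeval (fun c => (X (if c = a then b else c) : MvPolynomial (Fin m) k)) f = 0) :
    X a - X b ∣ f := by
  apply X_sub_X_dvd
  rw [← h]
  congr 2
  ext1 c
  split_ifs <;> rfl

theorem dP_mul (i : I) : p.dP i * (X 0 - X 1) = p.Pat i 1 0 - p.Pat i 0 1 := by
  refine exactDiv_mul (X_sub_X_dvd' ?_)
  rw [map_sub, aeval_Pat, aeval_Pat]
  simp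

theorem Qbar_mul (i j : I) : p.Qbar i j * (X 0 - X 2) = p.Qat i j 0 1 - p.Qat i j 2 1 := by
  refine exactDiv_mul (X_sub_X_dvd' ?_)
  rw [map_sub, aeval_Qat, aeval_Qat]
  simp

theorem vand_dvd {f : MvPolynomial (Fin 3) k}
    (h01 : aeval (fun c => (X (if c = 0 then 1 else c) : MvPolynomial (Fin 3) k)) f = 0)
    (h02 : aeval (fun c => (X (if c = 0 then 2 else c) : MvPolynomial (Fin 3) k)) f = 0)
    (h12 : aeval (fun c => (X (if c = 1 then 2 else c) : MvPolynomial (Fin 3) k)) f = 0) :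
    vand ∣ f := by
  obtain ⟨f, rfl⟩ := X_sub_X_dvd' h01
  have h02' : aeval (fun c => (X (if c = 0 then 2 else c) : MvPolynomial (Fin 3) k)) f = 0 := by
    rw [map_mul] at h02
    refine (isRegular_X_sub_X (k := k) (a := (2 : Fin 3)) (b := 1) (by decide)).left ?_
    simpa using h02
  obtain ⟨f, rfl⟩ := X_sub_X_dvd' h02'
  have h12' : aeval (fun c => (X (if c = 1 then 2 else c) : MvPolynomial (Fin 3) k)) f = 0 := by
    rw [map_mul, map_mul] at h12
    have h := isRegular_X_sub_X (k := k) (a := (0 : Fin 3)) (b := 2) (by decide)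
    refine h.left (h.left ?_)
    simpa using h12
  obtain ⟨f, rfl⟩ := X_sub_X_dvd' h12'
  exact ⟨f, by rw [vand]; ring⟩

theorem Pbar'_mul (i : I) : p.Pbar' i * vand = p.num' i := by
  refine exactDiv_mul (vand_dvd ?_ ?_ ?_) <;>
  · simp only [num', map_add, map_sub, map_mul, aeval_Pat, aeval_X]
    simp
    try ring

theorem Pbar''_mul (i : I) : p.Pbar'' i * vand = p.num'' i := by
  refine exactDiv_mul (vand_dvd ?_ ?_ ?_) <;>
  · simp only [num'', map_add, map_sub, map_mul, map_neg, aeval_Pat, aeval_X]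
    simp
    try ring

theorem isHomog_P {wt : Fin 2 → ℤ} {i : I} (h : ∀ j, wt j = 2 * C.d i) :
    IsHomog 𝓀 wt (2 * C.d i - C.form i i) (p.P i) := by
  intro s
  convert p.P_mem i s using 2
  have : 2 * (C.a i i / 2) = C.a i i := by
    rcases C.a_diag i with h | ⟨-, h⟩
    · rw [h]; rfl
    · exact Int.two_mul_ediv_two_of_even h
  rw [Fin.sum_univ_two, BorcherdsCartan.form, h, h]
  linear_combination (C.d i) * this

theorem isHomog_Q {wt : Fin 2 → ℤ} {i j : I} (hij : i ≠ j)
    (h0 : wt 0 = 2 * C.d i) (h1 : wt 1 = 2 * C.d j) :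
    IsHomog 𝓀 wt (-2 * C.form i j) (p.Q i j) := by
  intro s
  convert p.Q_mem i j hij s using 2
  rw [Fin.sum_univ_two, h0, h1]
  ring

theorem isHomog_Pat [GradedRing 𝓀] {m : ℕ} {wt : Fin m → ℤ} {i : I} {a b : Fin m}
    (ha : wt a = 2 * C.d i) (hb : wt b = 2 * C.d i) :
    IsHomog 𝓀 wt (2 * C.d i - C.form i i) (p.Pat i a b) :=
  IsHomog.aeval (p.isHomog_P (wt := fun _ => 2 * C.d i) fun _ => rfl) _ fun j => by
    fin_cases j <;> simp [ha, hb]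

theorem isHomog_Qat [GradedRing 𝓀] {m : ℕ} {wt : Fin m → ℤ} {i j : I} (hij : i ≠ j) {a b : Fin m}
    (ha : wt a = 2 * C.d i) (hb : wt b = 2 * C.d j) :
    IsHomog 𝓀 wt (-2 * C.form i j) (p.Qat i j a b) :=
  IsHomog.aeval (p.isHomog_Q (wt := ![2 * C.d i, 2 * C.d j]) hij rfl rfl) _ fun c => by
    fin_cases c <;> simp [ha, hb]

theorem isHomog_X_sub_X [GradedRing 𝓀] {m : ℕ} {wt : Fin m → ℤ} {D : ℤ} {a b : Fin m}
    (ha : wt a = D) (hb : wt b = D) : IsHomog 𝓀 wt D (X a - X b) := by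
  have h1 := isHomog_X (𝓀 := 𝓀) wt a
  have h2 := isHomog_X (𝓀 := 𝓀) wt b
  rw [ha] at h1
  rw [hb] at h2
  exact h1.sub h2

theorem isHomog_dP [GradedRing 𝓀] {wt : Fin 2 → ℤ} {i : I} (h : ∀ j, wt j = 2 * C.d i) :
    IsHomog 𝓀 wt (- C.form i i) (p.dP i) := by
  refine isHomog_exactDiv (D := 2 * C.d i) ?_ (isHomog_X_sub_X (h _) (h _))
    (isRegular_X_sub_X (by decide))
  rw [show - C.form i i + 2 * C.d i = 2 * C.d i - C.form i i by ring]
  exact (p.isHomog_Pat (h _) (h _)).sub (p.isHomog_Pat (h _) (h _))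

theorem isHomog_Qbar [GradedRing 𝓀] {wt : Fin 3 → ℤ} {i j : I} (hij : i ≠ j)
    (h0 : wt 0 = 2 * C.d i) (h1 : wt 1 = 2 * C.d j) (h2 : wt 2 = 2 * C.d i) :
    IsHomog 𝓀 wt (-2 * C.form i j - 2 * C.d i) (p.Qbar i j) := by
  refine isHomog_exactDiv (D := 2 * C.d i) ?_ (isHomog_X_sub_X h0 h2)
    (isRegular_X_sub_X (by decide))
  rw [sub_add_cancel]
  exact (p.isHomog_Qat hij h0 h1).sub (p.isHomog_Qat hij h2 h1)

theorem isHomog_vand [GradedRing 𝓀] {wt : Fin 3 → ℤ} {i : I} (h : ∀ j, wt j = 2 * C.d i) :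
    IsHomog 𝓀 wt (2 * C.d i + 2 * C.d i + 2 * C.d i) vand :=
  ((isHomog_X_sub_X (h _) (h _)).mul (isHomog_X_sub_X (h _) (h _))).mul
    (isHomog_X_sub_X (h _) (h _))

theorem isRegular_vand : IsRegular (vand : MvPolynomial (Fin 3) k) :=
  ((isRegular_X_sub_X (by decide)).mul (isRegular_X_sub_X (by decide))).mul
    (isRegular_X_sub_X (by decide))

theorem isHomog_Pbar' [GradedRing 𝓀] {wt : Fin 3 → ℤ} {i : I} (h : ∀ j, wt j = 2 * C.d i) :
    IsHomog 𝓀 wt (-2 * C.form i i) (p.Pbar' i) := by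
  refine isHomog_exactDiv ?_ (isHomog_vand h) isRegular_vand
  rw [show -2 * C.form i i + (2 * C.d i + 2 * C.d i + 2 * C.d i) =
    (2 * C.d i - C.form i i) + (2 * C.d i - C.form i i) + 2 * C.d i by ring]
  have hP := fun a b => p.isHomog_Pat (h a) (h b)
  have hX := fun a b => isHomog_X_sub_X (𝓀 := 𝓀) (h a) (h b)
  exact ((((hP _ _).mul (hP _ _)).mul (hX _ _)).add (((hP _ _).mul (hP _ _)).mul (hX _ _))).sub
    (((hP _ _).mul (hP _ _)).mul (hX _ _))

theorem isHomog_Pbar'' [GradedRing 𝓀] {wt : Fin 3 → ℤ} {i : I} (h : ∀ j, wt j = 2 * C.d i) :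
    IsHomog 𝓀 wt (-2 * C.form i i) (p.Pbar'' i) := by
  refine isHomog_exactDiv ?_ (isHomog_vand h) isRegular_vand
  rw [show -2 * C.form i i + (2 * C.d i + 2 * C.d i + 2 * C.d i) =
    (2 * C.d i - C.form i i) + (2 * C.d i - C.form i i) + 2 * C.d i by ring]
  have hP := fun a b => p.isHomog_Pat (h a) (h b)
  have hX := fun a b => isHomog_X_sub_X (𝓀 := 𝓀) (h a) (h b)
  exact ((((hP _ _).mul (hP _ _)).mul (hX _ _)).neg.sub
    (((hP _ _).mul (hP _ _)).mul (hX _ _))).add (((hP _ _).mul (hP _ _)).mul (hX _ _))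

end Params

end Data

section Algebra

/-- The generators `e(ν)`, `x_a` and `τ_l` of `R(n)`; positions are counted from `0`. -/
inductive Gen (I : Type u) (n : ℕ) : Type u
  | e (ν : Fin n → I)
  | x (a : Fin n)
  | tau (l : ℕ) (h : l + 1 < n)

/-- The position `l`. -/
def lo {n : ℕ} (l : ℕ) (h : l + 1 < n) : Fin n := ⟨l, Nat.lt_of_succ_lt h⟩

/-- The position `l + 1`. -/
def hi {n : ℕ} (l : ℕ) (h : l + 1 < n) : Fin n := ⟨l + 1, h⟩

/-- The simple transposition of the positions `l` and `l + 1`. -/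
def swp {n : ℕ} (l : ℕ) (h : l + 1 < n) : Equiv.Perm (Fin n) := Equiv.swap (lo l h) (hi l h)

/-- The value of a polynomial at pairwise commuting elements `z 0, …, z (m - 1)` of a
(noncommutative) `k`-algebra. -/
noncomputable def ev {k A : Type*} [CommRing k] [Ring A] [Algebra k A] {m : ℕ} (z : Fin m → A)
    (f : MvPolynomial (Fin m) k) : A :=
  ∑ s ∈ f.support, algebraMap k A (f.coeff s) * (List.ofFn fun j => z j ^ s j).prod

variable {k I : Type u} [CommRing k] [Fintype I] {C : BorcherdsCartan I} {𝓀 : ℤ → AddSubgroup k}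

/-- The free algebra on the generators. -/
abbrev Fr (k I : Type u) [CommRing k] (n : ℕ) := FreeAlgebra k (Gen I n)

namespace Fr

variable {n : ℕ}

/-- The generator `e(ν)`. -/
def e (ν : Fin n → I) : Fr k I n := FreeAlgebra.ι k (Gen.e ν)
/-- The generator `x_a`. -/
def x (a : Fin n) : Fr k I n := FreeAlgebra.ι k (Gen.x a)
/-- The generator `τ_l`. -/
def t (l : ℕ) (h : l + 1 < n) : Fr k I n := FreeAlgebra.ι k (Gen.tau l h)

end Fr

open Fr in
/-- The defining relations of `R(n)`. -/
inductive KLRel (p : Params C 𝓀) (n : ℕ) : Fr k I n → Fr k I n → Prop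
  | e_mul_self (ν : Fin n → I) : KLRel p n (e ν * e ν) (e ν)
  | e_mul_ne (ν ν' : Fin n → I) (h : ν ≠ ν') : KLRel p n (e ν * e ν') 0
  | e_sum : KLRel p n (∑ ν : Fin n → I, e ν) 1
  | x_comm (a b : Fin n) : KLRel p n (x a * x b) (x b * x a)
  | x_e (a : Fin n) (ν : Fin n → I) : KLRel p n (x a * e ν) (e ν * x a)
  | tau_e (l : ℕ) (h : l + 1 < n) (ν : Fin n → I) :
      KLRel p n (t l h * e ν) (e (ν ∘ swp l h) * t l h)
  | tau_comm (l m : ℕ) (hl : l + 1 < n) (hm : m + 1 < n) (h : l + 1 < m) :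
      KLRel p n (t l hl * t m hm) (t m hm * t l hl)
  | tau_sq_eq (l : ℕ) (h : l + 1 < n) (ν : Fin n → I) (hν : ν (lo l h) = ν (hi l h)) :
      KLRel p n (t l h * t l h * e ν)
        (ev ![x (lo l h), x (hi l h)] (p.dP (ν (lo l h))) * t l h * e ν)
  | tau_sq_ne (l : ℕ) (h : l + 1 < n) (ν : Fin n → I) (hν : ν (lo l h) ≠ ν (hi l h)) :
      KLRel p n (t l h * t l h * e ν)
        (ev ![x (lo l h), x (hi l h)] (p.Q (ν (lo l h)) (ν (hi l h))) * e ν)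
  | tau_x_lo (l : ℕ) (h : l + 1 < n) (ν : Fin n → I) (hν : ν (lo l h) = ν (hi l h)) :
      KLRel p n ((t l h * x (lo l h) - x (hi l h) * t l h) * e ν)
        (-(ev ![x (lo l h), x (hi l h)] (p.P (ν (lo l h))) * e ν))
  | tau_x_hi (l : ℕ) (h : l + 1 < n) (ν : Fin n → I) (hν : ν (lo l h) = ν (hi l h)) :
      KLRel p n ((t l h * x (hi l h) - x (lo l h) * t l h) * e ν)
        (ev ![x (lo l h), x (hi l h)] (p.P (ν (lo l h))) * e ν)
  | tau_x_other (l : ℕ) (h : l + 1 < n) (a : Fin n) (ν : Fin n → I)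
      (hν : ν (lo l h) = ν (hi l h) → a ≠ lo l h ∧ a ≠ hi l h) :
      KLRel p n ((t l h * x a - x (swp l h a) * t l h) * e ν) 0
  | braid_Q (l : ℕ) (h : l + 1 < n) (h' : l + 1 + 1 < n) (ν : Fin n → I)
      (hν : ν (lo l h) = ν (hi (l + 1) h')) (hν' : ν (lo l h) ≠ ν (hi l h)) :
      KLRel p n ((t (l + 1) h' * t l h * t (l + 1) h' - t l h * t (l + 1) h' * t l h) * e ν)
        (ev ![x (lo l h), x (hi (l + 1) h')] (p.P (ν (lo l h))) *
          ev ![x (lo l h), x (hi l h), x (hi (l + 1) h')]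
            (p.Qbar (ν (lo l h)) (ν (hi l h))) * e ν)
  | braid_P (l : ℕ) (h : l + 1 < n) (h' : l + 1 + 1 < n) (ν : Fin n → I)
      (hν : ν (lo l h) = ν (hi (l + 1) h')) (hν' : ν (lo l h) = ν (hi l h)) :
      KLRel p n ((t (l + 1) h' * t l h * t (l + 1) h' - t l h * t (l + 1) h' * t l h) * e ν)
        (ev ![x (lo l h), x (hi l h), x (hi (l + 1) h')] (p.Pbar' (ν (lo l h))) * t l h * e ν +
          ev ![x (lo l h), x (hi l h), x (hi (l + 1) h')] (p.Pbar'' (ν (lo l h))) *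
            t (l + 1) h' * e ν)
  | braid_zero (l : ℕ) (h : l + 1 < n) (h' : l + 1 + 1 < n) (ν : Fin n → I)
      (hν : ν (lo l h) ≠ ν (hi (l + 1) h')) :
      KLRel p n ((t (l + 1) h' * t l h * t (l + 1) h' - t l h * t (l + 1) h' * t l h) * e ν) 0

/-- The Khovanov-Lauda-Rouquier algebra `R(n)`. -/
def Alg (p : Params C 𝓀) (n : ℕ) : Type u := RingQuot (KLRel p n)

namespace Alg

variable (p : Params C 𝓀) (n : ℕ)

noncomputable instance : Ring (Alg p n) := inferInstanceAs (Ring (RingQuot (KLRel p n)))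

noncomputable instance : Algebra k (Alg p n) := inferInstanceAs (Algebra k (RingQuot (KLRel p n)))

/-- The quotient map from the free algebra. -/
noncomputable def proj : Fr k I n →ₐ[k] Alg p n := RingQuot.mkAlgHom k (KLRel p n)

theorem proj_surjective : Function.Surjective (proj p n) :=
  RingQuot.mkAlgHom_surjective k (KLRel p n)

variable {p n}

theorem proj_rel {a b : Fr k I n} (h : KLRel p n a b) : proj p n a = proj p n b :=
  RingQuot.mkAlgHom_rel k h

/-- The homomorphism out of `R(n)` induced by a homomorphism respecting the relations. -/
noncomputable def lift {B : Type*} [Ring B] [Algebra k B] (f : Fr k I n →ₐ[k] B)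
    (hf : ∀ a b, KLRel p n a b → f a = f b) : Alg p n →ₐ[k] B :=
  RingQuot.liftAlgHom k ⟨f, fun a b h => hf a b h⟩

theorem lift_proj {B : Type*} [Ring B] [Algebra k B] (f : Fr k I n →ₐ[k] B)
    (hf : ∀ a b, KLRel p n a b → f a = f b) (a : Fr k I n) : lift f hf (proj p n a) = f a :=
  RingQuot.liftAlgHom_mkAlgHom_apply _ _ _ _

end Alg

end Algebra

section Elements

variable {k I : Type u} [CommRing k] [Fintype I] {C : BorcherdsCartan I} {𝓀 : ℤ → AddSubgroup k}

theorem ev_map {k A B : Type*} [CommRing k] [Ring A] [Algebra k A] [Ring B] [Algebra k B]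
    (g : A →ₐ[k] B) {m : ℕ} (z : Fin m → A) (f : MvPolynomial (Fin m) k) :
    g (ev z f) = ev (g ∘ z) f := by
  simp only [ev, map_sum, map_mul, AlgHom.commutes, map_list_prod, List.map_ofFn]
  refine Finset.sum_congr rfl fun s _ => ?_
  congr 3
  ext j
  simp

namespace Alg

variable (p : Params C 𝓀) {n : ℕ}

/-- The idempotent `e(ν)` of `R(n)`. -/
noncomputable def e (ν : Fin n → I) : Alg p n := proj p n (Fr.e ν)

/-- The element `x_a` of `R(n)`. -/
noncomputable def x (a : Fin n) : Alg p n := proj p n (Fr.x a)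

/-- The element `τ_l` of `R(n)`. -/
noncomputable def t (l : ℕ) (h : l + 1 < n) : Alg p n :=
  proj p n (Fr.t l h)

theorem mk_ev {m : ℕ} (z : Fin m → Fr k I n) (f : MvPolynomial (Fin m) k) :
    proj p n (ev z f) =
      ev (fun j => proj p n (z j)) f := ev_map _ z f

theorem vec2 {A B : Type*} (g : A → B) (a b : A) : (fun j => g (![a, b] j)) = ![g a, g b] := by
  ext j; fin_cases j <;> rfl

theorem vec3 {A B : Type*} (g : A → B) (a b c : A) :
    (fun j => g (![a, b, c] j)) = ![g a, g b, g c] := by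
  ext j; fin_cases j <;> rfl

theorem e_mul_self (ν : Fin n → I) : e p ν * e p ν = e p ν := by
  simpa [e] using proj_rel (KLRel.e_mul_self (p := p) ν)

theorem e_mul_ne {ν ν' : Fin n → I} (h : ν ≠ ν') : e p ν * e p ν' = 0 := by
  simpa [e] using proj_rel (KLRel.e_mul_ne (p := p) ν ν' h)

theorem e_sum : ∑ ν : Fin n → I, e p ν = 1 := by
  simpa [e] using proj_rel (KLRel.e_sum (p := p) (n := n))

theorem x_comm (a b : Fin n) : x p a * x p b = x p b * x p a := by
  simpa [x] using proj_rel (KLRel.x_comm (p := p) a b)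

theorem x_e (a : Fin n) (ν : Fin n → I) : x p a * e p ν = e p ν * x p a := by
  simpa [x, e] using proj_rel (KLRel.x_e (p := p) a ν)

theorem tau_e (l : ℕ) (h : l + 1 < n) (ν : Fin n → I) :
    t p l h * e p ν = e p (ν ∘ swp l h) * t p l h := by
  simpa [t, e] using proj_rel (KLRel.tau_e (p := p) l h ν)

theorem tau_comm (l m : ℕ) (hl : l + 1 < n) (hm : m + 1 < n) (h : l + 1 < m) :
    t p l hl * t p m hm = t p m hm * t p l hl := by
  simpa [t] using proj_rel (KLRel.tau_comm (p := p) l m hl hm h)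

theorem tau_sq_eq (l : ℕ) (h : l + 1 < n) (ν : Fin n → I) (hν : ν (lo l h) = ν (hi l h)) :
    t p l h * t p l h * e p ν =
      ev ![x p (lo l h), x p (hi l h)] (p.dP (ν (lo l h))) * t p l h * e p ν := by
  have := proj_rel (KLRel.tau_sq_eq (p := p) l h ν hν)
  simp only [map_mul, mk_ev, vec2] at this
  exact this

theorem tau_sq_ne (l : ℕ) (h : l + 1 < n) (ν : Fin n → I) (hν : ν (lo l h) ≠ ν (hi l h)) :
    t p l h * t p l h * e p ν =
      ev ![x p (lo l h), x p (hi l h)] (p.Q (ν (lo l h)) (ν (hi l h))) * e p ν := by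
  have := proj_rel (KLRel.tau_sq_ne (p := p) l h ν hν)
  simp only [map_mul, mk_ev, vec2] at this
  exact this

theorem tau_x_lo (l : ℕ) (h : l + 1 < n) (ν : Fin n → I) (hν : ν (lo l h) = ν (hi l h)) :
    (t p l h * x p (lo l h) - x p (hi l h) * t p l h) * e p ν =
      -(ev ![x p (lo l h), x p (hi l h)] (p.P (ν (lo l h))) * e p ν) := by
  have := proj_rel (KLRel.tau_x_lo (p := p) l h ν hν)
  simp only [map_mul, map_sub, map_neg, mk_ev, vec2] at this
  exact this

theorem tau_x_hi (l : ℕ) (h : l + 1 < n) (ν : Fin n → I) (hν : ν (lo l h) = ν (hi l h)) :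
    (t p l h * x p (hi l h) - x p (lo l h) * t p l h) * e p ν =
      ev ![x p (lo l h), x p (hi l h)] (p.P (ν (lo l h))) * e p ν := by
  have := proj_rel (KLRel.tau_x_hi (p := p) l h ν hν)
  simp only [map_mul, map_sub, map_neg, mk_ev, vec2] at this
  exact this

theorem tau_x_other (l : ℕ) (h : l + 1 < n) (a : Fin n) (ν : Fin n → I)
    (hν : ν (lo l h) = ν (hi l h) → a ≠ lo l h ∧ a ≠ hi l h) :
    (t p l h * x p a - x p (swp l h a) * t p l h) * e p ν = 0 := by
  have := proj_rel (KLRel.tau_x_other (p := p) l h a ν hν)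
  simp only [map_mul, map_sub, map_zero] at this
  exact this

theorem braid_Q (l : ℕ) (h : l + 1 < n) (h' : l + 1 + 1 < n) (ν : Fin n → I)
    (hν : ν (lo l h) = ν (hi (l + 1) h')) (hν' : ν (lo l h) ≠ ν (hi l h)) :
    (t p (l + 1) h' * t p l h * t p (l + 1) h' - t p l h * t p (l + 1) h' * t p l h) * e p ν =
      ev ![x p (lo l h), x p (hi (l + 1) h')] (p.P (ν (lo l h))) *
        ev ![x p (lo l h), x p (hi l h), x p (hi (l + 1) h')]
          (p.Qbar (ν (lo l h)) (ν (hi l h))) * e p ν := by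
  have := proj_rel (KLRel.braid_Q (p := p) l h h' ν hν hν')
  simp only [map_mul, map_sub, mk_ev, vec2, vec3] at this
  exact this

theorem braid_P (l : ℕ) (h : l + 1 < n) (h' : l + 1 + 1 < n) (ν : Fin n → I)
    (hν : ν (lo l h) = ν (hi (l + 1) h')) (hν' : ν (lo l h) = ν (hi l h)) :
    (t p (l + 1) h' * t p l h * t p (l + 1) h' - t p l h * t p (l + 1) h' * t p l h) * e p ν =
      ev ![x p (lo l h), x p (hi l h), x p (hi (l + 1) h')] (p.Pbar' (ν (lo l h))) *
          t p l h * e p ν +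
        ev ![x p (lo l h), x p (hi l h), x p (hi (l + 1) h')] (p.Pbar'' (ν (lo l h))) *
          t p (l + 1) h' * e p ν := by
  have := proj_rel (KLRel.braid_P (p := p) l h h' ν hν hν')
  simp only [map_mul, map_sub, map_add, mk_ev, vec2, vec3] at this
  exact this

theorem braid_zero (l : ℕ) (h : l + 1 < n) (h' : l + 1 + 1 < n) (ν : Fin n → I)
    (hν : ν (lo l h) ≠ ν (hi (l + 1) h')) :
    (t p (l + 1) h' * t p l h * t p (l + 1) h' - t p l h * t p (l + 1) h' * t p l h) * e p ν = 0 := by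
  have := proj_rel (KLRel.braid_zero (p := p) l h h' ν hν)
  simp only [map_mul, map_sub, map_zero] at this
  exact this

/-- Induction principle: `R(n)` is generated by `k`, `e(ν)`, `x_a` and `τ_l`. -/
theorem induction {motive : Alg p n → Prop} (scalar : ∀ c : k, motive (algebraMap k _ c))
    (he : ∀ ν, motive (e p ν)) (hx : ∀ a, motive (x p a)) (ht : ∀ l h, motive (t p l h))
    (mul : ∀ a b, motive a → motive b → motive (a * b))
    (add : ∀ a b, motive a → motive b → motive (a + b)) (a : Alg p n) : motive a := by
  obtain ⟨a, rfl⟩ := proj_surjective p n a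
  induction a using FreeAlgebra.induction with
  | grade0 c => rw [AlgHom.commutes]; exact scalar c
  | grade1 g =>
    cases g with
    | e ν => exact he ν
    | x a => exact hx a
    | tau l h => exact ht l h
  | mul a b ha hb => rw [map_mul]; exact mul _ _ ha hb
  | add a b ha hb => rw [map_add]; exact add _ _ ha hb

/-- The sequence `(ν, i)`. -/
def snoc {I : Type*} {n : ℕ} (ν : Fin n → I) (i : I) : Fin (n + 1) → I :=
  Fin.snoc (α := fun _ => I) ν i

@[simp] theorem snoc_castSucc {I : Type*} {n : ℕ} (ν : Fin n → I) (i : I) (a : Fin n) :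
    snoc ν i a.castSucc = ν a := Fin.snoc_castSucc (α := fun _ => I) _ _ _

@[simp] theorem snoc_last {I : Type*} {n : ℕ} (ν : Fin n → I) (i : I) :
    snoc ν i (Fin.last n) = i := Fin.snoc_last (α := fun _ => I) _ _

theorem snoc_lo {I : Type*} {n : ℕ} (ν : Fin n → I) (i : I) (l : ℕ) (h : l + 1 < n)
    (h' : l + 1 < n + 1) : snoc ν i (lo l h') = ν (lo l h) := snoc_castSucc ν i (lo l h)

theorem snoc_hi {I : Type*} {n : ℕ} (ν : Fin n → I) (i : I) (l : ℕ) (h : l + 1 < n)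
    (h' : l + 1 < n + 1) : snoc ν i (hi l h') = ν (hi l h) := snoc_castSucc ν i (hi l h)

theorem swp_castSucc (l : ℕ) (h : l + 1 < n) (h' : l + 1 < n + 1) (a : Fin n) :
    swp l h' a.castSucc = (swp l h a).castSucc := by
  have := (Fin.castSucc_injective n).swap_apply (lo l h) (hi l h) a
  exact this

theorem snoc_swp {I : Type*} (ν : Fin n → I) (i : I) (l : ℕ) (h : l + 1 < n)
    (h' : l + 1 < n + 1) : snoc ν i ∘ swp l h' = snoc (ν ∘ swp l h) i := by
  ext a
  refine Fin.lastCases ?_ (fun a => ?_) a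
  · have : swp l h' (Fin.last n) = Fin.last n := by
      apply Equiv.swap_apply_of_ne_of_ne
      · exact fun h0 => by have := congrArg Fin.val h0; simp [lo] at this; omega
      · exact fun h0 => by have := congrArg Fin.val h0; simp [hi] at this; omega
    rw [Function.comp_apply, this, snoc_last, snoc_last]
  · rw [Function.comp_apply, swp_castSucc l h h', snoc_castSucc, snoc_castSucc]; rfl

/-- The values of the embedding `R(n) → R(n + 1)` on the generators. -/
noncomputable def embGen : Gen I n → Alg p (n + 1)
  | Gen.e ν => ∑ i : I, e p (snoc ν i)
  | Gen.x a => x p a.castSucc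
  | Gen.tau l h => t p l (Nat.lt_succ_of_lt h)

theorem embGen_rel (a b : Fr k I n) (hab : KLRel p n a b) :
    FreeAlgebra.lift k (embGen p) a = FreeAlgebra.lift k (embGen p) b := by
  have hE : ∀ ν : Fin n → I, FreeAlgebra.lift k (embGen p) (Fr.e ν) = ∑ i : I, e p (snoc ν i) :=
    fun ν => FreeAlgebra.lift_ι_apply _ _
  have hX : ∀ a : Fin n, FreeAlgebra.lift k (embGen p) (Fr.x a) = x p a.castSucc :=
    fun ν => FreeAlgebra.lift_ι_apply _ _
  have hT : ∀ l (h : l + 1 < n), FreeAlgebra.lift k (embGen p) (Fr.t l h) =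
      t p l (Nat.lt_succ_of_lt h) := fun ν _ => FreeAlgebra.lift_ι_apply _ _
  have hev : ∀ {m : ℕ} (z : Fin m → Fr k I n) (f : MvPolynomial (Fin m) k),
      FreeAlgebra.lift k (embGen p) (ev z f) =
      ev (fun j => FreeAlgebra.lift k (embGen p) (z j)) f := fun z f => ev_map _ z f
  cases hab with
  | e_mul_self ν =>
    simp only [map_mul, hE, Finset.sum_mul_sum]
    refine Finset.sum_congr rfl fun i _ => ?_
    rw [Finset.sum_eq_single i, e_mul_self]
    · intro j _ hj
      refine e_mul_ne p fun h => hj ?_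
      simpa using (congrFun h (Fin.last n)).symm
    · simp
  | e_mul_ne ν ν' h =>
    simp only [map_mul, hE, Finset.sum_mul_sum, map_zero]
    refine Finset.sum_eq_zero fun i _ => Finset.sum_eq_zero fun j _ => ?_
    refine e_mul_ne p fun h' => h ?_
    ext a
    simpa using congrFun h' a.castSucc
  | e_sum =>
    simp only [map_sum, hE, map_one]
    rw [← e_sum p, ← Finset.sum_product']
    refine Finset.sum_bij' (fun a _ => snoc a.1 a.2)
      (fun μ _ => (fun a => μ a.castSucc, μ (Fin.last n))) ?_ ?_ ?_ ?_ ?_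
    · simp
    · simp
    · intro a _; ext <;> simp
    · intro μ _
      ext a
      refine Fin.lastCases ?_ (fun a => ?_) a <;> simp
    · intro a _; rfl
  | x_comm a b => simp only [map_mul, hX]; exact x_comm p _ _
  | x_e a ν =>
    simp only [map_mul, hX, hE, Finset.mul_sum, Finset.sum_mul]
    exact Finset.sum_congr rfl fun i _ => x_e p _ _
  | tau_e l h ν =>
    simp only [map_mul, hT, hE, Finset.mul_sum, Finset.sum_mul]
    refine Finset.sum_congr rfl fun i _ => ?_
    rw [tau_e, snoc_swp ν i l h]
  | tau_comm l m hl hm h => simp only [map_mul, hT]; exact tau_comm p _ _ _ _ h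
  | tau_sq_eq l h ν hν =>
    simp only [map_mul, hT, hE, hev, vec2, hX, Finset.mul_sum]
    refine Finset.sum_congr rfl fun i _ => ?_
    rw [tau_sq_eq p l _ _ (by rwa [snoc_lo ν i l h, snoc_hi ν i l h]), snoc_lo ν i l h]
    rfl
  | tau_sq_ne l h ν hν =>
    simp only [map_mul, hT, hE, hev, vec2, hX, Finset.mul_sum]
    refine Finset.sum_congr rfl fun i _ => ?_
    rw [tau_sq_ne p l _ _ (by rwa [snoc_lo ν i l h, snoc_hi ν i l h]), snoc_lo ν i l h,
      snoc_hi ν i l h]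
    rfl
  | tau_x_lo l h ν hν =>
    simp only [map_mul, map_sub, map_neg, hT, hE, hev, vec2, hX, Finset.mul_sum,
      ← Finset.sum_neg_distrib]
    refine Finset.sum_congr rfl fun i _ => ?_
    have := tau_x_lo p l (Nat.lt_succ_of_lt h) (snoc ν i)
      (by rwa [snoc_lo ν i l h, snoc_hi ν i l h])
    rwa [snoc_lo ν i l h] at this
  | tau_x_hi l h ν hν =>
    simp only [map_mul, map_sub, map_neg, hT, hE, hev, vec2, hX, Finset.mul_sum]
    refine Finset.sum_congr rfl fun i _ => ?_
    have := tau_x_hi p l (Nat.lt_succ_of_lt h) (snoc ν i)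
      (by rwa [snoc_lo ν i l h, snoc_hi ν i l h])
    rwa [snoc_lo ν i l h] at this
  | tau_x_other l h a ν hν =>
    simp only [map_mul, map_sub, map_zero, hT, hE, hX, Finset.mul_sum]
    refine Finset.sum_eq_zero fun i _ => ?_
    have := tau_x_other p l (Nat.lt_succ_of_lt h) a.castSucc (snoc ν i) (by
      rw [snoc_lo ν i l h, snoc_hi ν i l h]
      intro h0
      obtain ⟨h1, h2⟩ := hν h0
      exact ⟨fun h3 => h1 (Fin.castSucc_injective n h3), fun h3 => h2 (Fin.castSucc_injective n h3)⟩)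
    rwa [swp_castSucc l h] at this
  | braid_Q l h h' ν hν hν' =>
    simp only [map_mul, map_sub, hT, hE, hev, vec2, vec3, hX, Finset.mul_sum]
    refine Finset.sum_congr rfl fun i _ => ?_
    have := braid_Q p l (Nat.lt_succ_of_lt h) (Nat.lt_succ_of_lt h') (snoc ν i)
      (by rwa [snoc_lo ν i l h, snoc_hi ν i (l + 1) h'])
      (by rwa [snoc_lo ν i l h, snoc_hi ν i l h])
    rwa [snoc_lo ν i l h, snoc_hi ν i l h] at this
  | braid_P l h h' ν hν hν' =>
    simp only [map_mul, map_sub, map_add, hT, hE, hev, vec2, vec3, hX, Finset.mul_sum,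
      ← Finset.sum_add_distrib]
    refine Finset.sum_congr rfl fun i _ => ?_
    have := braid_P p l (Nat.lt_succ_of_lt h) (Nat.lt_succ_of_lt h') (snoc ν i)
      (by rwa [snoc_lo ν i l h, snoc_hi ν i (l + 1) h'])
      (by rwa [snoc_lo ν i l h, snoc_hi ν i l h])
    rwa [snoc_lo ν i l h] at this
  | braid_zero l h h' ν hν =>
    simp only [map_mul, map_sub, map_zero, hT, hE, Finset.mul_sum]
    refine Finset.sum_eq_zero fun i _ => ?_
    exact braid_zero p l (Nat.lt_succ_of_lt h) (Nat.lt_succ_of_lt h') (snoc ν i)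
      (by rwa [snoc_lo ν i l h, snoc_hi ν i (l + 1) h'])

variable (n) in
/-- The natural homomorphism `R(n) → R(n + 1)`: `x_a ↦ x_a`, `τ_l ↦ τ_l`,
`e(ν) ↦ ∑ i, e(ν, i)`. -/
noncomputable def emb : Alg p n →ₐ[k] Alg p (n + 1) :=
  lift (FreeAlgebra.lift k (embGen p)) (embGen_rel p)

theorem emb_e (ν : Fin n → I) : emb p n (e p ν) = ∑ i : I, e p (snoc ν i) := by
  rw [emb, e, lift_proj]
  exact FreeAlgebra.lift_ι_apply _ _

theorem emb_x (a : Fin n) : emb p n (x p a) = x p a.castSucc := by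
  rw [emb, x, lift_proj]
  exact FreeAlgebra.lift_ι_apply _ _

theorem emb_t (l : ℕ) (h : l + 1 < n) : emb p n (t p l h) = t p l (Nat.lt_succ_of_lt h) := by
  rw [emb, t, lift_proj]
  exact FreeAlgebra.lift_ι_apply _ _

end Alg

end Elements

section Grading

variable {k I : Type u} [CommRing k] [Fintype I] {C : BorcherdsCartan I} {𝓀 : ℤ → AddSubgroup k}

namespace Alg

variable (p : Params C 𝓀) {n : ℕ}

/-- Products of homogeneous scalars and of the elements `e(ν)` (of degree `0`), `x_a e(ν)` (of
degree `2 d_i` for `i = ν_a`) and `τ_l e(ν)` (of degree `-(α_i | α_j)` for `i = ν_l`,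
`j = ν_{l + 1}`). -/
inductive HomEl : ℤ → Alg p n → Prop
  | scalar {d : ℤ} {c : k} (hc : c ∈ 𝓀 d) : HomEl d (algebraMap k _ c)
  | e (ν : Fin n → I) : HomEl 0 (e p ν)
  | x (a : Fin n) (ν : Fin n → I) : HomEl (2 * C.d (ν a)) (x p a * e p ν)
  | t (l : ℕ) (h : l + 1 < n) (ν : Fin n → I) :
      HomEl (- C.form (ν (lo l h)) (ν (hi l h))) (t p l h * e p ν)
  | mul {d d' : ℤ} {a b : Alg p n} : HomEl d a → HomEl d' b → HomEl (d + d') (a * b)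

variable (n) in
/-- The grading of `R(n)`. -/
noncomputable def deg (d : ℤ) : AddSubgroup (Alg p n) := AddSubgroup.closure {a | HomEl p d a}

theorem mem_deg {d : ℤ} {a : Alg p n} (h : HomEl p d a) : a ∈ deg p n d :=
  AddSubgroup.subset_closure h

theorem mul_mem_deg {d d' : ℤ} {a b : Alg p n} (ha : a ∈ deg p n d) (hb : b ∈ deg p n d') :
    a * b ∈ deg p n (d + d') := by
  induction ha using AddSubgroup.closure_induction with
  | zero => simp
  | add x y _ _ hx hy => rw [add_mul]; exact add_mem hx hy
  | neg x _ hx => rw [neg_mul]; exact neg_mem hx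
  | mem x hx =>
    induction hb using AddSubgroup.closure_induction with
    | zero => simp
    | add y z _ _ hy hz => rw [mul_add]; exact add_mem hy hz
    | neg y _ hy => rw [mul_neg]; exact neg_mem hy
    | mem y hy => exact mem_deg p (HomEl.mul hx hy)

theorem iSup_deg [GradedRing 𝓀] (a : Alg p n) : a ∈ ⨆ d, deg p n d := by
  have hm : ∀ {d : ℤ} {a : Alg p n}, HomEl p d a → a ∈ ⨆ d, deg p n d := fun {d a} h =>
    AddSubgroup.mem_iSup_of_mem (S := deg p n) d (mem_deg p h)
  induction a using Alg.induction p with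
  | scalar c =>
    induction mem_iSup_of_isInternal (DirectSum.Decomposition.isInternal 𝓀) c using
        AddSubgroup.iSup_induction' with
    | hp d c hc => exact hm (HomEl.scalar hc)
    | h1 => simp
    | hadd a b _ _ ha hb => rw [map_add]; exact add_mem ha hb
  | he ν => exact hm (HomEl.e ν)
  | hx a =>
    rw [← mul_one (x p a), ← e_sum, Finset.mul_sum]
    exact AddSubgroup.sum_mem _ fun ν _ => hm (HomEl.x a ν)
  | ht l h =>
    rw [← mul_one (t p l h), ← e_sum, Finset.mul_sum]
    exact AddSubgroup.sum_mem _ fun ν _ => hm (HomEl.t l h ν)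
  | add a b ha hb => exact add_mem ha hb
  | mul a b ha hb =>
    induction ha using AddSubgroup.iSup_induction' with
    | h1 => simp
    | hadd x y _ _ hx hy => rw [add_mul]; exact add_mem hx hy
    | hp d x hx =>
      induction hb using AddSubgroup.iSup_induction' with
      | h1 => simp
      | hadd y z _ _ hy hz => rw [mul_add]; exact add_mem hy hz
      | hp d' y hy => exact AddSubgroup.mem_iSup_of_mem (d + d') (mul_mem_deg p hx hy)

section Coaction

variable {T : Type*} [Ring T] [Algebra k T] (S : ℤ → Alg p n →+ T)

/-- The properties of `S d a = a ⊗ z ^ d` in `R(n)[z, z⁻¹]` with the `k`-algebra structure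
`c ↦ c ⊗ z ^ d` for `c` of degree `d`. -/
structure CoData : Prop where
  mul : ∀ D E a b, S D a * S E b = S (D + E) (a * b)
  one : S 0 1 = 1
  scalar : ∀ d, ∀ c ∈ 𝓀 d, algebraMap k T c = S d (algebraMap k (Alg p n) c)

/-- The values of the coaction on the generators. -/
noncomputable def coGen : Gen I n → T
  | Gen.e ν => S 0 (e p ν)
  | Gen.x a => ∑ μ : Fin n → I, S (2 * C.d (μ a)) (x p a * e p μ)
  | Gen.tau l h => ∑ μ : Fin n → I, S (- C.form (μ (lo l h)) (μ (hi l h))) (t p l h * e p μ)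

/-- The coaction on the free algebra. -/
noncomputable def coFr : Fr k I n →ₐ[k] T := FreeAlgebra.lift k (coGen p S)

/-- The element `z e(ν)` is homogeneous of degree `D`. -/
def HomE (z : Fr k I n) (ν : Fin n → I) (D : ℤ) : Prop :=
  coFr p S z * S 0 (e p ν) = S D (proj p n z * e p ν)

/-- The element `z e(ν)` is homogeneous of degree `D` with left idempotent `e(ν')`. -/
def IsHom (z : Fr k I n) (ν : Fin n → I) (D : ℤ) (ν' : Fin n → I) : Prop :=
  HomE p S z ν D ∧ proj p n z * e p ν = e p ν' * proj p n z

variable {p S}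

theorem HomE.congr {z : Fr k I n} {ν : Fin n → I} {D D' : ℤ} (h : HomE p S z ν D)
    (hD : D = D') : HomE p S z ν D' := hD ▸ h

theorem HomE.mul (hc : CoData p S)
    {z w : Fr k I n} {ν ν' : Fin n → I} {D E : ℤ} (hw : HomE p S w ν' E)
    (hz : IsHom p S z ν D ν') : HomE p S (w * z) ν (E + D) := by
  have hz1 : coFr p S z * S 0 (e p ν) = S D (proj p n z * e p ν) := hz.1
  have hz2 := hz.2
  have hw1 : coFr p S w * S 0 (e p ν') = S E (proj p n w * e p ν') := hw
  calc coFr p S (w * z) * S 0 (e p ν) = coFr p S w * (coFr p S z * S 0 (e p ν)) := by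
        rw [map_mul, mul_assoc]
    _ = coFr p S w * S 0 (e p ν') * S D (proj p n z) := by
        rw [hz1, hz2, mul_assoc (coFr p S w), hc.mul, zero_add]
    _ = S (E + D) (proj p n (w * z) * e p ν) := by
        rw [hw1, hc.mul, map_mul (proj p n), mul_assoc, mul_assoc, ← hz2]

theorem HomE.add {z w : Fr k I n} {ν : Fin n → I} {D : ℤ} (hw : HomE p S w ν D)
    (hz : HomE p S z ν D) : HomE p S (w + z) ν D := by
  rw [HomE] at *
  rw [map_add, map_add, add_mul, add_mul, hw, hz, map_add]

theorem HomE.neg {z : Fr k I n} {ν : Fin n → I} {D : ℤ}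
    (hz : HomE p S z ν D) : HomE p S (-z) ν D := by
  rw [HomE] at *
  rw [map_neg, map_neg, neg_mul, neg_mul, hz, map_neg]

theorem HomE.sub {z w : Fr k I n} {ν : Fin n → I} {D : ℤ} (hw : HomE p S w ν D)
    (hz : HomE p S z ν D) : HomE p S (w - z) ν D := by
  rw [sub_eq_add_neg]; exact hw.add hz.neg

theorem HomE.zero {ν : Fin n → I} {D : ℤ} : HomE p S 0 ν D := by
  simp [HomE]

theorem IsHom.mul (hc : CoData p S)
    {z w : Fr k I n} {ν ν' ν'' : Fin n → I} {D E : ℤ} (hw : IsHom p S w ν' E ν'')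
    (hz : IsHom p S z ν D ν') : IsHom p S (w * z) ν (E + D) ν'' :=
  ⟨hw.1.mul hc hz, by
    rw [map_mul, mul_assoc, hz.2, ← mul_assoc, hw.2, mul_assoc]⟩

theorem IsHom.add {z w : Fr k I n} {ν ν' : Fin n → I} {D : ℤ} (hw : IsHom p S w ν D ν')
    (hz : IsHom p S z ν D ν') : IsHom p S (w + z) ν D ν' :=
  ⟨hw.1.add hz.1, by rw [map_add, add_mul, mul_add, hw.2, hz.2]⟩

theorem IsHom.zero {ν ν' : Fin n → I} {D : ℤ} : IsHom p S 0 ν D ν' :=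
  ⟨HomE.zero, by simp⟩

theorem isHom_e (hc : CoData p S) (ν μ : Fin n → I) : IsHom p S (Fr.e ν) μ 0 μ := by
  constructor
  · rw [HomE, show coFr p S (Fr.e ν) = S 0 (e p ν) from FreeAlgebra.lift_ι_apply _ _, hc.mul]; rfl
  · change e p ν * e p μ = e p μ * e p ν
    by_cases h : ν = μ
    · rw [h]
    · rw [e_mul_ne p h, e_mul_ne p (Ne.symm h)]

theorem isHom_sum (hc : CoData p S) (f : (Fin n → I) → ℤ) (a : Alg p n) (ν : Fin n → I) :
    (∑ μ : Fin n → I, S (f μ) (a * e p μ)) * S 0 (e p ν) = S (f ν) (a * e p ν) := by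
  classical
  rw [Finset.sum_mul, Finset.sum_eq_single ν]
  · rw [hc.mul, mul_assoc, e_mul_self, add_zero]
  · intro μ _ h
    rw [hc.mul, mul_assoc, e_mul_ne p h, mul_zero, map_zero]
  · simp

theorem isHom_x (hc : CoData p S) (a : Fin n) (ν : Fin n → I) : IsHom p S (Fr.x a) ν (2 * C.d (ν a)) ν := by
  constructor
  · rw [HomE, show coFr p S (Fr.x a) = _ from FreeAlgebra.lift_ι_apply _ _]
    exact isHom_sum hc (fun μ => 2 * C.d (μ a)) (x p a) ν
  · exact x_e p a ν

theorem isHom_t (hc : CoData p S) (l : ℕ) (h : l + 1 < n) (ν : Fin n → I) :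
    IsHom p S (Fr.t l h) ν (- C.form (ν (lo l h)) (ν (hi l h))) (ν ∘ swp l h) := by
  constructor
  · rw [HomE, show coFr p S (Fr.t l h) = _ from FreeAlgebra.lift_ι_apply _ _]
    exact isHom_sum hc (fun μ => - C.form (μ (lo l h)) (μ (hi l h))) (t p l h) ν
  · exact tau_e p l h ν

theorem isHom_scalar (hc : CoData p S) {d : ℤ} {c : k} (hcd : c ∈ 𝓀 d) (ν : Fin n → I) :
    IsHom p S (algebraMap k _ c) ν d ν := by
  constructor
  · rw [HomE, AlgHom.commutes, AlgHom.commutes, hc.scalar d c hcd, hc.mul, add_zero]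
  · rw [AlgHom.commutes, Algebra.commutes]

theorem isHom_one [GradedRing 𝓀] (hc : CoData p S) (ν : Fin n → I) : IsHom p S 1 ν 0 ν := by
  rw [← map_one (algebraMap k _)]
  exact isHom_scalar hc SetLike.GradedOne.one_mem ν

theorem isHom_pow [GradedRing 𝓀] (hc : CoData p S) {z : Fr k I n} {ν : Fin n → I} {D : ℤ} (hz : IsHom p S z ν D ν)
    (r : ℕ) : IsHom p S (z ^ r) ν (D * r) ν := by
  induction r with
  | zero => simpa using isHom_one hc ν
  | succ r ih =>
    rw [pow_succ, show D * ((r + 1 : ℕ) : ℤ) = D * r + D by push_cast; ring]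
    exact ih.mul hc hz

theorem isHom_prod [GradedRing 𝓀] (hc : CoData p S) {ν : Fin n → I} {m : ℕ} (z : Fin m → Fr k I n) (D : Fin m → ℤ)
    (hz : ∀ j, IsHom p S (z j) ν (D j) ν) :
    IsHom p S (List.ofFn z).prod ν (∑ j, D j) ν := by
  induction m with
  | zero => simpa using isHom_one hc ν
  | succ m ih =>
    rw [List.ofFn_succ, List.prod_cons, Fin.sum_univ_succ]
    exact (hz 0).mul hc (ih _ _ fun j => hz _)

theorem isHom_ev [GradedRing 𝓀] (hc : CoData p S) {ν : Fin n → I} {m : ℕ} {z : Fin m → Fr k I n} {wt : Fin m → ℤ}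
    (hz : ∀ j, IsHom p S (z j) ν (wt j) ν) {N : ℤ} {f : MvPolynomial (Fin m) k}
    (hf : IsHomog 𝓀 wt N f) : IsHom p S (ev z f) ν N ν := by
  classical
  rw [ev]
  have : ∀ s : Finset (Fin m →₀ ℕ), IsHom p S
      (∑ s ∈ s, algebraMap k _ (f.coeff s) * (List.ofFn fun j => z j ^ s j).prod) ν N ν := by
    intro s
    induction s using Finset.induction_on with
    | empty => rw [Finset.sum_empty]; exact IsHom.zero
    | insert a s ha ih =>
      rw [Finset.sum_insert ha]
      refine IsHom.add ?_ ih
      have := (isHom_scalar hc (hf a) ν).mul hc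
        (isHom_prod hc (fun j => z j ^ a j) _ fun j => isHom_pow hc (hz j) (a j))
      rwa [sub_add_cancel] at this
  exact this _

theorem coFr_mul_e {r s : Fr k I n} {ν : Fin n → I} {D D' : ℤ}
    (hr : HomE p S r ν D) (hs : HomE p S s ν D') (hD : D' = D)
    (h : proj p n (r * Fr.e ν) = proj p n (s * Fr.e ν)) :
    coFr p S (r * Fr.e ν) = coFr p S (s * Fr.e ν) := by
  subst hD
  have he : coFr p S (Fr.e ν) = S 0 (e p ν) := FreeAlgebra.lift_ι_apply _ _
  have he' : proj p n (Fr.e ν) = e p ν := rfl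
  rw [map_mul, map_mul, he'] at h
  rw [HomE] at hr hs
  rw [map_mul, map_mul, he, hr, hs, h]

theorem coFr_ext (hc : CoData p S) {r s : Fr k I n} (h : proj p n r = proj p n s)
    (hr : ∀ ν, ∃ D, HomE p S r ν D ∧ HomE p S s ν D) :
    coFr p S r = coFr p S s := by
  have key : ∀ z : T, z = ∑ ν : Fin n → I, z * S 0 (e p ν) := by
    intro z
    rw [← Finset.mul_sum, ← map_sum, e_sum, hc.one, mul_one]
  rw [key (coFr p S r), key (coFr p S s)]
  refine Finset.sum_congr rfl fun ν _ => ?_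
  obtain ⟨D, h2, h3⟩ := hr ν
  rw [HomE] at h2 h3
  rw [h2, h3, h]

theorem swp_lo (l : ℕ) (h : l + 1 < n) : swp l h (lo l h) = hi l h :=
  Equiv.swap_apply_left _ _

theorem swp_hi (l : ℕ) (h : l + 1 < n) : swp l h (hi l h) = lo l h :=
  Equiv.swap_apply_right _ _

theorem swp_of_ne (l : ℕ) (h : l + 1 < n) (a : Fin n) (h1 : a.1 ≠ l) (h2 : a.1 ≠ l + 1) :
    swp l h a = a :=
  Equiv.swap_apply_of_ne_of_ne (fun h => h1 (congrArg Fin.val h)) fun h => h2 (congrArg Fin.val h)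

theorem swp_succ_lo (l : ℕ) (h : l + 1 < n) (h' : l + 1 + 1 < n) :
    swp (l + 1) h' (lo l h) = lo l h :=
  swp_of_ne _ _ _ (by simp only [lo]; omega) (by simp only [lo]; omega)

theorem swp_hi_succ (l : ℕ) (h : l + 1 < n) (h' : l + 1 + 1 < n) :
    swp l h (hi (l + 1) h') = hi (l + 1) h' :=
  swp_of_ne _ _ _ (by simp only [hi]; omega) (by simp only [hi]; omega)

theorem swp_succ_hi (l : ℕ) (h : l + 1 < n) (h' : l + 1 + 1 < n) :
    swp (l + 1) h' (hi l h) = hi (l + 1) h' := swp_lo _ _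

theorem lo_succ (l : ℕ) (h : l + 1 < n) (h' : l + 1 + 1 < n) : lo (l + 1) h' = hi l h := rfl

theorem form_comm (i j : I) : C.form i j = C.form j i := C.symm i j

theorem coFr_rel [GradedRing 𝓀] (hc : CoData p S) {r s : Fr k I n} (hrs : KLRel p n r s) :
    coFr p S r = coFr p S s := by
  have hπ : proj p n r = proj p n s := proj_rel hrs
  have he := isHom_e hc
  have hx := isHom_x hc
  have ht := isHom_t hc
  have x2 : ∀ {ν : Fin n → I} (a b : Fin n) j,
      IsHom p S (![Fr.x a, Fr.x b] j) ν (![2 * C.d (ν a), 2 * C.d (ν b)] j) ν := by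
    intro ν a b j
    fin_cases j
    · exact hx a ν
    · exact hx b ν
  have x3 : ∀ {ν : Fin n → I} (a b c : Fin n) j,
      IsHom p S (![Fr.x a, Fr.x b, Fr.x c] j) ν
        (![2 * C.d (ν a), 2 * C.d (ν b), 2 * C.d (ν c)] j) ν := by
    intro ν a b c j
    fin_cases j
    · exact hx a ν
    · exact hx b ν
    · exact hx c ν
  -- the two sides of the braid relation
  have b1 : ∀ (ν : Fin n → I) l (h : l + 1 < n) (h' : l + 1 + 1 < n),
      HomE p S (Fr.t (l + 1) h' * Fr.t l h * Fr.t (l + 1) h') ν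
        (-(C.form (ν (lo l h)) (ν (hi l h)) + C.form (ν (lo l h)) (ν (hi (l + 1) h')) +
          C.form (ν (hi l h)) (ν (hi (l + 1) h')))) := by
    intro ν l h h'
    refine (((ht (l + 1) h' _).mul hc (ht l h _)).1.mul hc (ht (l + 1) h' ν)).congr ?_
    simp only [Function.comp_apply, lo_succ l h h', swp_hi, swp_hi_succ, swp_succ_lo,
      swp_succ_hi]
    ring
  have b2 : ∀ (ν : Fin n → I) l (h : l + 1 < n) (h' : l + 1 + 1 < n),
      HomE p S (Fr.t l h * Fr.t (l + 1) h' * Fr.t l h) ν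
        (-(C.form (ν (lo l h)) (ν (hi l h)) + C.form (ν (lo l h)) (ν (hi (l + 1) h')) +
          C.form (ν (hi l h)) (ν (hi (l + 1) h')))) := by
    intro ν l h h'
    refine (((ht l h _).mul hc (ht (l + 1) h' _)).1.mul hc (ht l h ν)).congr ?_
    simp only [Function.comp_apply, lo_succ l h h', swp_lo, swp_hi, swp_hi_succ, swp_succ_lo,
      swp_succ_hi]
    ring
  cases hrs with
  | e_mul_self ν =>
    exact coFr_ext hc hπ fun μ => ⟨_, ((he _ _).mul hc (he _ _)).1, by simpa using (he _ _).1⟩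
  | e_mul_ne ν ν' h =>
    exact coFr_ext hc hπ fun μ => ⟨_, ((he _ _).mul hc (he _ _)).1, HomE.zero⟩
  | e_sum =>
    rw [map_sum, map_one, ← hc.one, ← e_sum, map_sum]
    exact Finset.sum_congr rfl fun ν _ => FreeAlgebra.lift_ι_apply _ _
  | x_comm a b =>
    exact coFr_ext hc hπ fun μ => ⟨_, ((hx _ _).mul hc (hx _ _)).1,
      ((hx _ _).mul hc (hx _ _)).1.congr (add_comm _ _)⟩
  | x_e a ν =>
    exact coFr_ext hc hπ fun μ => ⟨_, ((hx _ _).mul hc (he _ _)).1,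
      ((he _ _).mul hc (hx _ _)).1.congr (add_comm _ _)⟩
  | tau_e l h ν =>
    exact coFr_ext hc hπ fun μ => ⟨_, ((ht _ _ _).mul hc (he _ _)).1,
      ((he _ _).mul hc (ht _ _ _)).1.congr (add_comm _ _)⟩
  | tau_comm l m hl hm h =>
    refine coFr_ext hc hπ fun μ => ⟨_, ((ht _ _ _).mul hc (ht _ _ _)).1,
      ((ht _ _ _).mul hc (ht _ _ _)).1.congr ?_⟩
    simp only [Function.comp_apply]
    rw [swp_of_ne m hm (lo l hl), swp_of_ne m hm (hi l hl), swp_of_ne l hl (lo m hm),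
      swp_of_ne l hl (hi m hm), add_comm]
    all_goals simp only [lo, hi]; omega
  | tau_sq_eq l h ν hν =>
    refine coFr_mul_e ((ht l h _).mul hc (ht l h ν)).1
      ((isHom_ev hc (x2 (lo l h) (hi l h))
        (p.isHomog_dP (i := ν (lo l h)) ?_)).1.mul hc (ht l h ν)) ?_ hπ
    · intro j
      fin_cases j <;> simp [swp_lo, swp_hi, hν]
    · simp only [Function.comp_apply, swp_lo, swp_hi, hν]
  | tau_sq_ne l h ν hν =>
    refine coFr_mul_e ((ht l h _).mul hc (ht l h ν)).1
      (isHom_ev hc (x2 (lo l h) (hi l h)) (p.isHomog_Q hν rfl rfl)).1 ?_ hπ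
    simp only [Function.comp_apply, swp_lo, swp_hi]
    rw [form_comm (ν (hi l h))]
    ring
  | tau_x_lo l h ν hν =>
    rw [← neg_mul] at hπ ⊢
    refine coFr_mul_e (D := 2 * C.d (ν (lo l h)) - C.form (ν (lo l h)) (ν (lo l h)))
      ((((ht l h _).mul hc (hx _ ν)).1.congr ?_).sub
        (((hx _ _).mul hc (ht l h ν)).1.congr ?_))
      (isHom_ev hc (x2 (lo l h) (hi l h)) (p.isHomog_P (i := ν (lo l h)) ?_)).1.neg rfl hπ
    · rw [← hν]; ring
    · rw [Function.comp_apply, swp_hi, ← hν]; ring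
    · intro j
      fin_cases j <;> simp [hν]
  | tau_x_hi l h ν hν =>
    refine coFr_mul_e (D := 2 * C.d (ν (lo l h)) - C.form (ν (lo l h)) (ν (lo l h)))
      ((((ht l h _).mul hc (hx _ ν)).1.congr ?_).sub
        (((hx _ _).mul hc (ht l h ν)).1.congr ?_))
      (isHom_ev hc (x2 (lo l h) (hi l h)) (p.isHomog_P (i := ν (lo l h)) ?_)).1 rfl hπ
    · rw [← hν]; ring
    · rw [Function.comp_apply, swp_lo, ← hν]; ring
    · intro j
      fin_cases j <;> simp [hν]
  | tau_x_other l h a ν hν =>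
    rw [← zero_mul (Fr.e ν)] at hπ ⊢
    refine coFr_mul_e (((ht l h _).mul hc (hx _ ν)).1.sub
        (((hx _ _).mul hc (ht l h ν)).1.congr ?_)) HomE.zero rfl hπ
    have : swp l h (swp l h a) = a := Equiv.swap_apply_self _ _ _
    rw [Function.comp_apply, this, add_comm]
  | braid_Q l h h' ν hν hν' =>
    refine coFr_mul_e ((b1 ν l h h').sub (b2 ν l h h'))
      (((isHom_ev hc (x2 (lo l h) (hi (l + 1) h')) (p.isHomog_P (i := ν (lo l h)) ?_)).mul hc
        (isHom_ev hc (x3 (lo l h) (hi l h) (hi (l + 1) h')) (p.isHomog_Qbar hν' rfl rfl ?_))).1)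
      ?_ hπ
    · intro j
      fin_cases j <;> simp [hν]
    · simp [hν]
    · rw [← hν, form_comm (ν (hi l h))]; ring
  | braid_P l h h' ν hν hν' =>
    rw [← add_mul] at hπ ⊢
    refine coFr_mul_e (D := -3 * C.form (ν (lo l h)) (ν (lo l h)))
      (((b1 ν l h h').sub (b2 ν l h h')).congr ?_)
      ((((isHom_ev hc (x3 (lo l h) (hi l h) (hi (l + 1) h'))
          (p.isHomog_Pbar' (i := ν (lo l h)) ?_)).mul hc (ht l h ν)).1.congr ?_).add
        (((isHom_ev hc (x3 (lo l h) (hi l h) (hi (l + 1) h'))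
          (p.isHomog_Pbar'' (i := ν (lo l h)) ?_)).mul hc (ht (l + 1) h' ν)).1.congr ?_)) rfl hπ
    · rw [← hν, ← hν']; ring
    · intro j
      fin_cases j <;> simp [swp_lo, swp_hi, swp_hi_succ l h h', ← hν, ← hν']
    · rw [← hν']; ring
    · intro j
      fin_cases j <;> simp [swp_succ_lo l h h', swp_succ_hi l h h', swp_hi, lo_succ l h h',
        ← hν, ← hν']
    · rw [lo_succ l h h', ← hν, ← hν']; ring
  | braid_zero l h h' ν hν =>
    rw [← zero_mul (Fr.e ν)] at hπ ⊢
    exact coFr_mul_e ((b1 ν l h h').sub (b2 ν l h h')) HomE.zero rfl hπ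

theorem exists_co [GradedRing 𝓀] (hc : CoData p S) :
    ∃ Δ : Alg p n →+* T, ∀ d a, HomEl p d a → Δ a = S d a := by
  let Δ := lift (coFr p S) fun a b => coFr_rel hc
  have hΔ : ∀ z : Fr k I n, Δ (proj p n z) = coFr p S z := lift_proj _ _
  have h0 : ∀ z ν D ν', IsHom p S z ν D ν' →
      Δ (proj p n z * e p ν) = S D (proj p n z * e p ν) := by
    intro z ν D ν' h
    have h1 := h.1
    rw [HomE] at h1
    rw [← h1, map_mul, hΔ]
    congr 1
    rw [e, hΔ]
    exact FreeAlgebra.lift_ι_apply _ _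
  refine ⟨Δ.toRingHom, fun d a ha => ?_⟩
  change Δ a = S d a
  induction ha with
  | scalar hcd => rw [AlgHom.commutes, hc.scalar _ _ hcd]
  | e ν =>
    have := h0 _ _ _ _ (isHom_one hc ν)
    rwa [map_one, one_mul] at this
  | x a ν => exact h0 _ _ _ _ (isHom_x hc a ν)
  | t l h ν => exact h0 _ _ _ _ (isHom_t hc l h ν)
  | mul _ _ ha hb => rw [map_mul, ha, hb, hc.mul]

end Coaction

theorem deg_isInternal [GradedRing 𝓀] : DirectSum.IsInternal (deg p n) := by
  obtain ⟨δ, hδ⟩ := exists_ringCoaction 𝓀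
  let S : ℤ → Alg p n →+ AddMonoidAlgebra (Alg p n) ℤ := fun d => AddMonoidAlgebra.singleAddHom d
  have hSd : ∀ d a, S d a = AddMonoidAlgebra.single d a := fun _ _ => rfl
  let κ : k →+* AddMonoidAlgebra (Alg p n) ℤ :=
    (AddMonoidAlgebra.mapRingHom ℤ (algebraMap k (Alg p n))).comp δ
  have hκ : ∀ d, ∀ c ∈ 𝓀 d, κ c = S d (algebraMap k (Alg p n) c) := by
    intro d c hc
    rw [RingHom.comp_apply, hδ d c hc, hSd]
    exact AddMonoidAlgebra.mapRingHom_single _ _ _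
  have hcomm : ∀ c t, κ c * t = t * κ c := by
    intro c t
    induction mem_iSup_of_isInternal (DirectSum.Decomposition.isInternal 𝓀) c using
        AddSubgroup.iSup_induction' with
    | h1 => simp
    | hadd a b _ _ ha hb => rw [map_add, add_mul, mul_add, ha, hb]
    | hp d c hc =>
      rw [hκ d c hc, hSd]
      induction t using AddMonoidAlgebra.induction_linear with
      | zero => simp
      | add a b ha hb => rw [add_mul, mul_add, ha, hb]
      | single e a =>
        rw [AddMonoidAlgebra.single_mul_single, AddMonoidAlgebra.single_mul_single, add_comm,
          Algebra.commutes]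
  let _ : Algebra k (AddMonoidAlgebra (Alg p n) ℤ) := κ.toAlgebra' hcomm
  have hc : CoData p S :=
    { mul := fun D E a b => AddMonoidAlgebra.single_mul_single _ _ _ _
      one := rfl
      scalar := hκ }
  obtain ⟨Δ, hΔ⟩ := exists_co hc
  refine isInternal_of_coaction _ (iSup_deg p)
    (AddMonoidAlgebra.coeffAddEquiv.toAddMonoidHom.comp Δ.toAddMonoidHom) ?_
  intro d m hm
  change AddMonoidAlgebra.coeff (Δ m) = _
  have : Δ m = AddMonoidAlgebra.single d m := by
    induction hm using AddSubgroup.closure_induction with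
    | zero => simp
    | add x y _ _ hx hy => rw [map_add, hx, hy, AddMonoidAlgebra.single_add]
    | neg x _ hx => rw [map_neg, hx, AddMonoidAlgebra.single_neg]
    | mem x hx => exact hΔ d x hx
  rw [this, AddMonoidAlgebra.coeff_single]

noncomputable instance [GradedRing 𝓀] : GradedRing (deg p n) where
  one_mem := by
    have := mem_deg p (n := n) (HomEl.scalar (p := p) (SetLike.GradedOne.one_mem (A := 𝓀)))
    rwa [map_one] at this
  mul_mem _ _ _ _ ha hb := mul_mem_deg p ha hb
  toDecomposition := (deg_isInternal p).chooseDecomposition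

end Alg
end Grading

section Blocks

variable {k I : Type u} [CommRing k] [Fintype I] {C : BorcherdsCartan I} {𝓀 : ℤ → AddSubgroup k}

namespace Alg

variable (p : Params C 𝓀) {n : ℕ}

/-- The sum of the `e(ν)` over all `ν` with the property `φ`. -/
noncomputable def eSum (φ : (Fin n → I) → Prop) : Alg p n :=
  open Classical in ∑ ν : Fin n → I, if φ ν then e p ν else 0

variable {p} in
theorem ext_e {a b : Alg p n} (h : ∀ ν, a * e p ν = b * e p ν) : a = b := by
  rw [← mul_one a, ← mul_one b, ← e_sum, Finset.mul_sum, Finset.mul_sum]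
  exact Finset.sum_congr rfl fun ν _ => h ν

open Classical in
theorem eSum_mul_e (φ : (Fin n → I) → Prop) (ν : Fin n → I) :
    eSum p φ * e p ν = if φ ν then e p ν else 0 := by
  rw [eSum, Finset.sum_mul, Finset.sum_eq_single ν]
  · split_ifs <;> simp [e_mul_self]
  · intro μ _ h
    split_ifs <;> simp [e_mul_ne p h]
  · simp

theorem eSum_mul_eSum (φ ψ : (Fin n → I) → Prop) :
    eSum p φ * eSum p ψ = eSum p fun ν => φ ν ∧ ψ ν := by
  classical
  refine ext_e fun ν => ?_
  rw [mul_assoc, eSum_mul_e, eSum_mul_e]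
  by_cases h : ψ ν <;> simp [h, eSum_mul_e]

theorem eSum_comm_eSum (φ ψ : (Fin n → I) → Prop) :
    eSum p φ * eSum p ψ = eSum p ψ * eSum p φ := by
  rw [eSum_mul_eSum, eSum_mul_eSum]
  simp only [and_comm]

theorem eSum_idem (φ : (Fin n → I) → Prop) : IsIdempotentElem (eSum p φ) := by
  rw [IsIdempotentElem, eSum_mul_eSum]
  simp only [and_self]

theorem e_eq_eSum (ν : Fin n → I) : e p ν = eSum p fun μ => μ = ν := by
  classical
  refine ext_e fun μ => ?_
  rw [eSum_mul_e]
  split_ifs with h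
  · rw [h, e_mul_self]
  · rw [e_mul_ne p (Ne.symm h)]

theorem eSum_x (φ : (Fin n → I) → Prop) (a : Fin n) : eSum p φ * x p a = x p a * eSum p φ := by
  rw [eSum, Finset.sum_mul, Finset.mul_sum]
  refine Finset.sum_congr rfl fun ν _ => ?_
  split_ifs
  · exact (x_e p a ν).symm
  · simp

theorem eSum_t (φ : (Fin n → I) → Prop) (l : ℕ) (h : l + 1 < n)
    (hφ : ∀ ν, φ (ν ∘ swp l h) ↔ φ ν) : eSum p φ * t p l h = t p l h * eSum p φ := by
  classical
  refine ext_e fun ν => ?_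
  rw [mul_assoc, mul_assoc, tau_e, eSum_mul_e, ← mul_assoc, eSum_mul_e, hφ]
  split_ifs
  · exact (tau_e p l h ν).symm
  · simp

theorem eSum_mem (φ : (Fin n → I) → Prop) : eSum p φ ∈ deg p n 0 := by
  rw [eSum]
  refine AddSubgroup.sum_mem _ fun ν _ => ?_
  split_ifs
  · exact mem_deg p (HomEl.e ν)
  · exact zero_mem _

theorem emb_eSum (φ : (Fin n → I) → Prop) :
    emb p n (eSum p φ) = eSum p fun μ => φ (μ ∘ Fin.castSucc) := by
  classical
  refine ext_e fun μ => ?_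
  rw [eSum_mul_e, eSum, map_sum, Finset.sum_mul,
    Finset.sum_eq_single (μ ∘ Fin.castSucc)]
  · split_ifs
    · rw [emb_e, Finset.sum_mul, Finset.sum_eq_single (μ (Fin.last n))]
      · have : snoc (μ ∘ Fin.castSucc) (μ (Fin.last n)) = μ := by
          ext a
          refine Fin.lastCases ?_ (fun a => ?_) a <;> simp
        rw [this, e_mul_self]
      · intro j _ hj
        refine e_mul_ne p fun h => hj ?_
        simpa using congrFun h (Fin.last n)
      · simp
    · simp
  · intro ν _ hν
    split_ifs
    · rw [emb_e, Finset.sum_mul]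
      refine Finset.sum_eq_zero fun j _ => e_mul_ne p fun h => hν ?_
      rw [← h]
      ext a
      simp
    · simp
  · simp

/-- The weight `α_{ν_1} + ⋯ + α_{ν_n}` in `Q⁺ = ⨁ ℕ α_i`. -/
noncomputable def wt (ν : Fin n → I) : I →₀ ℕ := ∑ a, Finsupp.single (ν a) 1

theorem wt_swp (ν : Fin n → I) (l : ℕ) (h : l + 1 < n) : wt (ν ∘ swp l h) = wt ν :=
  Equiv.sum_comp (swp l h) fun a => Finsupp.single (ν a) 1

theorem wt_succ (μ : Fin (n + 1) → I) :
    wt μ = wt (μ ∘ Fin.castSucc) + Finsupp.single (μ (Fin.last n)) 1 :=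
  Fin.sum_univ_castSucc _

variable (n) in
/-- The idempotent `e(β) = ∑ e(ν)`, over all `ν` in `I ^ n` with
`α_{ν_1} + ⋯ + α_{ν_n} = β`. -/
noncomputable def eBeta (β : I →₀ ℕ) : Alg p n := eSum p fun ν => wt ν = β

variable (n) in
/-- The idempotent `e(n, i) = ∑ e(ν)`, over all `ν` in `I ^ (n + 1)` with `ν_{n+1} = i`. -/
noncomputable def eLast (i : I) : Alg p (n + 1) := eSum p fun ν => ν (Fin.last n) = i

theorem eBeta_idem (β : I →₀ ℕ) : IsIdempotentElem (eBeta p n β) := eSum_idem p _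

theorem eLast_idem (i : I) : IsIdempotentElem (eLast p n i) := eSum_idem p _

theorem eBeta_mem (β : I →₀ ℕ) : eBeta p n β ∈ deg p n 0 := eSum_mem p _

theorem eLast_mem (i : I) : eLast p n i ∈ deg p (n + 1) 0 := eSum_mem p _

/-- The idempotent `e(β)` is central, so that `e(β) R(n) = e(β) R(n) e(β)`. -/
theorem eBeta_central (β : I →₀ ℕ) (a : Alg p n) : eBeta p n β * a = a * eBeta p n β := by
  induction a using Alg.induction p with
  | scalar c => exact (Algebra.commutes _ _).symm
  | he ν => rw [e_eq_eSum, eBeta, eSum_comm_eSum]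
  | hx a => exact eSum_x p _ a
  | ht l h => exact eSum_t p _ l h fun ν => by rw [wt_swp]
  | mul a b ha hb => rw [← mul_assoc, ha, mul_assoc, hb, mul_assoc]
  | add a b ha hb => rw [mul_add, add_mul, ha, hb]

/-- The idempotent `e(n, i)` commutes with `R(n)`. -/
theorem eLast_comm (i : I) (a : Alg p n) : eLast p n i * emb p n a = emb p n a * eLast p n i := by
  induction a using Alg.induction p with
  | scalar c => rw [AlgHom.commutes]; exact (Algebra.commutes _ _).symm
  | he ν => rw [e_eq_eSum, emb_eSum, eLast, eSum_comm_eSum]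
  | hx a => rw [emb_x]; exact eSum_x p _ _
  | ht l h =>
    rw [emb_t]
    refine eSum_t p _ l _ fun ν => ?_
    rw [Function.comp_apply, swp_of_ne _ _ _ (by simp; omega) (by simp; omega)]
  | mul a b ha hb => rw [map_mul, ← mul_assoc, ha, mul_assoc, hb, mul_assoc]
  | add a b ha hb => rw [map_add, mul_add, add_mul, ha, hb]

theorem emb_mem_deg {d : ℤ} {a : Alg p n} (ha : a ∈ deg p n d) : emb p n a ∈ deg p (n + 1) d := by
  induction ha using AddSubgroup.closure_induction with
  | zero => simp
  | add x y _ _ hx hy => rw [map_add]; exact add_mem hx hy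
  | neg x _ hx => rw [map_neg]; exact neg_mem hx
  | mem a ha =>
    induction ha with
    | scalar hc => rw [AlgHom.commutes]; exact mem_deg p (HomEl.scalar hc)
    | e ν =>
      rw [emb_e]
      exact AddSubgroup.sum_mem _ fun i _ => mem_deg p (HomEl.e _)
    | x a ν =>
      rw [map_mul, emb_e, emb_x, Finset.mul_sum]
      refine AddSubgroup.sum_mem _ fun i _ => ?_
      have := mem_deg p (HomEl.x (p := p) a.castSucc (snoc ν i))
      rwa [snoc_castSucc] at this
    | t l h ν =>
      rw [map_mul, emb_e, emb_t, Finset.mul_sum]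
      refine AddSubgroup.sum_mem _ fun i _ => ?_
      have := mem_deg p (HomEl.t (p := p) l (Nat.lt_succ_of_lt h) (snoc ν i))
      rwa [snoc_lo ν i l h, snoc_hi ν i l h] at this
    | mul _ _ ha hb => rw [map_mul]; exact mul_mem_deg p ha hb

end Alg

variable (p : Params C 𝓀) (n : ℕ) (β : I →₀ ℕ)

/-- The algebra `R(β) = e(β) R(n)`, for `β` in `Q⁺` of height `n`. Since `e(β)` is central, it is
the ring of the elements `e(β) r e(β)` with unit `e(β)`. (It is zero if `β` is not of height
`n`.) -/
abbrev Block : Type u := (Alg.eBeta_idem p (n := n) β).Corner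

namespace Block

/-- The inclusion of `R(β)` in `R(n)`. -/
def incl : Block p n β →ₙ+* Alg p n where
  toFun r := r.1
  map_mul' _ _ := rfl
  map_add' _ _ := rfl
  map_zero' := rfl

theorem incl_one : incl p n β 1 = Alg.eBeta p n β := rfl

variable {p n β} in
theorem mem_iff {r : Alg p n} : r ∈ Subsemigroup.corner (Alg.eBeta p n β) ↔
    Alg.eBeta p n β * r = r := by
  rw [Subsemigroup.mem_corner_iff (Alg.eBeta_idem p β), Alg.eBeta_central, and_self]

variable {p n β} in
theorem mul_incl (r : Block p n β) : Alg.eBeta p n β * incl p n β r = incl p n β r :=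
  mem_iff.1 r.2

/-- The ring homomorphism `c ↦ c e(β)`. -/
noncomputable def scalar : k →+* Block p n β where
  toFun c := ⟨algebraMap k _ c * Alg.eBeta p n β, mem_iff.2 (by
    rw [← mul_assoc, ← Algebra.commutes, mul_assoc, (Alg.eBeta_idem p β).eq])⟩
  map_one' := Subtype.ext (by
    change algebraMap k _ 1 * Alg.eBeta p n β = Alg.eBeta p n β
    rw [map_one, one_mul])
  map_mul' a b := Subtype.ext (by
    change algebraMap k _ (a * b) * Alg.eBeta p n β =
      algebraMap k _ a * Alg.eBeta p n β * (algebraMap k _ b * Alg.eBeta p n β)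
    rw [map_mul, mul_assoc, mul_assoc, ← mul_assoc (Alg.eBeta p n β), ← Algebra.commutes b,
      mul_assoc, (Alg.eBeta_idem p β).eq])
  map_zero' := Subtype.ext (by
    change algebraMap k _ 0 * Alg.eBeta p n β = 0
    rw [map_zero, zero_mul])
  map_add' a b := Subtype.ext (by
    change algebraMap k _ (a + b) * Alg.eBeta p n β =
      algebraMap k _ a * Alg.eBeta p n β + algebraMap k _ b * Alg.eBeta p n β
    rw [map_add, add_mul])

noncomputable instance : Algebra k (Block p n β) :=
  (scalar p n β).toAlgebra' fun c r => Subtype.ext (by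
    change algebraMap k _ c * Alg.eBeta p n β * incl p n β r =
      incl p n β r * (algebraMap k _ c * Alg.eBeta p n β)
    rw [mul_assoc, Alg.eBeta_central, ← mul_assoc, Algebra.commutes, mul_assoc])

/-- The grading of `R(β)`. -/
noncomputable def deg (d : ℤ) : AddSubgroup (Block p n β) :=
  (Alg.deg p n d).comap (incl p n β).toAddMonoidHom

variable {p n β} in
theorem algebraMap_mem {d : ℤ} {c : k} (hc : c ∈ 𝓀 d) :
    algebraMap k (Block p n β) c ∈ deg p n β d := by
  change algebraMap k (Alg p n) c * Alg.eBeta p n β ∈ Alg.deg p n d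
  rw [← add_zero d]
  exact Alg.mul_mem_deg p (Alg.mem_deg p (Alg.HomEl.scalar hc)) (Alg.eBeta_mem p _)

theorem deg_isInternal [GradedRing 𝓀] : DirectSum.IsInternal (deg p n β) := by
  refine isInternal_retract (Alg.deg_isInternal p) (incl p n β).toAddMonoidHom
    (AddMonoidHom.mk' (fun r => (⟨Alg.eBeta p n β * r, mem_iff.2 (by
      rw [← mul_assoc, (Alg.eBeta_idem p β).eq])⟩ : Block p n β))
      (fun a b => Subtype.ext (mul_add _ _ _)))
    (fun r => Subtype.ext (mul_incl r)) (fun d m hm => ?_)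
  change Alg.eBeta p n β * m ∈ _
  rw [← zero_add d]
  exact Alg.mul_mem_deg p (Alg.eBeta_mem p _) hm

noncomputable instance [GradedRing 𝓀] : GradedRing (deg p n β) where
  one_mem := Alg.eBeta_mem p _
  mul_mem _ _ _ _ ha hb := Alg.mul_mem_deg p ha hb
  toDecomposition := (deg_isInternal p n β).chooseDecomposition

variable {n β}

theorem eBeta_mul_eLast {δ : I →₀ ℕ} {i : I} (h : δ = β + Finsupp.single i 1) :
    Alg.eBeta p (n + 1) δ * Alg.eLast p n i =
      Alg.emb p n (Alg.eBeta p n β) * Alg.eLast p n i := by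
  rw [Alg.eBeta, Alg.eBeta, Alg.eLast, Alg.emb_eSum, Alg.eSum_mul_eSum, Alg.eSum_mul_eSum]
  congr 1
  ext μ
  refine and_congr_left fun hμ => ?_
  rw [Alg.wt_succ, h, hμ, add_left_inj]

/-- The homomorphism `R(β) → R(β + α_i)`, `r ↦ r e(n, i)`. It sends `1` to
`e(β, i) = e(β + α_i) e(n, i)`; see `ofSucc_idem`. -/
noncomputable def ofSucc {δ : I →₀ ℕ} {i : I} (h : δ = β + Finsupp.single i 1) :
    GrHom (deg p n β) (deg p (n + 1) δ) where
  toFun r := ⟨Alg.emb p n (incl p n β r) * Alg.eLast p n i, mem_iff.2 (by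
    rw [Alg.eBeta_central, mul_assoc, ← Alg.eBeta_central, eBeta_mul_eLast p h, ← mul_assoc,
      ← map_mul, ← Alg.eBeta_central, mul_incl])⟩
  map_mul' a b := Subtype.ext (by
    change Alg.emb p n (incl p n β (a * b)) * Alg.eLast p n i =
      Alg.emb p n (incl p n β a) * Alg.eLast p n i *
      (Alg.emb p n (incl p n β b) * Alg.eLast p n i)
    rw [map_mul, map_mul, mul_assoc, mul_assoc, ← mul_assoc (Alg.eLast p n i), Alg.eLast_comm,
      mul_assoc (Alg.emb p n (incl p n β b)), (Alg.eLast_idem p i).eq])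
  map_zero' := Subtype.ext (by
    change Alg.emb p n (incl p n β 0) * Alg.eLast p n i = 0
    rw [map_zero, map_zero, zero_mul])
  map_add' a b := Subtype.ext (by
    change Alg.emb p n (incl p n β (a + b)) * Alg.eLast p n i =
      Alg.emb p n (incl p n β a) * Alg.eLast p n i + Alg.emb p n (incl p n β b) * Alg.eLast p n i
    rw [map_add, map_add, add_mul])
  map_mem' {d a} ha := by
    change Alg.emb p n (incl p n β a) * Alg.eLast p n i ∈ Alg.deg p (n + 1) d
    rw [← add_zero d]
    exact Alg.mul_mem_deg p (Alg.emb_mem_deg p ha) (Alg.eLast_mem p _)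

theorem ofSucc_idem {δ : I →₀ ℕ} {i : I} (h : δ = β + Finsupp.single i 1) :
    incl p (n + 1) δ (ofSucc p h : GrHom (deg p n β) _).idem =
      Alg.eBeta p (n + 1) δ * Alg.eLast p n i := (eBeta_mul_eLast p h).symm

end Block

variable [GradedRing 𝓀] {δ : I →₀ ℕ}

/-- The simple root `α_i` as an element of `Q⁺`. -/
noncomputable abbrev root (i : I) : I →₀ ℕ := Finsupp.single i 1

/-- The category of graded left `R(β)`-modules and degree preserving homomorphisms. -/
abbrev Mod (p : Params C 𝓀) (n : ℕ) (β : I →₀ ℕ) := GrMod.{max u w} (Block.deg p n β)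

/-- The functor `E_i : Mod R(β + α_i) ⥤ Mod R(β)`, `M ↦ e(β, i) M`. -/
noncomputable def E (i : I) (h : δ = β + root i) : Mod.{u, w} p (n + 1) δ ⥤ Mod.{u, w} p n β :=
  (Block.ofSucc p h).restrict

/-- The functor `F_i : Mod R(β) ⥤ Mod R(β + α_i)`, `N ↦ R(β + α_i) e(β, i) ⊗_{R(β)} N`. -/
noncomputable def F (i : I) (h : δ = β + root i) : Mod.{u, w} p n β ⥤ Mod.{u, w} p (n + 1) δ :=
  GrHom.induct.{u, w} (Block.ofSucc p h)

/-- The degree shift functor `q ^ s`: `(q ^ s M)_d = M_{d - s}`. -/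
noncomputable def qShift (s : ℤ) : Mod.{u, w} p n β ⥤ Mod.{u, w} p n β :=
  GrMod.shift (Block.deg p n β) s

/-- The functor `M ↦ M ⊗_k k[t]`, where the indeterminate `t` has degree `s`. -/
noncomputable def tensorPoly (s : ℤ) : Mod.{u, w} p n β ⥤ Mod.{u, w} p n β :=
  polyFunctor.{u, w} 𝓀 Block.algebraMap_mem s

end Blocks

section Bimodule

variable {k I : Type u} [CommRing k] [Fintype I] {C : BorcherdsCartan I} {𝓀 : ℤ → AddSubgroup k}

/-- The algebra `R(n + 1)` as a bimodule over itself and, by restriction, over `R(n)`. -/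
def Reg (p : Params C 𝓀) (n : ℕ) : Type u := Alg p (n + 1)

namespace Reg

variable (p : Params C 𝓀) (n : ℕ)

noncomputable instance : AddCommGroup (Reg p n) := inferInstanceAs (AddCommGroup (Alg p (n + 1)))

noncomputable instance : Module (Alg p (n + 1)) (Reg p n) :=
  inferInstanceAs (Module (Alg p (n + 1)) (Alg p (n + 1)))

/-- The left action `a • y = a y` of `R(n)`. -/
noncomputable instance : Module (Alg p n) (Reg p n) :=
  Module.compHom (Alg p (n + 1)) (Alg.emb p n).toRingHom

/-- The right action `x • a = x a` of `R(n)`. -/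
noncomputable instance : Module (Alg p n)ᵐᵒᵖ (Reg p n) :=
  Module.compHom (Alg p (n + 1)) (Alg.emb p n).toRingHom.op

variable {p n}

/-- An element of `R(n + 1)`. -/
def of (a : Alg p (n + 1)) : Reg p n := a

/-- Right multiplication by an element of `R(n + 1)`. -/
noncomputable def mulRight (v : Alg p (n + 1)) : Reg p n →ₗ[Alg p n] Reg p n where
  toFun y := (show Alg p (n + 1) from y) * v
  map_add' a _ := add_mul (show Alg p (n + 1) from a) _ v
  map_smul' a b := mul_assoc (Alg.emb p n a) (show Alg p (n + 1) from b) v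

end Reg

variable (p : Params C 𝓀) (n : ℕ)

/-- The `(R(n + 1), R(n + 1))`-bimodule `R(n + 1) ⊗_{R(n)} R(n + 1)`. -/
abbrev SelfTensor : Type u := BalTensor (Alg p (n + 1)) (Alg p n) (Reg p n) (Reg p n)

namespace SelfTensor

variable {p n}

/-- The element `x ⊗ y`. -/
noncomputable def tmul (x y : Alg p (n + 1)) : SelfTensor p n :=
  BalTensor.tmul (Reg.of x) (Reg.of y)

/-- The right action of `R(n + 1)`: `(x ⊗ y) · v = x ⊗ (y v)`. -/
noncomputable def mulRight (v : Alg p (n + 1)) (t : SelfTensor p n) : SelfTensor p n :=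
  BalTensor.map (Alg p (n + 1)) (Alg p n) (Reg p n) (Reg.mulRight v) t

end SelfTensor

/-- The subalgebra `R(n, 1)` of `R(n + 1)`, the image of `R(n) ⊗_k R(1)`: it is generated by
`R(n)`, `x_{n+1}` and the `e(n, i)`. -/
noncomputable def parabolic : Subalgebra k (Alg p (n + 1)) :=
  Algebra.adjoin k (Set.range (Alg.emb p n) ∪ {Alg.x p (Fin.last n)} ∪ Set.range (Alg.eLast p n))

/-- The homomorphism `R(n) → R(n, 1)`. -/
noncomputable def toParabolic : Alg p n →ₐ[k] parabolic p n :=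
  (Alg.emb p n).codRestrict (parabolic p n) fun a =>
    Algebra.subset_adjoin (Or.inl (Or.inl ⟨a, rfl⟩))

end Bimodule

end KLR

/-! Everything rests on one structural fact (`expand_bijective`): R(n+1) is a free right R(n)-module
on the elements τ_a ⋯ τ_{n-1} x_n^r e(n,i), with 0 ≤ a ≤ n, r ≥ 0, i ∈ I and positions counted from
0.

Spanning. Let τ be the last crossing of R(m+2) and J = R(m+1) τ R(m+1) + R(m+1,1). Then J contains 1
and is stable under left multiplication by every generator, so J is the whole algebra
(`mem_mackey`). The only serious products are τ x τ with x in R(m+1). By induction on m such an x is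
a sum of elements of R(m,1), which lead back to τ², and of elements a τ' b with τ' the previous
crossing and a, b commuting with τ, where the braid relation applies (`tl_mul_par_mul_tl`,
`braid_mem`).

Independence. R(n) acts on the functions I^n → K, where K is the total ring of fractions of k[X_0,
X_1, ...]. Each τ_l acts as α s_l + β with α a unit; the conditions on the leading coefficients of
P_i and Q_ij make their values at two distinct variables non-zero-divisors, so that these become
units of K. The product τ_a ⋯ τ_{n-1} then splits into operators U_b, a ≤ b ≤ n, with U_b x_n = x_b
U_b and U_a injective (`exists_rep_cyc`). In a linear relation, a Vandermonde argument separates the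
b, triangularity separates the a, the last colour separates the i, and replacing X_n by infinitely
many other variables separates the r. Hence faithfulness for R(n) gives both the basis of R(n+1)
over R(n) and faithfulness for R(n+1); the induction starts with R(0), which consists of scalars
(`rep_faithful`).

Bimodules. Modulo R(m+1,1), the map x ⊗ y ↦ x τ y sends the spanning family of R(m+1) ⊗_{R(m)}
R(m+1) to the part a ≤ m of the basis of R(m+2), while R(m+1,1) is the part a = m+1. This gives the
decomposition of R(m+2) (`mackeySum_bijective`).

Functors. E_i F_j N is cut out of R(m+2) ⊗ N by idempotents on both sides. The first summand of the
decomposition becomes F_j E_i N through z ⊗ x ↦ z τ ⊗ x, and the shift is the degree of τ. In the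
second summand e(n,i) is central, so that this summand disappears for i ≠ j and becomes N ⊗ k[t],
with t^r ↦ x_n^r, for i = j. If α_i does not occur in β, the first summand is killed instead. All
maps are natural, preserve degrees and are bijective, hence they are isomorphisms of graded modules.
-/

namespace KLR

/-! ### Generic points, and the braid relation as an identity of fractions. -/

section Generic

open MvPolynomial

/-- If `∑ b, x_b ^ r • v_b = 0` for all `r` and the differences of the `x_b` are units, then all
`v_b` vanish. -/
theorem eq_zero_of_forall_sum_pow_mul {K ι : Type*} [CommRing K] {x v : ι → K} {s : Finset ι}
    (hx : ∀ a ∈ s, ∀ b ∈ s, a ≠ b → IsUnit (x a - x b))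
    (h : ∀ r : ℕ, ∑ b ∈ s, x b ^ r * v b = 0) : ∀ b ∈ s, v b = 0 := by
  classical
  induction s using Finset.induction_on generalizing v with
  | empty => simp
  | insert c s hc ih =>
    have h1 : ∀ b ∈ s, v b = 0 := by
      -- Subtracting x_c times the relation for r from the relation for r + 1 removes the term of c
      -- and multiplies v_b by x_b - x_c, a unit for b ≠ c.
      have := ih (v := fun b => (x b - x c) * v b)
        (fun a ha b hb => hx a (Finset.mem_insert_of_mem ha) b (Finset.mem_insert_of_mem hb))
        (fun r => by
          have h0 := h r
          have h1 := h (r + 1)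
          rw [Finset.sum_insert hc] at h0 h1
          have h2 : ∑ b ∈ s, x b ^ r * ((x b - x c) * v b) =
              ∑ b ∈ s, x b ^ (r + 1) * v b - x c * ∑ b ∈ s, x b ^ r * v b := by
            rw [Finset.mul_sum, ← Finset.sum_sub_distrib]
            exact Finset.sum_congr rfl fun b _ => by ring
          rw [h2]
          linear_combination h1 - x c * h0)
      intro b hb
      exact (hx b (Finset.mem_insert_of_mem hb) c (Finset.mem_insert_self _ _)
        (fun h => hc (h ▸ hb))).mul_right_eq_zero.1 (this b hb)
    intro b hb
    rcases Finset.mem_insert.1 hb with rfl | hb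
    · have := h 0
      rw [Finset.sum_insert hc, Finset.sum_eq_zero fun b hb => by rw [h1 b hb, mul_zero]] at this
      simpa using this
    · exact h1 b hb

/-- A generic point: an algebra with elements `X a` permuted by the finite permutations, such that
all `X a - X b`, `P_i(X a, X b)` and `Q_ij(X a, X b)` are invertible. -/
structure Generic {k I : Type u} [CommRing k] {C : BorcherdsCartan I} {𝓀 : ℤ → AddSubgroup k}
    (p : Params C 𝓀) (K : Type u) [CommRing K] [Algebra k K] where
  X : ℕ → K
  perm : Equiv.Perm ℕ → K →ₐ[k] K
  perm_X : ∀ σ a, perm σ (X a) = X (σ a)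
  perm_mul : ∀ σ τ y, perm (σ * τ) y = perm σ (perm τ y)
  perm_one : ∀ y, perm 1 y = y
  isUnit_sub : ∀ {a b}, a ≠ b → IsUnit (X a - X b)
  isUnit_P : ∀ i {a b}, a ≠ b → IsUnit (aeval ![X a, X b] (p.P i))
  isUnit_Q : ∀ {i j}, i ≠ j → ∀ {a b}, a ≠ b → IsUnit (aeval ![X a, X b] (p.Q i j))
  injective : Function.Injective (algebraMap k K)

namespace Generic

variable {k I : Type u} [CommRing k] {C : BorcherdsCartan I} {𝓀 : ℤ → AddSubgroup k}
  {p : Params C 𝓀} {K : Type u} [CommRing K] [Algebra k K] (G : Generic p K)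

/-- The inverse of `X a - X b`. -/
noncomputable def inv (a b : ℕ) : K := Ring.inverse (G.X a - G.X b)

theorem mul_inv {a b : ℕ} (h : a ≠ b) : (G.X a - G.X b) * G.inv a b = 1 :=
  Ring.mul_inverse_cancel _ (G.isUnit_sub h)

theorem inv_eq {a b : ℕ} (h : a ≠ b) {y : K} (hy : (G.X a - G.X b) * y = 1) : y = G.inv a b :=
  (G.isUnit_sub h).mul_right_injective (hy.trans (G.mul_inv h).symm)

theorem perm_inv (σ : Equiv.Perm ℕ) {a b : ℕ} (h : a ≠ b) :
    G.perm σ (G.inv a b) = G.inv (σ a) (σ b) := by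
  refine G.inv_eq (fun h' => h (σ.injective h')) ?_
  rw [← G.perm_X, ← G.perm_X, ← map_sub, ← map_mul, G.mul_inv h, map_one]

theorem inv_symm {a b : ℕ} (h : a ≠ b) : G.inv b a = -G.inv a b := by
  refine (G.inv_eq h.symm ?_).symm
  linear_combination G.mul_inv h

/-- `P_i(X a, X b)`. -/
noncomputable def P (i : I) (a b : ℕ) : K := aeval ![G.X a, G.X b] (p.P i)

/-- `Q_ij(X a, X b)`. -/
noncomputable def Q (i j : I) (a b : ℕ) : K := aeval ![G.X a, G.X b] (p.Q i j)

theorem perm_aeval {m : ℕ} (σ : Equiv.Perm ℕ) (a : Fin m → ℕ) (f : MvPolynomial (Fin m) k) :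
    G.perm σ (aeval (fun j => G.X (a j)) f) = aeval (fun j => G.X (σ (a j))) f := by
  rw [← AlgHom.comp_apply]
  congr 1
  ext j : 1
  simp [G.perm_X]

theorem aeval_two (a b : ℕ) (f : MvPolynomial (Fin 2) k) :
    aeval ![G.X a, G.X b] f = aeval (fun j => G.X (![a, b] j)) f := by
  congr 2
  ext j
  fin_cases j <;> rfl

theorem perm_aeval_two (σ : Equiv.Perm ℕ) (a b : ℕ) (f : MvPolynomial (Fin 2) k) :
    G.perm σ (aeval ![G.X a, G.X b] f) = aeval ![G.X (σ a), G.X (σ b)] f := by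
  rw [aeval_two, aeval_two, perm_aeval]
  congr 2
  ext j
  fin_cases j <;> rfl

theorem perm_P (σ : Equiv.Perm ℕ) (i : I) (a b : ℕ) : G.perm σ (G.P i a b) = G.P i (σ a) (σ b) :=
  G.perm_aeval_two σ a b _

theorem perm_Q (σ : Equiv.Perm ℕ) (i j : I) (a b : ℕ) :
    G.perm σ (G.Q i j a b) = G.Q i j (σ a) (σ b) :=
  G.perm_aeval_two σ a b _

theorem Q_symm (i j : I) (a b : ℕ) : G.Q i j a b = G.Q j i b a := by
  rw [Q, p.Q_symm i j, Q, ← AlgHom.comp_apply]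
  congr 1
  ext j : 1
  fin_cases j <;> simp

theorem aeval_Pat {m : ℕ} (i : I) (a b : Fin m) (z : Fin m → ℕ) :
    aeval (fun j => G.X (z j)) (p.Pat i a b) = G.P i (z a) (z b) := by
  rw [Params.Pat, P, ← AlgHom.comp_apply]
  congr 1
  ext j : 1
  fin_cases j <;> simp

theorem aeval_Qat {m : ℕ} (i j : I) (a b : Fin m) (z : Fin m → ℕ) :
    aeval (fun j => G.X (z j)) (p.Qat i j a b) = G.Q i j (z a) (z b) := by
  rw [Params.Qat, Q, ← AlgHom.comp_apply]
  congr 1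
  ext j : 1
  fin_cases j <;> simp

/-- The quotients in the defining relations are exact divisions of polynomials. At a generic point
the denominators are units, so the values are honest fractions with which one can calculate. -/
theorem aeval_dP (i : I) {a b : ℕ} (h : a ≠ b) :
    aeval ![G.X a, G.X b] (p.dP i) = (G.P i b a - G.P i a b) * G.inv a b := by
  have := congrArg (aeval (fun j => G.X (![a, b] j))) (p.dP_mul i)
  simp only [map_mul, map_sub, aeval_X, aeval_Pat] at this
  simp only [← aeval_two, Matrix.cons_val_zero, Matrix.cons_val_one] at this
  rw [← this, mul_assoc, G.mul_inv h, mul_one]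

theorem aeval_three (a b c : ℕ) (f : MvPolynomial (Fin 3) k) :
    aeval ![G.X a, G.X b, G.X c] f = aeval (fun j => G.X (![a, b, c] j)) f := by
  congr 2
  ext j
  fin_cases j <;> rfl

theorem aeval_Qbar (i j : I) {a b c : ℕ} (h : a ≠ c) :
    aeval ![G.X a, G.X b, G.X c] (p.Qbar i j) = (G.Q i j a b - G.Q i j c b) * G.inv a c := by
  have := congrArg (aeval (fun j => G.X (![a, b, c] j))) (p.Qbar_mul i j)
  simp only [map_mul, map_sub, aeval_X, aeval_Qat] at this
  simp only [← aeval_three] at this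
  have h' : aeval ![G.X a, G.X b, G.X c] (p.Qbar i j) * (G.X a - G.X c) =
    G.Q i j a b - G.Q i j c b := this
  rw [← h', mul_assoc, G.mul_inv h, mul_one]

theorem aeval_Pbar' (i : I) {a b c : ℕ} (hab : a ≠ b) (hbc : b ≠ c) (hac : a ≠ c) :
    aeval ![G.X a, G.X b, G.X c] (p.Pbar' i) =
      G.P i b a * G.P i a c * (G.inv a b * G.inv a c) +
      G.P i a c * G.P i b c * (G.inv a c * G.inv b c) -
      G.P i a b * G.P i b c * (G.inv a b * G.inv b c) := by
  have := congrArg (aeval (fun j => G.X (![a, b, c] j))) (p.Pbar'_mul i)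
  simp only [Params.vand, Params.num', map_mul, map_sub, map_add, aeval_X, aeval_Pat] at this
  simp only [← aeval_three] at this
  have h' : aeval ![G.X a, G.X b, G.X c] (p.Pbar' i) *
      ((G.X a - G.X b) * (G.X a - G.X c) * (G.X b - G.X c)) =
      G.P i b a * G.P i a c * (G.X b - G.X c) + G.P i a c * G.P i b c * (G.X a - G.X b) -
      G.P i a b * G.P i b c * (G.X a - G.X c) := this
  have h1 := G.mul_inv hab
  have h2 := G.mul_inv hbc
  have h3 := G.mul_inv hac
  -- The three differences are units, so the identity may be checked after clearing all
  -- denominators.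
  apply (G.isUnit_sub hab).mul_left_injective
  apply (G.isUnit_sub hac).mul_left_injective
  apply (G.isUnit_sub hbc).mul_left_injective
  simp only []
  linear_combination h' - G.P i b a * G.P i a c * (G.X b - G.X c) *
      (h1 * (G.X a - G.X c) * G.inv a c + h3) -
    G.P i a c * G.P i b c * (G.X a - G.X b) * (h3 * (G.X b - G.X c) * G.inv b c + h2) +
    G.P i a b * G.P i b c * (G.X a - G.X c) * (h1 * (G.X b - G.X c) * G.inv b c + h2)

theorem aeval_Pbar'' (i : I) {a b c : ℕ} (hab : a ≠ b) (hbc : b ≠ c) (hac : a ≠ c) :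
    aeval ![G.X a, G.X b, G.X c] (p.Pbar'' i) =
      - (G.P i a b * G.P i a c * (G.inv a b * G.inv a c)) -
      G.P i a c * G.P i c b * (G.inv a c * G.inv b c) +
      G.P i a b * G.P i b c * (G.inv a b * G.inv b c) := by
  have := congrArg (aeval (fun j => G.X (![a, b, c] j))) (p.Pbar''_mul i)
  simp only [Params.vand, Params.num'', map_mul, map_sub, map_neg, map_add, aeval_X,
    aeval_Pat] at this
  simp only [← aeval_three] at this
  have h' : aeval ![G.X a, G.X b, G.X c] (p.Pbar'' i) *
      ((G.X a - G.X b) * (G.X a - G.X c) * (G.X b - G.X c)) =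
      -(G.P i a b * G.P i a c * (G.X b - G.X c)) - G.P i a c * G.P i c b * (G.X a - G.X b) +
      G.P i a b * G.P i b c * (G.X a - G.X c) := this
  have h1 := G.mul_inv hab
  have h2 := G.mul_inv hbc
  have h3 := G.mul_inv hac
  apply (G.isUnit_sub hab).mul_left_injective
  apply (G.isUnit_sub hac).mul_left_injective
  apply (G.isUnit_sub hbc).mul_left_injective
  simp only []
  linear_combination h' + G.P i a b * G.P i a c * (G.X b - G.X c) *
      (h1 * (G.X a - G.X c) * G.inv a c + h3) +
    G.P i a c * G.P i c b * (G.X a - G.X b) * (h3 * (G.X b - G.X c) * G.inv b c + h2) -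
    G.P i a b * G.P i b c * (G.X a - G.X c) * (h1 * (G.X b - G.X c) * G.inv b c + h2)

open Classical in
/-- The coefficient of the transposition in the action of `τ`. -/
noncomputable def α (i j : I) (a b : ℕ) : K :=
  if i = j then G.P i a b * G.inv a b else if WellOrderingRel i j then G.Q i j a b else 1

open Classical in
/-- The coefficient of the identity in the action of `τ`. -/
noncomputable def β (i j : I) (a b : ℕ) : K := if i = j then -(G.P i a b * G.inv a b) else 0

/-- This is where the invertibility of the values of P_i and Q_ij is used: it makes the permuting
part of τ injective, which is what independence needs. -/
theorem isUnit_α (i j : I) {a b : ℕ} (h : a ≠ b) : IsUnit (G.α i j a b) := by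
  rw [α]
  split_ifs with h1 h2
  · refine (G.isUnit_P i h).mul ?_
    exact IsUnit.of_mul_eq_one_right _ (G.mul_inv h)
  · exact G.isUnit_Q h1 h
  · exact isUnit_one

theorem perm_α (σ : Equiv.Perm ℕ) (i j : I) {a b : ℕ} (h : a ≠ b) :
    G.perm σ (G.α i j a b) = G.α i j (σ a) (σ b) := by
  rw [α, α]
  split_ifs
  · rw [map_mul, G.perm_P, G.perm_inv σ h]
  · rw [G.perm_Q]
  · rw [map_one]

theorem perm_β (σ : Equiv.Perm ℕ) (i j : I) {a b : ℕ} (h : a ≠ b) :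
    G.perm σ (G.β i j a b) = G.β i j (σ a) (σ b) := by
  rw [β, β]
  split_ifs
  · rw [map_neg, map_mul, G.perm_P, G.perm_inv σ h]
  · rw [map_zero]

theorem α_self (i : I) (a b : ℕ) : G.α i i a b = G.P i a b * G.inv a b := if_pos rfl

theorem β_self (i : I) (a b : ℕ) : G.β i i a b = -(G.P i a b * G.inv a b) := if_pos rfl

theorem β_of_ne {i j : I} (h : i ≠ j) (a b : ℕ) : G.β i j a b = 0 := if_neg h

/-- For distinct colours τ² only sees the product of the two coefficients. A well-order on I decides
which ordering of the two colours carries all of Q_ij; the other one carries 1. -/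
theorem α_mul_α {i j : I} (h : i ≠ j) (a b : ℕ) :
    G.α i j a b * G.α j i b a = G.Q i j a b := by
  rw [α, α, if_neg h, if_neg h.symm]
  rcases trichotomous_of WellOrderingRel i j with h1 | h1 | h1
  · rw [if_pos h1, if_neg (asymm h1), mul_one]
  · exact absurd h1 h
  · rw [if_neg (asymm h1), if_pos h1, one_mul, G.Q_symm]

/-- The action of `τ` on the first two of three colours. -/
noncomputable def T₁ (a b : ℕ) (F : I → I → I → K) (i j k : I) : K :=
  G.α i j a b * G.perm (Equiv.swap a b) (F j i k) + G.β i j a b * F i j k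

/-- The action of `τ` on the last two of three colours. -/
noncomputable def T₂ (b c : ℕ) (F : I → I → I → K) (i j k : I) : K :=
  G.α j k b c * G.perm (Equiv.swap b c) (F i k j) + G.β j k b c * F i j k

/-- Once all permutations are moved to the right, both triple products are combinations of permuted
values of F. The terms of the longest permutation agree by the braid relation of transpositions, and
the error terms come from the identity parts β, which are present only for equal neighbouring
colours. What remains is an identity of coefficients in each pattern of equal colours. -/
theorem T_braid {a b c : ℕ} (hab : a ≠ b) (hbc : b ≠ c) (hac : a ≠ c) (F : I → I → I → K)
    (i j k : I) :
    (i ≠ k → G.T₂ b c (G.T₁ a b (G.T₂ b c F)) i j k = G.T₁ a b (G.T₂ b c (G.T₁ a b F)) i j k) ∧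
    (i = k → i ≠ j → G.T₂ b c (G.T₁ a b (G.T₂ b c F)) i j k -
      G.T₁ a b (G.T₂ b c (G.T₁ a b F)) i j k = G.P i a c *
        aeval ![G.X a, G.X b, G.X c] (p.Qbar i j) * F i j k) ∧
    (i = k → i = j → G.T₂ b c (G.T₁ a b (G.T₂ b c F)) i j k -
      G.T₁ a b (G.T₂ b c (G.T₁ a b F)) i j k =
        aeval ![G.X a, G.X b, G.X c] (p.Pbar' i) * G.T₁ a b F i j k +
        aeval ![G.X a, G.X b, G.X c] (p.Pbar'' i) * G.T₂ b c F i j k) := by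
  have s1 : Equiv.swap a b c = c := Equiv.swap_apply_of_ne_of_ne hac.symm hbc.symm
  have s2 : Equiv.swap b c a = a := Equiv.swap_apply_of_ne_of_ne hab hac
  have inv1 : ∀ y, G.perm (Equiv.swap a b) (G.perm (Equiv.swap a b) y) = y := fun y => by
    rw [← G.perm_mul, Equiv.swap_mul_self, G.perm_one]
  have inv2 : ∀ y, G.perm (Equiv.swap b c) (G.perm (Equiv.swap b c) y) = y := fun y => by
    rw [← G.perm_mul, Equiv.swap_mul_self, G.perm_one]
  have br : ∀ y, G.perm (Equiv.swap b c) (G.perm (Equiv.swap a b) (G.perm (Equiv.swap b c) y)) =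
      G.perm (Equiv.swap a b) (G.perm (Equiv.swap b c) (G.perm (Equiv.swap a b) y)) := fun y => by
    rw [← G.perm_mul, ← G.perm_mul, ← G.perm_mul, ← G.perm_mul]
    congr 1
    congr 1
    have e1 := Equiv.swap_mul_swap_mul_swap hab hac
    have e2 := Equiv.swap_mul_swap_mul_swap hbc.symm hac.symm
    rw [e1, Equiv.swap_comm a b, Equiv.swap_comm b c, e2, Equiv.swap_comm]
  simp only [T₁, T₂, map_add, map_mul, G.perm_α _ _ _ hab, G.perm_α _ _ _ hbc,
    G.perm_α _ _ _ hac, G.perm_β _ _ _ hab, G.perm_β _ _ _ hbc, G.perm_β _ _ _ hac,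
    G.perm_α _ _ _ hab.symm, G.perm_α _ _ _ hbc.symm, G.perm_α _ _ _ hac.symm,
    G.perm_β _ _ _ hab.symm, G.perm_β _ _ _ hbc.symm, G.perm_β _ _ _ hac.symm,
    Equiv.swap_apply_left, Equiv.swap_apply_right, s1, s2, inv1, inv2, br]
  refine ⟨fun hik => ?_, ?_, ?_⟩
  · by_cases hij : i = j
    · subst hij
      simp only [G.β_of_ne hik]
      simp only [α_self, β_self, G.inv_symm hab, G.inv_symm hbc, G.inv_symm hac]
      ring
    · by_cases hjk : j = k
      · subst hjk
        simp only [G.β_of_ne hik, α_self, β_self]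
        ring
      · simp only [G.β_of_ne hik, G.β_of_ne hij, G.β_of_ne hjk, G.β_of_ne (Ne.symm hij),
          G.β_of_ne (Ne.symm hjk)]
        ring
  · rintro rfl hij
    simp only [G.β_of_ne hij, G.β_of_ne hij.symm, G.aeval_Qbar i j hac]
    -- Two crossings of distinct colours around one β produce Q; writing Q as that product of α's
    -- turns the claim into a polynomial identity.
    simp only [← G.α_mul_α hij, β_self]
    ring
  · rintro rfl rfl
    simp only [aeval_Pbar' G i hab hbc hac, aeval_Pbar'' G i hab hbc hac, α_self, β_self,
      G.inv_symm hab, G.inv_symm hbc, G.inv_symm hac]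
    ring

end Generic
end Generic

/-! ### The representation of R(n) on the functions from I^n to K. -/

section Representation

open MvPolynomial

theorem ev_eq_aeval {k A : Type*} [CommRing k] [CommRing A] [Algebra k A] {m : ℕ} (z : Fin m → A)
    (f : MvPolynomial (Fin m) k) : ev z f = aeval z f := by
  rw [ev, aeval_def, eval₂_eq']
  refine Finset.sum_congr rfl fun s _ => ?_
  rw [List.prod_ofFn]

theorem ev_mem {k A : Type*} [CommRing k] [Ring A] [Algebra k A] {m : ℕ} {z : Fin m → A}
    (S : Subalgebra k A) (hz : ∀ j, z j ∈ S) (f : MvPolynomial (Fin m) k) : ev z f ∈ S := by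
  refine sum_mem fun s _ => mul_mem (S.algebraMap_mem _) (list_prod_mem fun y hy => ?_)
  obtain ⟨j, rfl⟩ := (List.mem_ofFn' _ _).1 hy
  exact pow_mem (hz j) _

namespace Generic

variable {k I : Type u} [CommRing k] {C : BorcherdsCartan I} {𝓀 : ℤ → AddSubgroup k}
  {p : Params C 𝓀} {K : Type u} [CommRing K] [Algebra k K] (G : Generic p K) {n : ℕ}

/-- Multiplication by an element of `K` on `⨁_ν K`. -/
noncomputable def scal (n : ℕ) : K →ₐ[k] Module.End k ((Fin n → I) → K) :=
  Algebra.lsmul k k ((Fin n → I) → K)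

theorem scal_apply (y : K) (f : (Fin n → I) → K) (μ : Fin n → I) :
    scal (k := k) n y f μ = y * f μ := rfl

open Classical in
/-- The projection to the summand of `ν`. -/
noncomputable def eOp (ν : Fin n → I) : Module.End k ((Fin n → I) → K) where
  toFun f μ := if μ = ν then f μ else 0
  map_add' f g := by
    ext μ
    simp only [Pi.add_apply]
    split_ifs <;> simp
  map_smul' c f := by
    ext μ
    simp only [Pi.smul_apply, RingHom.id_apply]
    split_ifs <;> simp

/-- The action of `τ_l`. -/
noncomputable def tOp (l : ℕ) (h : l + 1 < n) : Module.End k ((Fin n → I) → K) where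
  toFun f μ := G.α (μ (lo l h)) (μ (hi l h)) l (l + 1) *
      G.perm (Equiv.swap l (l + 1)) (f (μ ∘ swp l h)) +
    G.β (μ (lo l h)) (μ (hi l h)) l (l + 1) * f μ
  map_add' f g := by
    ext μ
    simp only [Pi.add_apply, map_add]
    ring
  map_smul' c f := by
    ext μ
    simp only [Pi.smul_apply, RingHom.id_apply, map_smul, smul_add, mul_smul_comm]

open Classical in
theorem eOp_apply (ν : Fin n → I) (f : (Fin n → I) → K) (μ : Fin n → I) :
    (eOp ν : Module.End k _) f μ = if μ = ν then f μ else 0 := rfl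

theorem eOp_apply_self (ν : Fin n → I) (f : (Fin n → I) → K) :
    (eOp ν : Module.End k _) f ν = f ν := by rw [eOp_apply, if_pos rfl]

theorem eOp_apply_of_ne {μ ν : Fin n → I} (h : μ ≠ ν) (f : (Fin n → I) → K) :
    (eOp ν : Module.End k _) f μ = 0 := by rw [eOp_apply, if_neg h]

theorem tOp_apply (l : ℕ) (h : l + 1 < n) (f : (Fin n → I) → K) (μ : Fin n → I) :
    G.tOp l h f μ = G.α (μ (lo l h)) (μ (hi l h)) l (l + 1) *
      G.perm (Equiv.swap l (l + 1)) (f (μ ∘ swp l h)) +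
    G.β (μ (lo l h)) (μ (hi l h)) l (l + 1) * f μ := rfl

/-- The action of the generators. -/
noncomputable def repGen : Gen I n → Module.End k ((Fin n → I) → K)
  | Gen.e ν => eOp ν
  | Gen.x a => scal n (G.X a)
  | Gen.tau l h => G.tOp l h

theorem comp_swp_self {l : ℕ} {h : l + 1 < n} {μ : Fin n → I} (hμ : μ (lo l h) = μ (hi l h)) :
    μ ∘ swp l h = μ := by
  ext a
  by_cases h1 : a = lo l h
  · subst h1; rw [Function.comp_apply, Alg.swp_lo, hμ]
  · by_cases h2 : a = hi l h
    · subst h2; rw [Function.comp_apply, Alg.swp_hi, hμ]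
    · rw [Function.comp_apply, swp, Equiv.swap_apply_of_ne_of_ne h1 h2]

theorem comp_swp_swp (l : ℕ) (h : l + 1 < n) (μ : Fin n → I) : (μ ∘ swp l h) ∘ swp l h = μ := by
  ext a
  simp [swp]

theorem perm_swap_swap (a b : ℕ) (y : K) :
    G.perm (Equiv.swap a b) (G.perm (Equiv.swap a b) y) = y := by
  rw [← G.perm_mul, Equiv.swap_mul_self, G.perm_one]

theorem comp_swp_eq_iff {l : ℕ} {h : l + 1 < n} {μ ν : Fin n → I} :
    μ ∘ swp l h = ν ↔ μ = ν ∘ swp l h :=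
  ⟨fun e => by rw [← e, comp_swp_swp], fun e => by rw [e, comp_swp_swp]⟩

/-- Replace the three entries of `μ` from position `l` on. -/
def upd (μ : Fin n → I) (l : ℕ) (i j k : I) (a : Fin n) : I :=
  if a.1 = l then i else if a.1 = l + 1 then j else if a.1 = l + 2 then k else μ a

theorem upd_self (μ : Fin n → I) (l : ℕ) (h : l + 1 < n) (h' : l + 1 + 1 < n) :
    upd μ l (μ (lo l h)) (μ (hi l h)) (μ (hi (l + 1) h')) = μ := by
  ext a
  simp only [upd]
  split_ifs with h1 h2 h3
  · exact congrArg μ (Fin.ext h1.symm)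
  · exact congrArg μ (Fin.ext h2.symm)
  · exact congrArg μ (Fin.ext h3.symm)
  · rfl

theorem swp_val (l : ℕ) (h : l + 1 < n) (a : Fin n) :
    (swp l h a).1 = if a.1 = l then l + 1 else if a.1 = l + 1 then l else a.1 := by
  split_ifs with h1 h2
  · rw [show a = lo l h from Fin.ext h1, Alg.swp_lo]; rfl
  · rw [show a = hi l h from Fin.ext h2, Alg.swp_hi]; rfl
  · rw [Alg.swp_of_ne l h a h1 h2]

theorem upd_comp_swp (μ : Fin n → I) (l : ℕ) (h : l + 1 < n) (i j k : I) :
    upd μ l i j k ∘ swp l h = upd μ l j i k := by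
  ext a
  simp only [upd, Function.comp_apply, swp_val]
  split_ifs <;> first | rfl | omega | skip
  rw [Alg.swp_of_ne l h a (by assumption) (by assumption)]

theorem upd_comp_swp_succ (μ : Fin n → I) (l : ℕ) (h' : l + 1 + 1 < n) (i j k : I) :
    upd μ l i j k ∘ swp (l + 1) h' = upd μ l i k j := by
  ext a
  simp only [upd, Function.comp_apply, swp_val]
  split_ifs <;> first | rfl | omega | skip
  rw [Alg.swp_of_ne (l + 1) h' a (by assumption) (by assumption)]

/-- With all other colours frozen, τ_l and τ_{l+1} only involve three colours and three variables;
this reduces the braid relation to `T_braid`. -/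
theorem tOp_upd (l : ℕ) (h : l + 1 < n) (f : (Fin n → I) → K) (μ : Fin n → I) :
    (fun i j k => G.tOp l h f (upd μ l i j k)) =
      G.T₁ l (l + 1) fun i j k => f (upd μ l i j k) := by
  ext i j k
  rw [tOp_apply, upd_comp_swp, T₁]
  simp [upd, lo, hi]

theorem tOp_succ_upd (l : ℕ) (h' : l + 1 + 1 < n) (f : (Fin n → I) → K) (μ : Fin n → I) :
    (fun i j k => G.tOp (l + 1) h' f (upd μ l i j k)) =
      G.T₂ (l + 1) (l + 1 + 1) fun i j k => f (upd μ l i j k) := by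
  ext i j k
  rw [tOp_apply, upd_comp_swp_succ, T₂]
  have : ¬ l + 1 + 1 = l := by omega
  simp [upd, lo, hi, this]

theorem tOp_braid (l : ℕ) (h : l + 1 < n) (h' : l + 1 + 1 < n) (f : (Fin n → I) → K)
    (μ : Fin n → I) :
    (μ (lo l h) ≠ μ (hi (l + 1) h') →
      G.tOp (l + 1) h' (G.tOp l h (G.tOp (l + 1) h' f)) μ -
        G.tOp l h (G.tOp (l + 1) h' (G.tOp l h f)) μ = 0) ∧
    (μ (lo l h) = μ (hi (l + 1) h') → μ (lo l h) ≠ μ (hi l h) →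
      G.tOp (l + 1) h' (G.tOp l h (G.tOp (l + 1) h' f)) μ -
        G.tOp l h (G.tOp (l + 1) h' (G.tOp l h f)) μ =
      G.P (μ (lo l h)) l (l + 1 + 1) * aeval ![G.X l, G.X (l + 1), G.X (l + 1 + 1)]
        (p.Qbar (μ (lo l h)) (μ (hi l h))) * f μ) ∧
    (μ (lo l h) = μ (hi (l + 1) h') → μ (lo l h) = μ (hi l h) →
      G.tOp (l + 1) h' (G.tOp l h (G.tOp (l + 1) h' f)) μ -
        G.tOp l h (G.tOp (l + 1) h' (G.tOp l h f)) μ =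
      aeval ![G.X l, G.X (l + 1), G.X (l + 1 + 1)] (p.Pbar' (μ (lo l h))) * G.tOp l h f μ +
      aeval ![G.X l, G.X (l + 1), G.X (l + 1 + 1)] (p.Pbar'' (μ (lo l h))) *
        G.tOp (l + 1) h' f μ) := by
  have key := G.T_braid (a := l) (b := l + 1) (c := l + 1 + 1) (by omega) (by omega) (by omega)
    (fun i j k => f (upd μ l i j k)) (μ (lo l h)) (μ (hi l h)) (μ (hi (l + 1) h'))
  simp only [← G.tOp_upd l h _ μ, ← G.tOp_succ_upd l h' _ μ] at key
  simp only [upd_self μ l h h'] at key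
  exact ⟨fun h1 => sub_eq_zero.2 (key.1 h1), key.2⟩

theorem ev_scal {m : ℕ} (z : Fin m → K) (f : MvPolynomial (Fin m) k) :
    ev (fun j => scal n (z j)) f = (scal n (aeval z f) : Module.End k ((Fin n → I) → K)) := by
  rw [← ev_eq_aeval, ev_map]
  rfl

open Classical in
-- For equal colours β = -α, so τ = α (s - 1) with α = P(u,v)/(u - v), and τ² = -(α + s(α)) τ, where
-- the factor is the divided difference of P. For distinct colours β vanishes and only the product
-- of two α's is left.
theorem tOp_sq (l : ℕ) (h : l + 1 < n) (f : (Fin n → I) → K) (μ : Fin n → I) :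
    G.tOp l h (G.tOp l h f) μ = if μ (lo l h) = μ (hi l h) then
      aeval ![G.X l, G.X (l + 1)] (p.dP (μ (lo l h))) * G.tOp l h f μ else
      aeval ![G.X l, G.X (l + 1)] (p.Q (μ (lo l h)) (μ (hi l h))) * f μ := by
  have hl : l ≠ l + 1 := by omega
  split_ifs with hμ
  · simp only [tOp_apply, comp_swp_self hμ, ← hμ, α_self, β_self, map_add, map_mul, map_neg,
      perm_swap_swap, G.perm_P, G.perm_inv _ hl, Equiv.swap_apply_left, Equiv.swap_apply_right,
      G.aeval_dP _ hl, G.inv_symm hl]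
    ring
  · simp only [tOp_apply, comp_swp_swp, Function.comp_apply, Alg.swp_lo, Alg.swp_hi,
      G.β_of_ne hμ, G.β_of_ne (Ne.symm hμ), map_add, map_mul, map_zero, zero_mul, add_zero,
      perm_swap_swap, G.perm_α _ _ _ hl, Equiv.swap_apply_left, Equiv.swap_apply_right]
    rw [← mul_assoc, G.α_mul_α hμ]
    rfl

/-- The permuting part of τ intertwines x_a with its permuted version exactly, so the commutator
comes from β alone. For equal colours β (X_l - X_{l+1}) is -P, whence the signs in the relations. -/
theorem tOp_x (l : ℕ) (h : l + 1 < n) (f : (Fin n → I) → K) (μ : Fin n → I) (a : ℕ) :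
    G.tOp l h (scal (k := k) n (G.X a) f) μ - G.X (Equiv.swap l (l + 1) a) * G.tOp l h f μ =
      G.β (μ (lo l h)) (μ (hi l h)) l (l + 1) * (G.X a - G.X (Equiv.swap l (l + 1) a)) * f μ := by
  simp only [tOp_apply, scal_apply, map_mul, G.perm_X]
  ring

/-- The identity part of τ could violate this, but it is nonzero only where the two colours agree,
and such sequences are fixed by the transposition. -/
theorem tOp_eOp (l : ℕ) (h : l + 1 < n) (ν : Fin n → I) :
    G.tOp l h * eOp ν = eOp (ν ∘ swp l h) * G.tOp l h := by
  classical
  ext f μ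
  simp only [Module.End.mul_apply, eOp_apply, tOp_apply, comp_swp_eq_iff]
  by_cases h1 : μ = ν ∘ swp l h
  · subst h1
    simp only [if_true, comp_swp_swp]
    by_cases h2 : ν (lo l h) = ν (hi l h)
    · rw [comp_swp_self h2, if_pos rfl]
    · simp only [Function.comp_apply, Alg.swp_lo, Alg.swp_hi]
      rw [G.β_of_ne (Ne.symm h2), zero_mul, zero_mul]
  · simp only [if_neg h1, map_zero, mul_zero, zero_add]
    by_cases h2 : μ (lo l h) = μ (hi l h)
    · rw [if_neg, mul_zero]
      rintro rfl
      exact h1 (comp_swp_self h2).symm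
    · rw [G.β_of_ne h2, zero_mul]

theorem swap_swap_comm {a b c d : ℕ} (h1 : a ≠ c) (h2 : a ≠ d) (h3 : b ≠ c) (h4 : b ≠ d) :
    Equiv.swap a b * Equiv.swap c d = Equiv.swap c d * Equiv.swap a b := by
  refine Equiv.ext fun x => ?_
  simp only [Equiv.Perm.mul_apply, Equiv.swap_apply_def]
  split_ifs <;> omega

theorem swp_swp_comm (l m : ℕ) (hl : l + 1 < n) (hm : m + 1 < n) (h : l + 1 < m) (a : Fin n) :
    swp l hl (swp m hm a) = swp m hm (swp l hl a) := by
  apply Fin.ext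
  simp only [swp_val]
  split_ifs <;> omega

theorem tOp_comm (l m : ℕ) (hl : l + 1 < n) (hm : m + 1 < n) (h : l + 1 < m) :
    G.tOp l hl * G.tOp m hm = G.tOp m hm * G.tOp l hl := by
  ext f μ
  have e1 : (μ ∘ swp l hl) ∘ swp m hm = (μ ∘ swp m hm) ∘ swp l hl := by
    ext a
    exact congrArg μ (swp_swp_comm l m hl hm h a)
  have e2 : ∀ y, G.perm (Equiv.swap l (l + 1)) (G.perm (Equiv.swap m (m + 1)) y) =
      G.perm (Equiv.swap m (m + 1)) (G.perm (Equiv.swap l (l + 1)) y) := fun y => by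
    rw [← G.perm_mul, ← G.perm_mul, swap_swap_comm (by omega) (by omega) (by omega) (by omega)]
  have c1 : swp l hl (lo m hm) = lo m hm :=
    Alg.swp_of_ne _ _ _ (by simp only [lo]; omega) (by simp only [lo]; omega)
  have c2 : swp l hl (hi m hm) = hi m hm :=
    Alg.swp_of_ne _ _ _ (by simp only [hi]; omega) (by simp only [hi]; omega)
  have c3 : swp m hm (lo l hl) = lo l hl :=
    Alg.swp_of_ne _ _ _ (by simp only [lo]; omega) (by simp only [lo]; omega)
  have c4 : swp m hm (hi l hl) = hi l hl :=
    Alg.swp_of_ne _ _ _ (by simp only [hi]; omega) (by simp only [hi]; omega)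
  have d1 : Equiv.swap l (l + 1) m = m := Equiv.swap_apply_of_ne_of_ne (by omega) (by omega)
  have d2 : Equiv.swap l (l + 1) (m + 1) = m + 1 :=
    Equiv.swap_apply_of_ne_of_ne (by omega) (by omega)
  have d3 : Equiv.swap m (m + 1) l = l := Equiv.swap_apply_of_ne_of_ne (by omega) (by omega)
  have d4 : Equiv.swap m (m + 1) (l + 1) = l + 1 :=
    Equiv.swap_apply_of_ne_of_ne (by omega) (by omega)
  have hll : l ≠ l + 1 := by omega
  have hmm : m ≠ m + 1 := by omega
  simp only [Module.End.mul_apply, tOp_apply, Function.comp_apply, map_add, map_mul,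
    G.perm_α _ _ _ hll, G.perm_α _ _ _ hmm, G.perm_β _ _ _ hll, G.perm_β _ _ _ hmm,
    c1, c2, c3, c4, d1, d2, d3, d4, e1, e2]
  ring

variable [Fintype I]

theorem repGen_rel (a b : Fr k I n) (hab : KLRel p n a b) :
    FreeAlgebra.lift k G.repGen a = FreeAlgebra.lift k G.repGen b := by
  have hE : ∀ ν : Fin n → I, FreeAlgebra.lift k G.repGen (Fr.e ν) = eOp ν :=
    fun ν => FreeAlgebra.lift_ι_apply _ _
  have hX : ∀ a : Fin n, FreeAlgebra.lift k G.repGen (Fr.x a) = scal n (G.X a) :=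
    fun ν => FreeAlgebra.lift_ι_apply _ _
  have hT : ∀ l (h : l + 1 < n), FreeAlgebra.lift k G.repGen (Fr.t l h) = G.tOp l h :=
    fun ν _ => FreeAlgebra.lift_ι_apply _ _
  have hev : ∀ {m : ℕ} (z : Fin m → Fin n) (f : MvPolynomial (Fin m) k),
      FreeAlgebra.lift k G.repGen (ev (fun j => Fr.x (z j)) f) =
      scal n (aeval (fun j => G.X (z j)) f) := fun z f => by
    rw [ev_map, ← ev_scal]
    congr 1
    ext j : 1
    exact hX _
  have hev2 : ∀ (a b : Fin n) (f : MvPolynomial (Fin 2) k),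
      FreeAlgebra.lift k G.repGen (ev ![Fr.x a, Fr.x b] f) =
      scal n (aeval ![G.X a, G.X b] f) := fun a b f => by
    rw [← Alg.vec2 Fr.x, hev ![a, b], Alg.vec2 (fun a : Fin n => G.X a)]
  have hev3 : ∀ (a b c : Fin n) (f : MvPolynomial (Fin 3) k),
      FreeAlgebra.lift k G.repGen (ev ![Fr.x a, Fr.x b, Fr.x c] f) =
      scal n (aeval ![G.X a, G.X b, G.X c] f) := fun a b c f => by
    rw [← Alg.vec3 Fr.x, hev ![a, b, c], Alg.vec3 (fun a : Fin n => G.X a)]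
  cases hab with
  | e_mul_self ν =>
    ext f μ
    simp only [map_mul, hE, Module.End.mul_apply, eOp_apply]
    split_ifs <;> rfl
  | e_mul_ne ν ν' h =>
    ext f μ
    simp only [map_mul, hE, Module.End.mul_apply, eOp_apply, map_zero, LinearMap.zero_apply,
      Pi.zero_apply]
    split_ifs with h1 h2
    · exact absurd (h1.symm.trans h2) h
    · rfl
    · rfl
  | e_sum =>
    ext f μ
    simp only [map_sum, hE, map_one, LinearMap.sum_apply, Finset.sum_apply, eOp_apply]
    simp
  | x_comm a b =>
    simp only [map_mul, hX]
    rw [← map_mul, ← map_mul, mul_comm]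
  | x_e a ν =>
    ext f μ
    simp only [map_mul, hX, hE, Module.End.mul_apply, eOp_apply, scal_apply]
    split_ifs <;> simp
  | tau_e l h ν =>
    simp only [map_mul, hT, hE]
    exact G.tOp_eOp l h ν
  | tau_comm l m hl hm h =>
    simp only [map_mul, hT]
    exact G.tOp_comm l m hl hm h
  | tau_sq_eq l h ν hν =>
    ext f μ
    simp only [map_mul, hT, hE, hev2, Module.End.mul_apply, scal_apply, tOp_sq]
    by_cases hμ : μ = ν
    · subst hμ
      rw [if_pos hν]
      rfl
    · have h0 : G.tOp l h ((eOp ν : Module.End k _) f) μ = 0 := by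
        rw [← Module.End.mul_apply, tOp_eOp, comp_swp_self hν, Module.End.mul_apply,
          eOp_apply_of_ne hμ]
      rw [h0, eOp_apply_of_ne hμ]
      simp
  | tau_sq_ne l h ν hν =>
    ext f μ
    simp only [map_mul, hT, hE, hev2, Module.End.mul_apply, scal_apply]
    by_cases hμ : μ = ν
    · subst hμ
      rw [tOp_sq, if_neg hν]
      rfl
    · have : G.tOp l h (G.tOp l h ((eOp ν : Module.End k _) f)) =
          (eOp ν : Module.End k _) (G.tOp l h (G.tOp l h f)) := by
        simp only [← Module.End.mul_apply]
        rw [tOp_eOp, ← mul_assoc, tOp_eOp, comp_swp_swp, mul_assoc]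
      rw [this, eOp_apply_of_ne hμ, eOp_apply_of_ne hμ, mul_zero]
  | tau_x_lo l h ν hν =>
    ext f μ
    have hx := G.tOp_x l h ((eOp ν : Module.End k _) f) μ l
    rw [Equiv.swap_apply_left] at hx
    simp only [map_mul, map_sub, map_neg, hT, hE, hX, hev2, Module.End.mul_apply,
      LinearMap.sub_apply, LinearMap.neg_apply, Pi.sub_apply, Pi.neg_apply, scal_apply]
    refine hx.trans ?_
    by_cases hμ : μ = ν
    · subst hμ
      rw [hν, β_self]
      have := G.mul_inv (a := l) (b := l + 1) (by omega)
      change _ = -(G.P _ l (l + 1) * _)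
      linear_combination (-G.P (μ (hi l h)) l (l + 1) * (eOp μ : Module.End k _) f μ) * this
    · rw [eOp_apply_of_ne hμ]
      simp
  | tau_x_hi l h ν hν =>
    ext f μ
    have hx := G.tOp_x l h ((eOp ν : Module.End k _) f) μ (l + 1)
    rw [Equiv.swap_apply_right] at hx
    simp only [map_mul, map_sub, hT, hE, hX, hev2, Module.End.mul_apply,
      LinearMap.sub_apply, Pi.sub_apply, scal_apply]
    refine hx.trans ?_
    by_cases hμ : μ = ν
    · subst hμ
      rw [hν, β_self]
      have := G.mul_inv (a := l) (b := l + 1) (by omega)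
      change _ = G.P _ l (l + 1) * _
      linear_combination (G.P (μ (hi l h)) l (l + 1) * (eOp μ : Module.End k _) f μ) * this
    · rw [eOp_apply_of_ne hμ]
      simp
  | tau_x_other l h a ν hν =>
    ext f μ
    have hx := G.tOp_x l h ((eOp ν : Module.End k _) f) μ a
    have ha : (swp l h a).1 = Equiv.swap l (l + 1) a.1 := by
      rw [swp_val, Equiv.swap_apply_def]
    simp only [map_mul, map_sub, hT, hE, hX, Module.End.mul_apply, map_zero,
      LinearMap.sub_apply, Pi.sub_apply, scal_apply, LinearMap.zero_apply, Pi.zero_apply, ha]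
    refine hx.trans ?_
    by_cases hμ : μ = ν
    · subst hμ
      by_cases hh : μ (lo l h) = μ (hi l h)
      · obtain ⟨h1, h2⟩ := hν hh
        rw [Equiv.swap_apply_of_ne_of_ne (a := l) (b := l + 1) (fun e => h1 (Fin.ext e)) (fun e => h2 (Fin.ext e)),
          sub_self, mul_zero, zero_mul]
      · rw [G.β_of_ne hh, zero_mul, zero_mul]
    · rw [eOp_apply_of_ne hμ, mul_zero]
  | braid_Q l h h' ν hν hν' =>
    ext f μ
    obtain ⟨h1, h2, h3⟩ := G.tOp_braid l h h' ((eOp ν : Module.End k _) f) μ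
    simp only [map_mul, map_sub, hT, hE, hev2, hev3, Module.End.mul_apply,
      LinearMap.sub_apply, Pi.sub_apply, scal_apply]
    by_cases hμ : μ = ν
    · subst hμ
      rw [h2 hν hν', mul_assoc]
      rfl
    -- At μ ≠ ν the right side vanishes. The pattern of colours of μ is arbitrary, but in every
    -- pattern the difference of the triple products at μ is a combination of values at μ of
    -- functions supported at ν, the transpositions involved fixing μ.
    · rw [eOp_apply_of_ne hμ, mul_zero, mul_zero]
      by_cases c1 : μ (lo l h) = μ (hi (l + 1) h')
      · by_cases c2 : μ (lo l h) = μ (hi l h)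
        · have c3 : μ (lo (l + 1) h') = μ (hi (l + 1) h') := c2.symm.trans c1
          rw [h3 c1 c2, tOp_apply, tOp_apply, comp_swp_self c2, comp_swp_self c3,
            eOp_apply_of_ne hμ]
          simp
        · rw [h2 c1 c2, eOp_apply_of_ne hμ, mul_zero]
      · rw [h1 c1]
  | braid_P l h h' ν hν hν' =>
    ext f μ
    obtain ⟨h1, h2, h3⟩ := G.tOp_braid l h h' ((eOp ν : Module.End k _) f) μ
    simp only [map_mul, map_sub, map_add, hT, hE, hev3, Module.End.mul_apply,
      LinearMap.sub_apply, LinearMap.add_apply, Pi.sub_apply, Pi.add_apply, scal_apply]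
    by_cases hμ : μ = ν
    · subst hμ
      rw [h3 hν hν']
      rfl
    · have c3 : ν (lo (l + 1) h') = ν (hi (l + 1) h') := hν'.symm.trans hν
      have e1 : G.tOp l h ((eOp ν : Module.End k _) f) μ = 0 := by
        rw [← Module.End.mul_apply, tOp_eOp, comp_swp_self hν', Module.End.mul_apply,
          eOp_apply_of_ne hμ]
      have e2 : G.tOp (l + 1) h' ((eOp ν : Module.End k _) f) μ = 0 := by
        rw [← Module.End.mul_apply, tOp_eOp, comp_swp_self c3, Module.End.mul_apply,
          eOp_apply_of_ne hμ]
      rw [e1, e2, mul_zero, mul_zero, add_zero]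
      by_cases c1 : μ (lo l h) = μ (hi (l + 1) h')
      · by_cases c2 : μ (lo l h) = μ (hi l h)
        · rw [h3 c1 c2, e1, e2, mul_zero, mul_zero, add_zero]
        · rw [h2 c1 c2, eOp_apply_of_ne hμ, mul_zero]
      · rw [h1 c1]
  | braid_zero l h h' ν hν =>
    ext f μ
    obtain ⟨h1, h2, h3⟩ := G.tOp_braid l h h' ((eOp ν : Module.End k _) f) μ
    simp only [map_mul, map_sub, hT, hE, Module.End.mul_apply, map_zero,
      LinearMap.sub_apply, Pi.sub_apply, LinearMap.zero_apply, Pi.zero_apply]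
    by_cases c1 : μ (lo l h) = μ (hi (l + 1) h')
    · have hμ : μ ≠ ν := fun e => hν (e ▸ c1)
      by_cases c2 : μ (lo l h) = μ (hi l h)
      · have c3 : μ (lo (l + 1) h') = μ (hi (l + 1) h') := c2.symm.trans c1
        rw [h3 c1 c2, tOp_apply, tOp_apply, comp_swp_self c2, comp_swp_self c3,
          eOp_apply_of_ne hμ]
        simp
      · rw [h2 c1 c2, eOp_apply_of_ne hμ, mul_zero]
    · rw [h1 c1]

/-- The representation of `R(n)` on `⨁_ν K`. -/
noncomputable def rep (n : ℕ) : Alg p n →ₐ[k] Module.End k ((Fin n → I) → K) :=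
  Alg.lift (FreeAlgebra.lift k G.repGen) G.repGen_rel

theorem rep_e (ν : Fin n → I) : G.rep n (Alg.e p ν) = eOp ν := by
  rw [rep, Alg.e, Alg.lift_proj]
  exact FreeAlgebra.lift_ι_apply _ _

theorem rep_x (a : Fin n) : G.rep n (Alg.x p a) = scal n (G.X a) := by
  rw [rep, Alg.x, Alg.lift_proj]
  exact FreeAlgebra.lift_ι_apply _ _

theorem rep_t (l : ℕ) (h : l + 1 < n) : G.rep n (Alg.t p l h) = G.tOp l h := by
  rw [rep, Alg.t, Alg.lift_proj]
  exact FreeAlgebra.lift_ι_apply _ _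

end Generic
end Representation

/-! ### Existence of a generic point: the total ring of fractions of k[X_0, X_1, ...]. -/

section GenericPoint

open MvPolynomial

/-- A polynomial `f(u, v)` whose leading coefficient in `u` is a constant unit gives regular
elements `f(X_a, X_b)`. -/
theorem aeval_mem_nonZeroDivisors {k σ : Type*} [CommRing k] {f : MvPolynomial (Fin 2) k} {N : ℕ}
    (hf : ∀ s, f.coeff s ≠ 0 → s 0 ≤ N ∧ (s 0 = N → s 1 = 0))
    (hu : IsUnit (f.coeff (Finsupp.single 0 N))) {a b : σ} (hab : a ≠ b) :
    aeval ![X a, X b] f ∈ nonZeroDivisors (MvPolynomial σ k) := by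
  classical
  -- Polynomials are read as polynomials in the single variable X_a. Keeping X_a in the coefficient
  -- ring as well is harmless: evaluation at X_a is a left inverse of g, so g is injective.
  let g : MvPolynomial σ k →ₐ[k] Polynomial (MvPolynomial σ k) :=
    aeval fun c => if c = a then Polynomial.X else Polynomial.C (X c)
  have hg : ∀ q, Polynomial.eval (X a) (g q) = q := by
    intro q
    have : ((Polynomial.aeval (X a : MvPolynomial σ k)).restrictScalars k).comp g =
        AlgHom.id k _ := by
      ext c : 1
      by_cases hc : c = a
      · subst hc; simp [g]
      · simp [g, hc]
    exact DFunLike.congr_fun this q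
  have hg0 : ∀ q, g q = 0 → q = 0 := fun q h => by rw [← hg q, h, Polynomial.eval_zero]
  have key : g (aeval ![X a, X b] f) = ∑ s ∈ f.support, Polynomial.monomial (s 0)
      (C (f.coeff s) * X b ^ s 1) := by
    rw [← AlgHom.comp_apply, show g.comp (aeval ![X a, X b]) =
      aeval ![Polynomial.X, Polynomial.C (X b)] by
        ext j : 1
        fin_cases j
        · simp [g]
        · simp [g, hab.symm], aeval_def, eval₂_eq']
    refine Finset.sum_congr rfl fun s _ => ?_
    rw [Fin.prod_univ_two, ← Polynomial.C_mul_X_pow_eq_monomial, Polynomial.C_mul,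
      Polynomial.C_pow, IsScalarTower.algebraMap_apply k (MvPolynomial σ k)]
    simp only [Matrix.cons_val_zero, Matrix.cons_val_one, Polynomial.algebraMap_eq,
      MvPolynomial.algebraMap_eq]
    ring
  have hdeg : (g (aeval ![X a, X b] f)).natDegree ≤ N := by
    rw [key]
    refine Polynomial.natDegree_sum_le_of_forall_le _ _ fun s hs => ?_
    exact (Polynomial.natDegree_monomial_le _).trans (hf s (mem_support_iff.1 hs)).1
  have hcoeff : (g (aeval ![X a, X b] f)).coeff N = C (f.coeff (Finsupp.single 0 N)) := by
    rw [key, Polynomial.finsetSum_coeff, Finset.sum_eq_single (Finsupp.single 0 N)]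
    · simp
    · intro s hs hne
      rw [Polynomial.coeff_monomial, if_neg]
      intro h
      refine hne (Finsupp.ext fun j => ?_)
      fin_cases j
      · simpa using h
      · simpa using (hf s (mem_support_iff.1 hs)).2 h
    · intro h
      rw [notMem_support_iff.1 h]
      simp
  have hreg : ∀ q, g (aeval ![X a, X b] f) * g q = 0 → g q = 0 := by
    intro q h
    obtain ⟨c, hc⟩ := (hu.map (C (σ := σ))).exists_right_inv
    -- Multiplying by the inverse c of the leading coefficient gives a monic polynomial, which is
    -- regular over any commutative ring.
    have hm : (g (aeval ![X a, X b] f) * Polynomial.C c).Monic :=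
      Polynomial.monic_of_natDegree_le_of_coeff_eq_one N
        ((Polynomial.natDegree_mul_C_le _ _).trans hdeg)
        (by rw [Polynomial.coeff_mul_C, hcoeff, hc])
    refine hm.isRegular.left.mul_left_eq_zero_iff.1 ?_
    linear_combination Polynomial.C c * h
  rw [mem_nonZeroDivisors_iff_right]
  intro q hq
  refine hg0 q (hreg q ?_)
  rw [← map_mul, mul_comm, hq, map_zero]

variable {k I : Type u} [CommRing k] {C : BorcherdsCartan I} {𝓀 : ℤ → AddSubgroup k}

/-- The bound on the total degree p + q leaves the pure power of u as the only monomial of maximal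
degree in u, and its coefficient is a unit. -/
theorem P_mem_nonZeroDivisors (p : Params C 𝓀) (i : I) {a b : ℕ} (h : a ≠ b) :
    aeval ![X a, X b] (p.P i) ∈ nonZeroDivisors (MvPolynomial ℕ k) := by
  obtain ⟨c, -, hc⟩ := p.P_unit_left i
  refine aeval_mem_nonZeroDivisors (N := (1 - C.a i i / 2).toNat) (fun s hs => ?_)
    (IsUnit.of_mul_eq_one _ hc) h
  have h1 := p.P_support i s hs
  omega

/-- From d_i p + d_j q ≤ -d_i a_ij with positive d_i and d_j one gets p ≤ -a_ij, with equality only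
for q = 0; so the leading coefficient in u is the unit t^{-a_ij,0}. -/
theorem Q_mem_nonZeroDivisors (p : Params C 𝓀) {i j : I} (hij : i ≠ j) {a b : ℕ} (h : a ≠ b) :
    aeval ![X a, X b] (p.Q i j) ∈ nonZeroDivisors (MvPolynomial ℕ k) := by
  obtain ⟨c, -, hc⟩ := p.Q_unit i j hij
  refine aeval_mem_nonZeroDivisors (N := (-C.a i j).toNat) (fun s hs => ?_)
    (IsUnit.of_mul_eq_one _ hc) h
  have h1 := p.Q_support i j hij s hs
  have h2 := C.d_pos i
  have h3 := C.d_pos j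
  have h4 := C.a_off_diag i j hij
  rw [BorcherdsCartan.form] at h1
  have h5 : (0 : ℤ) ≤ s 1 := by positivity
  have h6 : ((-C.a i j).toNat : ℤ) = -C.a i j := Int.toNat_of_nonneg (by omega)
  have h7 : (s 0 : ℤ) ≤ -C.a i j := by
    by_contra h
    nlinarith [mul_nonneg h3.le h5]
  refine ⟨by omega, fun h => ?_⟩
  have h8 : (s 0 : ℤ) = -C.a i j := by omega
  rw [h8] at h1
  have : (s 1 : ℤ) ≤ 0 := by
    by_contra h
    nlinarith
  omega

/-- The total ring of fractions of the polynomial ring in infinitely many variables. -/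
abbrev Frac (k : Type u) [CommRing k] : Type u := FractionRing (MvPolynomial ℕ k)

theorem isUnit_frac {f : MvPolynomial ℕ k} (hf : f ∈ nonZeroDivisors (MvPolynomial ℕ k)) :
    IsUnit (algebraMap _ (Frac k) f) :=
  IsLocalization.map_units (M := nonZeroDivisors (MvPolynomial ℕ k)) (Frac k) ⟨f, hf⟩

/-- An automorphism preserves non-zero-divisors, so permutations of the variables extend to
fractions. -/
theorem isUnit_frac_rename (σ : Equiv.Perm ℕ) (y : nonZeroDivisors (MvPolynomial ℕ k)) :
    IsUnit (((IsScalarTower.toAlgHom k (MvPolynomial ℕ k) (Frac k)).comp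
      (renameEquiv k σ : MvPolynomial ℕ k →ₐ[k] MvPolynomial ℕ k)) y) := by
  have hy : renameEquiv k σ y ∈ (nonZeroDivisors (MvPolynomial ℕ k)).map (renameEquiv k σ) :=
    ⟨y, y.2, rfl⟩
  rw [MulEquivClass.map_nonZeroDivisors] at hy
  exact isUnit_frac hy

/-- The permutations of the variables act on the total ring of fractions. -/
noncomputable def fracPerm (σ : Equiv.Perm ℕ) : Frac k →ₐ[k] Frac k :=
  IsLocalization.liftAlgHom (M := nonZeroDivisors (MvPolynomial ℕ k)) (isUnit_frac_rename σ)

theorem fracPerm_algebraMap (σ : Equiv.Perm ℕ) (f : MvPolynomial ℕ k) :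
    fracPerm σ (algebraMap _ (Frac k) f) = algebraMap _ (Frac k) (rename σ f) :=
  IsLocalization.lift_eq (M := nonZeroDivisors (MvPolynomial ℕ k)) (isUnit_frac_rename σ) f

theorem fracHom_ext {g h : Frac k →ₐ[k] Frac k}
    (H : ∀ a, g (algebraMap _ (Frac k) (X a : MvPolynomial ℕ k)) =
      h (algebraMap _ (Frac k) (X a : MvPolynomial ℕ k))) : g = h := by
  refine IsLocalization.algHom_ext (nonZeroDivisors (MvPolynomial ℕ k)) ?_
  ext a
  exact H a

theorem aeval_frac (f : MvPolynomial (Fin 2) k) (a b : ℕ) :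
    aeval ![algebraMap _ (Frac k) (X a : MvPolynomial ℕ k), algebraMap _ (Frac k) (X b : MvPolynomial ℕ k)] f =
      algebraMap _ (Frac k) (aeval ![(X a : MvPolynomial ℕ k), X b] f) := by
  have : algebraMap (MvPolynomial ℕ k) (Frac k) (aeval ![(X a : MvPolynomial ℕ k), X b] f) =
    (IsScalarTower.toAlgHom k (MvPolynomial ℕ k) (Frac k)) (aeval ![(X a : MvPolynomial ℕ k), X b] f) := rfl
  rw [this, ← AlgHom.comp_apply]
  congr 1
  ext j : 1
  fin_cases j <;> simp

/-- The generic point given by the variables. -/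
noncomputable def generic (p : Params C 𝓀) : Generic p (Frac k) where
  X a := algebraMap _ (Frac k) (X a : MvPolynomial ℕ k)
  perm := fracPerm
  perm_X σ a := by rw [fracPerm_algebraMap, rename_X]
  perm_mul σ τ y := by
    rw [← AlgHom.comp_apply]
    congr 1
    refine fracHom_ext fun a => ?_
    rw [AlgHom.comp_apply, fracPerm_algebraMap, fracPerm_algebraMap, fracPerm_algebraMap]
    simp
  perm_one y := by
    rw [show fracPerm 1 = AlgHom.id k (Frac k) from fracHom_ext fun a => by
      rw [fracPerm_algebraMap]; simp]
    rfl
  isUnit_sub h := by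
    rw [← map_sub]
    exact isUnit_frac (isRegular_iff_mem_nonZeroDivisors.1 (isRegular_X_sub_X h))
  isUnit_P i a b h := by
    rw [aeval_frac]
    exact isUnit_frac (P_mem_nonZeroDivisors p i h)
  isUnit_Q hij a b h := by
    rw [aeval_frac]
    exact isUnit_frac (Q_mem_nonZeroDivisors p hij h)
  injective := by
    rw [IsScalarTower.algebraMap_eq k (MvPolynomial ℕ k) (Frac k)]
    exact (IsFractionRing.injective (MvPolynomial ℕ k) (Frac k)).comp (C_injective ℕ k)

end GenericPoint

/-! ### Independence of x_n from the action of R(n). -/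

section Slices

/-- A polynomial with infinitely many roots, whose differences are units, vanishes. -/
theorem polynomial_eq_zero_of_roots {K : Type*} [CommRing K] (q : Polynomial K) {x : ℕ → K}
    (hx : ∀ a b, a ≠ b → IsUnit (x a - x b)) (h : ∀ m, q.eval (x m) = 0) : q = 0 := by
  nontriviality K
  induction hd : q.natDegree using Nat.strong_induction_on generalizing q x with
  | _ d ih =>
    by_contra hq
    -- K need not be a domain, so roots are split off one at a time: the remaining points are still
    -- roots of the quotient because their differences from x_0 are units.
    obtain ⟨q', rfl⟩ := Polynomial.dvd_iff_isRoot.2 (h 0)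
    have hq' : q' ≠ 0 := fun h => hq (by rw [h, mul_zero])
    rw [(Polynomial.monic_X_sub_C _).natDegree_mul' hq', Polynomial.natDegree_X_sub_C] at hd
    refine hq' (ih q'.natDegree (by omega) q' (x := fun m => x (m + 1))
      (fun a b hab => hx _ _ (by omega)) (fun m => ?_) rfl)
    have := h (m + 1)
    rw [Polynomial.eval_mul] at this
    refine (hx (m + 1) 0 (by omega)).mul_right_eq_zero.1 ?_
    simpa using this

namespace Generic

variable {k I : Type u} [CommRing k] {C : BorcherdsCartan I} {𝓀 : ℤ → AddSubgroup k}
  {p : Params C 𝓀} {K : Type u} [CommRing K] [Algebra k K] (G : Generic p K) {n : ℕ} [Fintype I]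

open Alg

/-- `R(n)` acts on the summands with a given last entry. -/
theorem rep_emb (y : Alg p n) (F : (Fin (n + 1) → I) → K) (ν : Fin n → I) (i : I) :
    G.rep (n + 1) (emb p n y) F (snoc ν i) = G.rep n y (fun μ => F (snoc μ i)) ν := by
  induction y using Alg.induction generalizing F ν with
  | scalar c =>
    rw [AlgHom.commutes, AlgHom.commutes, AlgHom.commutes]
    rfl
  | he μ =>
    classical
    rw [emb_e, map_sum, rep_e]
    simp only [rep_e, LinearMap.sum_apply, Finset.sum_apply, eOp_apply]
    rw [Finset.sum_eq_single i]
    · congr 1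
      refine propext ⟨fun h => ?_, fun h => by rw [h]⟩
      ext a
      simpa using congrFun h a.castSucc
    · intro j _ hj
      rw [if_neg]
      intro h
      exact hj (by simpa using (congrFun h (Fin.last n)).symm)
    · simp
  | hx a =>
    rw [emb_x, rep_x, rep_x, scal_apply, scal_apply]
    rfl
  | ht l h =>
    rw [emb_t, rep_t, rep_t, tOp_apply, tOp_apply, snoc_lo ν i l h, snoc_hi ν i l h,
      snoc_swp ν i l h]
  | mul a b ha hb =>
    rw [map_mul, map_mul, map_mul, Module.End.mul_apply, Module.End.mul_apply, ha]
    exact congrArg (fun g => G.rep n a g ν) (funext fun μ => hb _ _)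
  | add a b ha hb =>
    rw [map_add, map_add, map_add, LinearMap.add_apply, LinearMap.add_apply, Pi.add_apply,
      Pi.add_apply, ha, hb]

/-- Permutations of the variables beyond the first `n` commute with the action of `R(n)`. -/
theorem rep_perm (σ : Equiv.Perm ℕ) (hσ : ∀ a < n, σ a = a) (y : Alg p n)
    (f : (Fin n → I) → K) (ν : Fin n → I) :
    G.perm σ (G.rep n y f ν) = G.rep n y (fun μ => G.perm σ (f μ)) ν := by
  induction y using Alg.induction generalizing f ν with
  | scalar c =>
    rw [AlgHom.commutes]
    exact map_smul (G.perm σ) c (f ν)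
  | he μ =>
    classical
    rw [rep_e, eOp_apply, eOp_apply]
    split_ifs <;> simp
  | hx a => rw [rep_x, scal_apply, scal_apply, map_mul, G.perm_X, hσ a a.2]
  | ht l h =>
    have hl := hσ l (by omega)
    have hl' := hσ (l + 1) h
    have hc : σ * Equiv.swap l (l + 1) = Equiv.swap l (l + 1) * σ := by
      rw [Equiv.mul_swap_eq_swap_mul, hl, hl']
    rw [rep_t, tOp_apply, tOp_apply, map_add, map_mul, map_mul, G.perm_α _ _ _ (by omega),
      G.perm_β _ _ _ (by omega), ← G.perm_mul, hc, G.perm_mul, hl, hl']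
  | mul a b ha hb =>
    rw [map_mul, Module.End.mul_apply, Module.End.mul_apply, ha]
    exact congrArg (fun g => G.rep n a g ν) (funext fun μ => hb _ _)
  | add a b ha hb =>
    rw [map_add, LinearMap.add_apply, LinearMap.add_apply, Pi.add_apply, Pi.add_apply, map_add,
      ha, hb]

/-- `x_n` is algebraically independent of the action of `R(n)`. -/
theorem rep_eq_zero_of_sum {s : Finset ℕ} {y : ℕ → Alg p n}
    (h : ∀ f ν, ∑ r ∈ s, G.X n ^ r * G.rep n (y r) f ν = 0) : ∀ r ∈ s, G.rep n (y r) = 0 := by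
  -- Conjugation by the transposition of n and n + m turns X_n into X_{n+m} and leaves the action of
  -- R(n), which only involves the first n variables, unchanged.
  have key : ∀ m, ∀ f ν, ∑ r ∈ s, G.X (n + m) ^ r * G.rep n (y r) f ν = 0 := by
    intro m f ν
    let σ := Equiv.swap n (n + m)
    have hσ : ∀ a < n, σ a = a := fun a ha =>
      Equiv.swap_apply_of_ne_of_ne (by omega) (by omega)
    have := congrArg (G.perm σ) (h (fun μ => G.perm σ (f μ)) ν)
    rw [map_sum, map_zero] at this
    rw [← this]
    refine Finset.sum_congr rfl fun r _ => ?_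
    rw [map_mul, map_pow, G.perm_X, G.rep_perm σ hσ]
    simp only [σ, perm_swap_swap, Equiv.swap_apply_left]
  intro r hr
  ext f ν
  simp only [LinearMap.zero_apply, Pi.zero_apply]
  -- By `key` this polynomial vanishes at X_n, X_{n+1}, ...; this is why K has infinitely many
  -- variables.
  let q : Polynomial K := ∑ r ∈ s, Polynomial.monomial r (G.rep n (y r) f ν)
  have hq : q = 0 := by
    refine polynomial_eq_zero_of_roots q (x := fun m => G.X (n + m))
      (fun a b hab => G.isUnit_sub (by omega)) fun m => ?_
    rw [← key m f ν, Polynomial.eval_finsetSum]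
    refine Finset.sum_congr rfl fun r _ => ?_
    rw [Polynomial.eval_monomial, mul_comm]
  have := congrArg (fun q => q.coeff r) hq
  simpa [q, Polynomial.finsetSum_coeff, Polynomial.coeff_monomial, hr] using this

end Generic
end Slices

/-! ### Spanning: R(m+2) = R(m+1) τ R(m+1) + R(m+1,1), and generators of R(n+1) over R(n). -/

section Spanning

variable {k I : Type u} [CommRing k] [Fintype I] {C : BorcherdsCartan I} {𝓀 : ℤ → AddSubgroup k}

namespace Alg

variable (p : Params C 𝓀) {n m : ℕ}

theorem t_x_of_ne (l : ℕ) (h : l + 1 < n) (a : Fin n) (h1 : a.1 ≠ l) (h2 : a.1 ≠ l + 1) :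
    t p l h * x p a = x p a * t p l h := by
  refine ext_e fun ν => ?_
  have := tau_x_other p l h a ν fun _ => ⟨fun e => h1 (congrArg Fin.val e),
    fun e => h2 (congrArg Fin.val e)⟩
  rw [swp_of_ne l h a h1 h2, sub_mul, sub_eq_zero] at this
  exact this

theorem eSum_mul_t (φ : (Fin n → I) → Prop) (l : ℕ) (h : l + 1 < n) :
    eSum p φ * t p l h = t p l h * eSum p fun ν => φ (ν ∘ swp l h) := by
  classical
  refine ext_e fun ν => ?_
  rw [mul_assoc, tau_e, ← mul_assoc, eSum_mul_e, mul_assoc, eSum_mul_e]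
  split_ifs
  · exact (tau_e p l h ν).symm
  · simp

variable (n) in
/-- The last polynomial generator. -/
noncomputable def xl : Alg p (n + 1) := x p (Fin.last n)

variable (m) in
/-- The last generator `τ`. -/
noncomputable def tl : Alg p (m + 2) := t p m (Nat.lt_succ_self (m + 1))

theorem xl_emb (y : Alg p n) : xl p n * emb p n y = emb p n y * xl p n := by
  induction y using Alg.induction p with
  | scalar c => rw [AlgHom.commutes]; exact (Algebra.commutes _ _).symm
  | he ν =>
    rw [emb_e, Finset.mul_sum, Finset.sum_mul]
    exact Finset.sum_congr rfl fun i _ => x_e p _ _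
  | hx a => rw [emb_x]; exact x_comm p _ _
  | ht l h =>
    rw [emb_t]
    exact (t_x_of_ne p l _ _ (by simp; omega) (by simp; omega)).symm
  | mul a b ha hb => rw [map_mul, ← mul_assoc, ha, mul_assoc, hb, mul_assoc]
  | add a b ha hb => rw [map_add, mul_add, add_mul, ha, hb]

theorem xl_pow_emb (r : ℕ) (y : Alg p n) : xl p n ^ r * emb p n y = emb p n y * xl p n ^ r :=
  (Commute.pow_left (xl_emb p y) r).eq

theorem eLast_xl (i : I) : eLast p n i * xl p n = xl p n * eLast p n i := eSum_x p _ _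

theorem eLast_xl_pow (i : I) (r : ℕ) : eLast p n i * xl p n ^ r = xl p n ^ r * eLast p n i :=
  (Commute.pow_right (eLast_xl p i) r).eq

/-- R(m) lives on positions before m, while τ involves m and m + 1. This is what makes x ⊗ y ↦ x τ y
well defined over R(m). -/
theorem tl_emb_emb (y : Alg p m) : tl p m * emb p _ (emb p m y) = emb p _ (emb p m y) * tl p m := by
  induction y using Alg.induction p with
  | scalar c => rw [AlgHom.commutes, AlgHom.commutes]; exact (Algebra.commutes _ _).symm
  | he ν =>
    rw [e_eq_eSum, emb_eSum, emb_eSum]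
    refine (eSum_t p _ _ _ fun μ => ?_).symm
    rw [iff_iff_eq]
    congr 1
    ext a
    refine congrArg μ (swp_of_ne _ _ _ ?_ ?_) <;> simp <;> omega
  | hx a =>
    rw [emb_x, emb_x]
    exact t_x_of_ne p _ _ _ (by simp; omega) (by simp; omega)
  | ht l h =>
    rw [emb_t, emb_t]
    exact (tau_comm p l m _ _ h).symm
  | mul a b ha hb => rw [map_mul, map_mul, ← mul_assoc, ha, mul_assoc, hb, mul_assoc]
  | add a b ha hb => rw [map_add, map_add, mul_add, add_mul, ha, hb]

/-- The crossing exchanges the last two colours: a condition on the last colour to the left of τ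
becomes one on the previous colour to its right. This is how E_i passes through F_j. -/
theorem eLast_tl (i : I) : eLast p (m + 1) i * tl p m = tl p m * emb p _ (eLast p m i) := by
  rw [eLast, tl, eSum_mul_t, eLast, emb_eSum]
  congr 2
  ext ν
  rw [Function.comp_apply, show Fin.last (m + 1) = hi m (Nat.lt_succ_self (m + 1)) from rfl,
    swp_hi]
  rfl

theorem tl_eLast (i : I) : tl p m * eLast p (m + 1) i = emb p _ (eLast p m i) * tl p m := by
  rw [eLast, eLast, emb_eSum, tl, eSum_mul_t]
  congr 2
  ext ν
  rw [Function.comp_apply, Function.comp_apply,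
    show Fin.castSucc (Fin.last m) = lo m (Nat.lt_succ_self (m + 1)) from rfl, swp_lo]
  rfl

theorem sum_eLast : ∑ i, eLast p n i = 1 := by
  classical
  refine ext_e fun ν => ?_
  rw [Finset.sum_mul, Finset.sum_eq_single (ν (Fin.last n))]
  · rw [eLast, eSum_mul_e, if_pos rfl, one_mul]
  · intro i _ hi
    rw [eLast, eSum_mul_e, if_neg (Ne.symm hi)]
  · simp

theorem eLast_mul_ne {i j : I} (h : i ≠ j) : eLast p n i * eLast p n j = 0 := by
  classical
  refine ext_e fun ν => ?_
  rw [eLast, eLast, eSum_mul_eSum, eSum_mul_e, if_neg, zero_mul]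
  rintro ⟨rfl, h'⟩
  exact h h'

theorem e_snoc (ν : Fin n → I) (i : I) : e p (snoc ν i) = emb p n (e p ν) * eLast p n i := by
  classical
  rw [emb_e, Finset.sum_mul, Finset.sum_eq_single i]
  · rw [← eLast_comm_e, eLast, eSum_mul_e, if_pos (snoc_last ν i)]
  · intro j _ hj
    rw [← eLast_comm_e, eLast, eSum_mul_e, if_neg (by rwa [snoc_last])]
  · simp
where
  eLast_comm_e {ν : Fin (n + 1) → I} {i : I} : eLast p n i * e p ν = e p ν * eLast p n i := by
    rw [e_eq_eSum, eLast, eSum_comm_eSum]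

theorem exists_snoc (ν : Fin (n + 1) → I) : ∃ ν' i, ν = snoc ν' i := by
  refine ⟨ν ∘ Fin.castSucc, ν (Fin.last n), ?_⟩
  ext a
  refine Fin.lastCases ?_ (fun a => ?_) a <;> simp

/-! #### The subalgebra `R(n, 1)` -/

theorem emb_mem_parabolic (y : Alg p n) : emb p n y ∈ parabolic p n :=
  Algebra.subset_adjoin (Or.inl (Or.inl ⟨y, rfl⟩))

theorem xl_mem_parabolic : xl p n ∈ parabolic p n :=
  Algebra.subset_adjoin (Or.inl (Or.inr rfl))

theorem eLast_mem_parabolic (i : I) : eLast p n i ∈ parabolic p n :=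
  Algebra.subset_adjoin (Or.inr ⟨i, rfl⟩)

theorem x_mem_parabolic (a : Fin (n + 1)) : x p a ∈ parabolic p n := by
  refine Fin.lastCases (xl_mem_parabolic p) (fun a => ?_) a
  rw [← emb_x]
  exact emb_mem_parabolic p _

theorem e_mem_parabolic (ν : Fin (n + 1) → I) : e p ν ∈ parabolic p n := by
  obtain ⟨ν', i, rfl⟩ := exists_snoc ν
  rw [e_snoc]
  exact mul_mem (emb_mem_parabolic p _) (eLast_mem_parabolic p i)

/-- R(n), x_n and the e(n,i) commute with one another, so products can be sorted; formally, the span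
of the sorted products contains 1 and is stable under left multiplication by the generators. -/
theorem parabolic_le_closure {z : Alg p (n + 1)} (hz : z ∈ parabolic p n) :
    z ∈ AddSubgroup.closure {z | ∃ r i y, z = xl p n ^ r * eLast p n i * emb p n y} := by
  set Y := AddSubgroup.closure {z | ∃ r i y, z = xl p n ^ r * eLast p n i * emb p n y}
  have hstab : ∀ a : Alg p (n + 1), (∀ r i y, a * (xl p n ^ r * eLast p n i * emb p n y) ∈ Y) →
      ∀ b ∈ Y, a * b ∈ Y := by
    intro a ha b hb
    induction hb using AddSubgroup.closure_induction with
    | zero => simp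
    | add x y _ _ hx hy => rw [mul_add]; exact add_mem hx hy
    | neg x _ hx => rw [mul_neg]; exact neg_mem hx
    | mem b hb =>
      obtain ⟨r, i, y, rfl⟩ := hb
      exact ha r i y
  have hemb : ∀ u : Alg p n, ∀ b ∈ Y, emb p n u * b ∈ Y := fun u => hstab _ fun r i y =>
    AddSubgroup.subset_closure ⟨r, i, u * y, by
      rw [map_mul, ← mul_assoc, ← mul_assoc, ← xl_pow_emb, mul_assoc (xl p n ^ r),
        ← eLast_comm]
      simp only [mul_assoc]⟩
  have key : ∀ b ∈ Y, z * b ∈ Y := by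
    induction hz using Algebra.adjoin_induction with
    | algebraMap c =>
      rw [← AlgHom.commutes (emb p n)]
      exact hemb _
    | add a b _ _ ha hb =>
      intro c hc
      rw [add_mul]
      exact add_mem (ha c hc) (hb c hc)
    | mul a b _ _ ha hb =>
      intro c hc
      rw [mul_assoc]
      exact ha _ (hb c hc)
    | mem a ha =>
      rcases ha with (⟨u, rfl⟩ | rfl) | ⟨j, rfl⟩
      · exact hemb u
      · refine hstab _ fun r i y => AddSubgroup.subset_closure ⟨r + 1, i, y, ?_⟩
        rw [pow_succ']
        simp only [mul_assoc, xl]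
      · refine hstab _ fun r i y => ?_
        rw [← mul_assoc, ← mul_assoc, eLast_xl_pow, mul_assoc (xl p n ^ r)]
        by_cases h : j = i
        · subst h
          rw [(eLast_idem p j).eq]
          exact AddSubgroup.subset_closure ⟨r, j, y, rfl⟩
        · rw [eLast_mul_ne p h]
          simp
  have h1 : (1 : Alg p (n + 1)) ∈ Y := by
    rw [← sum_eLast p]
    exact sum_mem fun i _ => AddSubgroup.subset_closure ⟨0, i, 1, by simp⟩
  simpa using key 1 h1

theorem ext_mem {z : Alg p n} {S : AddSubgroup (Alg p n)} (h : ∀ ν, z * e p ν ∈ S) : z ∈ S := by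
  rw [← mul_one z, ← e_sum, Finset.mul_sum]
  exact sum_mem fun ν _ => h ν

theorem ev_x_mem {r : ℕ} (a : Fin r → Fin n) (f : MvPolynomial (Fin r) k) (S : Subalgebra k (Alg p n))
    (h : ∀ a, x p a ∈ S) : ev (fun j => x p (a j)) f ∈ S :=
  ev_mem S (fun _ => h _) f

/-- The commutator of `τ` and `x`. -/
theorem tl_xl_sub_mem : tl p m * xl p (m + 1) - emb p _ (xl p m) * tl p m ∈ parabolic p (m + 1) := by
  refine ext_mem p (S := (parabolic p (m + 1)).toSubmodule.toAddSubgroup) fun ν => ?_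
  rw [show emb p _ (xl p m) = x p (lo m (Nat.lt_succ_self (m + 1))) from emb_x p _]
  by_cases h : ν (lo m (Nat.lt_succ_self (m + 1))) = ν (hi m (Nat.lt_succ_self (m + 1)))
  · have := tau_x_hi p m (Nat.lt_succ_self (m + 1)) ν h
    refine (congrArg (· ∈ (parabolic p (m + 1)).toSubmodule.toAddSubgroup) this).mpr ?_
    refine mul_mem (s := parabolic p (m + 1)) ?_ (e_mem_parabolic p ν)
    rw [← vec2 (x p)]
    exact ev_x_mem p _ _ _ (x_mem_parabolic p)
  · have := tau_x_other p m (Nat.lt_succ_self (m + 1)) (hi m (Nat.lt_succ_self (m + 1))) ν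
      fun h' => absurd h' h
    rw [swp_hi] at this
    refine (congrArg (· ∈ (parabolic p (m + 1)).toSubmodule.toAddSubgroup) this).mpr ?_
    exact zero_mem _

theorem tl_xl_sub_mem' : tl p m * emb p _ (xl p m) - xl p (m + 1) * tl p m ∈ parabolic p (m + 1) := by
  refine ext_mem p (S := (parabolic p (m + 1)).toSubmodule.toAddSubgroup) fun ν => ?_
  rw [show emb p _ (xl p m) = x p (lo m (Nat.lt_succ_self (m + 1))) from emb_x p _]
  by_cases h : ν (lo m (Nat.lt_succ_self (m + 1))) = ν (hi m (Nat.lt_succ_self (m + 1)))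
  · have := tau_x_lo p m (Nat.lt_succ_self (m + 1)) ν h
    refine (congrArg (· ∈ (parabolic p (m + 1)).toSubmodule.toAddSubgroup) this).mpr ?_
    refine neg_mem (mul_mem (s := parabolic p (m + 1)) ?_ (e_mem_parabolic p ν))
    rw [← vec2 (x p)]
    exact ev_x_mem p _ _ _ (x_mem_parabolic p)
  · have := tau_x_other p m (Nat.lt_succ_self (m + 1)) (lo m (Nat.lt_succ_self (m + 1))) ν
      fun h' => absurd h' h
    rw [swp_lo] at this
    refine (congrArg (· ∈ (parabolic p (m + 1)).toSubmodule.toAddSubgroup) this).mpr ?_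
    exact zero_mem _

/-- Induction by the Leibniz rule. Moving a power of x through τ costs only terms without τ. -/
theorem tl_xl_pow_sub_mem (r : ℕ) :
    tl p m * xl p (m + 1) ^ r - emb p _ (xl p m ^ r) * tl p m ∈ parabolic p (m + 1) := by
  induction r with
  | zero => simp
  | succ r ih =>
    have h1 := mul_mem ih (xl_mem_parabolic p)
    have h2 := mul_mem (emb_mem_parabolic p (xl p m ^ r)) (tl_xl_sub_mem p (m := m))
    have := add_mem h1 h2
    convert this using 1
    rw [pow_succ, pow_succ, map_mul]
    noncomm_ring

/-! #### The sum of `R(m + 1) τ R(m + 1)` and `R(m + 1, 1)` -/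

variable (m) in
/-- The sum of `R(m + 1) τ R(m + 1)` and `R(m + 1, 1)`. -/
noncomputable def mackey : AddSubgroup (Alg p (m + 2)) :=
  AddSubgroup.closure {z | ∃ x y, z = emb p _ x * tl p m * emb p _ y} ⊔
    (parabolic p (m + 1)).toSubmodule.toAddSubgroup

theorem parabolic_le_mackey {z : Alg p (m + 2)} (hz : z ∈ parabolic p (m + 1)) :
    z ∈ mackey p m :=
  AddSubgroup.mem_sup_right hz

theorem tl_mem_mackey (x y : Alg p (m + 1)) : emb p _ x * tl p m * emb p _ y ∈ mackey p m :=
  AddSubgroup.mem_sup_left (AddSubgroup.subset_closure ⟨x, y, rfl⟩)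

theorem mackey_induction {motive : (z : Alg p (m + 2)) → z ∈ mackey p m → Prop}
    (zero : motive 0 (zero_mem _))
    (add : ∀ a b ha hb, motive a ha → motive b hb → motive (a + b) (add_mem ha hb))
    (neg : ∀ a ha, motive a ha → motive (-a) (neg_mem ha))
    (cross : ∀ x y, motive (emb p _ x * tl p m * emb p _ y) (tl_mem_mackey p x y))
    (par : ∀ z (hz : z ∈ parabolic p (m + 1)), motive z (parabolic_le_mackey p hz))
    {z : Alg p (m + 2)} (hz : z ∈ mackey p m) : motive z hz := by
  obtain ⟨a, ha, b, hb, rfl⟩ := AddSubgroup.mem_sup.1 hz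
  refine add _ _ (AddSubgroup.mem_sup_left ha) _ ?_ (par b hb)
  clear hz
  induction ha using AddSubgroup.closure_induction with
  | zero => exact zero
  | add x y _ _ hx hy => exact add _ _ _ _ hx hy
  | neg x _ hx => exact neg _ _ hx
  | mem a ha =>
    obtain ⟨x, y, rfl⟩ := ha
    exact cross x y

variable (m) in
/-- The elements `a` with `a J ⊆ J` for `J = R(m + 1) τ R(m + 1) + R(m + 1, 1)`. -/
noncomputable def mackeyStab : Subalgebra k (Alg p (m + 2)) where
  carrier := {a | ∀ b ∈ mackey p m, a * b ∈ mackey p m}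
  mul_mem' ha hb c hc := by rw [mul_assoc]; exact ha _ (hb c hc)
  add_mem' ha hb c hc := by rw [add_mul]; exact add_mem (ha c hc) (hb c hc)
  algebraMap_mem' c b hb := by
    induction hb using mackey_induction with
    | zero => simp
    | add x y _ _ hx hy => rw [mul_add]; exact add_mem hx hy
    | neg x _ hx => rw [mul_neg]; exact neg_mem hx
    | cross x y =>
      rw [← AlgHom.commutes (emb p (m + 1)), ← mul_assoc, ← mul_assoc, ← map_mul]
      exact tl_mem_mackey p _ _
    | par z hz => exact parabolic_le_mackey p (mul_mem (algebraMap_mem _ c) hz)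

theorem mem_mackeyStab {a : Alg p (m + 2)}
    (h1 : ∀ x y, a * (emb p _ x * tl p m * emb p _ y) ∈ mackey p m)
    (h2 : ∀ z ∈ parabolic p (m + 1), a * z ∈ mackey p m) : a ∈ mackeyStab p m := by
  intro b hb
  induction hb using mackey_induction with
  | zero => simp
  | add x y _ _ hx hy => rw [mul_add]; exact add_mem hx hy
  | neg x _ hx => rw [mul_neg]; exact neg_mem hx
  | cross x y => exact h1 x y
  | par z hz => exact h2 z hz

/-- Left multiplication by R(m+1) is absorbed in the left factor, while x_{m+1} and e(m+1,i) commute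
with that factor and are moved through τ into the right factor, up to a term of R(m+1,1). -/
theorem parabolic_le_mackeyStab : parabolic p (m + 1) ≤ mackeyStab p m := by
  refine Algebra.adjoin_le ?_
  rintro a ((⟨u, rfl⟩ | rfl) | ⟨i, rfl⟩)
  · refine mem_mackeyStab p (fun x y => ?_)
      fun z hz => parabolic_le_mackey p (mul_mem (emb_mem_parabolic p u) hz)
    rw [← mul_assoc, ← mul_assoc, ← map_mul]
    exact tl_mem_mackey p _ _
  · refine mem_mackeyStab p (fun x y => ?_)
      fun z hz => parabolic_le_mackey p (mul_mem (xl_mem_parabolic p) hz)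
    change xl p (m + 1) * _ ∈ _
    rw [show xl p (m + 1) * (emb p _ x * tl p m * emb p _ y) =
      emb p _ x * tl p m * emb p _ (xl p m * y) - emb p _ x *
        (tl p m * emb p _ (xl p m) - xl p (m + 1) * tl p m) * emb p _ y by
      rw [← mul_assoc, ← mul_assoc, xl_emb, map_mul]
      noncomm_ring]
    exact sub_mem (tl_mem_mackey p _ _) (parabolic_le_mackey p (mul_mem (mul_mem
      (emb_mem_parabolic p _) (tl_xl_sub_mem' p)) (emb_mem_parabolic p _)))
  · refine mem_mackeyStab p (fun x y => ?_)
      fun z hz => parabolic_le_mackey p (mul_mem (eLast_mem_parabolic p i) hz)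
    rw [← mul_assoc, ← mul_assoc, eLast_comm, mul_assoc (emb p _ x), eLast_tl, mul_assoc,
      mul_assoc, ← map_mul, ← mul_assoc]
    exact tl_mem_mackey p _ _

/-- In sorted form, the powers of x_{m+1} and the idempotents can be moved to the left of τ, where
they lie in R(m+1). -/
theorem tl_mul_parabolic {z : Alg p (m + 2)} (hz : z ∈ parabolic p (m + 1)) :
    tl p m * z ∈ mackey p m := by
  have hz' := parabolic_le_closure p hz
  clear hz
  induction hz' using AddSubgroup.closure_induction with
  | zero => simp
  | add x y _ _ hx hy => rw [mul_add]; exact add_mem hx hy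
  | neg x _ hx => rw [mul_neg]; exact neg_mem hx
  | mem z hz =>
    obtain ⟨r, i, y, rfl⟩ := hz
    rw [show tl p m * (xl p (m + 1) ^ r * eLast p (m + 1) i * emb p _ y) =
      emb p _ (xl p m ^ r) * (tl p m * eLast p (m + 1) i) * emb p _ y +
      (tl p m * xl p (m + 1) ^ r - emb p _ (xl p m ^ r) * tl p m) * eLast p (m + 1) i *
        emb p _ y by noncomm_ring, tl_eLast, ← mul_assoc, ← map_mul]
    exact add_mem (tl_mem_mackey p _ _) (parabolic_le_mackey p (mul_mem (mul_mem
      (tl_xl_pow_sub_mem p r) (eLast_mem_parabolic p i)) (emb_mem_parabolic p y)))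

theorem mackey_mul_parabolic {b : Alg p (m + 2)} (hb : b ∈ mackey p m) {z : Alg p (m + 2)}
    (hz : z ∈ parabolic p (m + 1)) : b * z ∈ mackey p m := by
  induction hb using mackey_induction with
  | zero => simp
  | add x y _ _ hx hy => rw [add_mul]; exact add_mem hx hy
  | neg x _ hx => rw [neg_mul]; exact neg_mem hx
  | par b hb => exact parabolic_le_mackey p (mul_mem hb hz)
  | cross x y =>
    rw [mul_assoc, mul_assoc]
    exact parabolic_le_mackeyStab p (emb_mem_parabolic p x) _
      (tl_mul_parabolic p (mul_mem (emb_mem_parabolic p y) hz))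

theorem ev_x_mul_mem_mackey {r : ℕ} (a : Fin r → Fin (m + 2)) (f : MvPolynomial (Fin r) k)
    {b : Alg p (m + 2)} (hb : b ∈ mackey p m) : ev (fun j => x p (a j)) f * b ∈ mackey p m :=
  ev_x_mem p a f (mackeyStab p m) (fun a => parabolic_le_mackeyStab p (x_mem_parabolic p a)) b hb

theorem tl_mem : tl p m ∈ mackey p m := by
  simpa using tl_mem_mackey p (m := m) 1 1

theorem tl_mul_tl_mem : tl p m * tl p m ∈ mackey p m := by
  refine ext_mem p fun ν => ?_
  by_cases h : ν (lo m (Nat.lt_succ_self (m + 1))) = ν (hi m (Nat.lt_succ_self (m + 1)))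
  · rw [tl, tau_sq_eq p _ _ ν h, ← vec2 (x p), mul_assoc]
    exact ev_x_mul_mem_mackey p _ _ (mackey_mul_parabolic p (tl_mem p) (e_mem_parabolic p ν))
  · rw [tl, tau_sq_ne p _ _ ν h, ← vec2 (x p)]
    exact ev_x_mul_mem_mackey p _ _ (parabolic_le_mackey p (e_mem_parabolic p ν))

/-- The braid relation replaces this word by the one with a single last crossing, which has the form
x τ y. The error terms are polynomials times idempotents, or times one of the two crossings, and all
of these lie in the sum. -/
theorem braid_mem :
    tl p (m + 1) * emb p _ (tl p m) * tl p (m + 1) ∈ mackey p (m + 1) := by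
  have h0 : emb p _ (tl p m) * tl p (m + 1) * emb p _ (tl p m) ∈ mackey p (m + 1) :=
    tl_mem_mackey p _ _
  rw [← sub_add_cancel (tl p (m + 1) * emb p _ (tl p m) * tl p (m + 1))]
  refine add_mem ?_ h0
  have ht : emb p _ (tl p m) = t p m (Nat.lt_succ_of_lt (Nat.lt_succ_self (m + 1))) := emb_t p _ _
  refine ext_mem p fun ν => ?_
  have hpar : ∀ {z}, z ∈ mackey p (m + 1) → z * e p ν ∈ mackey p (m + 1) := fun hz =>
    mackey_mul_parabolic p hz (e_mem_parabolic p ν)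
  have hl : m + 1 < m + 1 + 2 := by omega
  have hl' : m + 1 + 1 < m + 1 + 2 := by omega
  rw [ht, tl]
  by_cases h : ν (lo m hl) = ν (hi (m + 1) hl')
  · by_cases h' : ν (lo m hl) = ν (hi m hl)
    · rw [braid_P p m hl hl' ν h h', ← vec3 (x p), mul_assoc, mul_assoc]
      refine add_mem (ev_x_mul_mem_mackey p _ _ (hpar ?_))
        (ev_x_mul_mem_mackey p _ _ (hpar (tl_mem p)))
      exact parabolic_le_mackey p (ht ▸ emb_mem_parabolic p _)
    · rw [braid_Q p m hl hl' ν h h', ← vec2 (x p), ← vec3 (x p), mul_assoc]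
      exact ev_x_mul_mem_mackey p _ _ (ev_x_mul_mem_mackey p _ _
        (parabolic_le_mackey p (e_mem_parabolic p ν)))
  · rw [braid_zero p m hl hl' ν h]
    exact zero_mem _

/-- For z = x_m^r e(m,i) y with y in R(m), the element y commutes with the right τ, the idempotent
passes through it, and x_m^r is traded for x_{m+1}^r on its right. What remains is τ², given by the
quadratic relation, and τ times an element of R(m+1,1). -/
theorem tl_mul_par_mul_tl {z : Alg p (m + 1)} (hz : z ∈ parabolic p m) :
    tl p m * emb p _ z * tl p m ∈ mackey p m := by
  have hz' := parabolic_le_closure p hz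
  clear hz
  induction hz' using AddSubgroup.closure_induction with
  | zero => simp
  | add x y _ _ hx hy => rw [map_add, mul_add, add_mul]; exact add_mem hx hy
  | neg x _ hx => rw [map_neg, mul_neg, neg_mul]; exact neg_mem hx
  | mem z hz =>
    obtain ⟨r, i, y, rfl⟩ := hz
    rw [map_mul, map_mul]
    rw [show tl p m * (emb p _ (xl p m ^ r) * emb p _ (eLast p m i) * emb p _ (emb p _ y)) *
      tl p m = tl p m * (emb p _ (xl p m ^ r) * (emb p _ (eLast p m i) * (emb p _ (emb p _ y) *
      tl p m))) by simp only [mul_assoc], ← tl_emb_emb, ← mul_assoc (emb p _ (eLast p m i)),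
      ← tl_eLast, show tl p m * (emb p _ (xl p m ^ r) * (tl p m * eLast p (m + 1) i *
      emb p _ (emb p _ y))) = tl p m * tl p m * (xl p (m + 1) ^ r * eLast p (m + 1) i *
        emb p _ (emb p _ y)) - tl p m * ((tl p m * xl p (m + 1) ^ r - emb p _ (xl p m ^ r) *
        tl p m) * eLast p (m + 1) i * emb p _ (emb p _ y)) by noncomm_ring]
    refine sub_mem (mackey_mul_parabolic p (tl_mul_tl_mem p) ?_) (tl_mul_parabolic p ?_)
    · exact mul_mem (mul_mem (pow_mem (xl_mem_parabolic p) r) (eLast_mem_parabolic p i))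
        (emb_mem_parabolic p _)
    · exact mul_mem (mul_mem (tl_xl_pow_sub_mem p r) (eLast_mem_parabolic p i))
        (emb_mem_parabolic p _)

theorem mem_of_generators {S : Subalgebra k (Alg p n)} (he : ∀ ν, e p ν ∈ S) (hx : ∀ a, x p a ∈ S)
    (ht : ∀ l h, t p l h ∈ S) (z : Alg p n) : z ∈ S := by
  induction z using Alg.induction p with
  | scalar c => exact S.algebraMap_mem c
  | he ν => exact he ν
  | hx a => exact hx a
  | ht l h => exact ht l h
  | mul a b ha hb => exact mul_mem ha hb
  | add a b ha hb => exact add_mem ha hb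

theorem mem_parabolic_zero (z : Alg p 1) : z ∈ parabolic p 0 :=
  mem_of_generators p (e_mem_parabolic p) (x_mem_parabolic p) (fun l h => by omega) z

/-- `R(m + 2)` is the sum of `R(m + 1) τ R(m + 1)` and `R(m + 1, 1)`. -/
theorem mem_mackey (z : Alg p (m + 2)) : z ∈ mackey p m := by
  induction m with
  | zero =>
    have : z ∈ mackeyStab p 0 := by
      refine mem_of_generators p (fun ν => parabolic_le_mackeyStab p (e_mem_parabolic p ν))
        (fun a => parabolic_le_mackeyStab p (x_mem_parabolic p a)) (fun l h => ?_) z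
      obtain rfl : l = 0 := by omega
      change tl p 0 ∈ _
      refine mem_mackeyStab p (fun x y => ?_) fun z hz => tl_mul_parabolic p hz
      rw [← mul_assoc, ← mul_assoc]
      exact mackey_mul_parabolic p (tl_mul_par_mul_tl p (mem_parabolic_zero p x))
        (emb_mem_parabolic p y)
    simpa using this 1 (parabolic_le_mackey p (one_mem _))
  | succ m ih =>
    -- It suffices that every generator preserves the sum, since the sum contains 1. All generators
    -- except the last crossing belong to the parabolic subalgebra.
    have : z ∈ mackeyStab p (m + 1) := by
      refine mem_of_generators p (fun ν => parabolic_le_mackeyStab p (e_mem_parabolic p ν))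
        (fun a => parabolic_le_mackeyStab p (x_mem_parabolic p a)) (fun l h => ?_) z
      by_cases hl : l < m + 1
      · rw [← emb_t p l (by omega)]
        exact parabolic_le_mackeyStab p (emb_mem_parabolic p _)
      obtain rfl : l = m + 1 := by omega
      change tl p (m + 1) ∈ _
      refine mem_mackeyStab p (fun x y => ?_) fun z hz => tl_mul_parabolic p hz
      rw [← mul_assoc, ← mul_assoc]
      refine mackey_mul_parabolic p ?_ (emb_mem_parabolic p y)
      induction (ih x) using mackey_induction with
      | zero => simp
      | add a b _ _ ha hb => rw [map_add, mul_add, add_mul]; exact add_mem ha hb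
      | neg a _ ha => rw [map_neg, mul_neg, neg_mul]; exact neg_mem ha
      | par z hz => exact tl_mul_par_mul_tl p hz
      | cross a b =>
        -- Here x = a τ_m b with a and b in R(m+1). Both commute with τ_{m+1}, which leaves a
        -- (τ_{m+1} τ_m τ_{m+1}) b.
        rw [map_mul, map_mul, show tl p (m + 1) * (emb p _ (emb p _ a) * emb p _ (tl p m) *
          emb p _ (emb p _ b)) * tl p (m + 1) = tl p (m + 1) * emb p _ (emb p _ a) *
          emb p _ (tl p m) * (emb p _ (emb p _ b) * tl p (m + 1)) by simp only [mul_assoc],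
          tl_emb_emb, ← tl_emb_emb p b, show emb p _ (emb p _ a) * tl p (m + 1) *
          emb p _ (tl p m) * (tl p (m + 1) * emb p _ (emb p _ b)) = emb p _ (emb p _ a) *
          (tl p (m + 1) * emb p _ (tl p m) * tl p (m + 1)) * emb p _ (emb p _ b) by
            simp only [mul_assoc]]
        exact mackey_mul_parabolic p (parabolic_le_mackeyStab p (emb_mem_parabolic p _) _
          (braid_mem p)) (emb_mem_parabolic p _)
    simpa using this 1 (parabolic_le_mackey p (one_mem _))

/-! #### The spanning set -/

/-- The product `τ_a τ_{a + 1} ⋯ τ_{n - 1}` in `R(n + 1)`. -/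
noncomputable def cyc : (n : ℕ) → ℕ → Alg p (n + 1)
  | 0, _ => 1
  | m + 1, a => if a ≤ m then emb p (m + 1) (cyc m a) * tl p m else 1

theorem cyc_last (n : ℕ) : cyc p n n = 1 := by
  cases n with
  | zero => rfl
  | succ m => rw [cyc, if_neg (by omega)]

theorem cyc_succ {a : ℕ} (h : a ≤ m) : cyc p (m + 1) a = emb p (m + 1) (cyc p m a) * tl p m :=
  if_pos h

/-- The definition splits off the rightmost crossing, as suits the induction on n; the expansion in
the representation needs the leftmost one. -/
theorem cyc_eq_t_mul {a : ℕ} (h : a < n) :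
    cyc p n a = t p a (Nat.succ_lt_succ h) * cyc p n (a + 1) := by
  induction n with
  | zero => omega
  | succ m ih =>
    rw [cyc_succ p (by omega)]
    by_cases ha : a = m
    · subst ha
      rw [cyc_last, cyc_last, map_one, one_mul, mul_one]
      rfl
    · rw [cyc_succ p (by omega), ih (by omega), map_mul, emb_t, mul_assoc]

/-- The element `τ_a ⋯ τ_{n - 1} x_n ^ r e(n, i)`. -/
noncomputable def bas (n a r : ℕ) (i : I) : Alg p (n + 1) :=
  cyc p n a * xl p n ^ r * eLast p n i

theorem parabolic_le_bas {z : Alg p (n + 1)} (hz : z ∈ parabolic p n) :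
    z ∈ AddSubgroup.closure {z | ∃ r i y, z = bas p n n r i * emb p n y} := by
  have := parabolic_le_closure p hz
  simp only [bas, cyc_last, one_mul]
  exact this

/-- Leading terms: right multiplication by τ carries a basis element of R(m+1) to the basis element
of R(m+2) with the same indices. The error is the commutator of τ with x^r, multiplied from the left
by an element of R(m+1), hence is parabolic. -/
theorem emb_cyc_mul_mem {a : ℕ} (ha : a ≤ m) (r : ℕ) (i : I) :
    emb p _ (bas p m a r i) * tl p m - bas p (m + 1) a r i ∈
      (parabolic p (m + 1)).toSubmodule.toAddSubgroup.map
        (AddMonoidHom.mulLeft (emb p _ (cyc p m a))) := by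
  refine ⟨-((tl p m * xl p (m + 1) ^ r - emb p _ (xl p m ^ r) * tl p m) *
    eLast p (m + 1) i), neg_mem (mul_mem (s := parabolic p (m + 1)) (tl_xl_pow_sub_mem p r)
    (eLast_mem_parabolic p i)), ?_⟩
  change emb p _ (cyc p m a) * _ = _
  rw [bas, bas, cyc_succ p ha, map_mul, map_mul, mul_assoc _ _ (tl p m), ← tl_eLast]
  noncomm_ring

/-- The elements `τ_a ⋯ τ_{n - 1} x_n ^ r e(n, i)` generate `R(n + 1)` as a right
`R(n)`-module. -/
theorem mem_closure_bas (z : Alg p (n + 1)) :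
    z ∈ AddSubgroup.closure {z | ∃ a ≤ n, ∃ r i y, z = bas p n a r i * emb p n y} := by
  have hpar : ∀ {n} {z : Alg p (n + 1)}, z ∈ parabolic p n →
      z ∈ AddSubgroup.closure {z | ∃ a ≤ n, ∃ r i y, z = bas p n a r i * emb p n y} := by
    intro n z hz
    refine AddSubgroup.closure_mono ?_ (parabolic_le_bas p hz)
    rintro _ ⟨r, i, y, rfl⟩
    exact ⟨n, le_rfl, r, i, y, rfl⟩
  induction n with
  | zero => exact hpar (mem_parabolic_zero p z)
  | succ m ih =>
    induction mem_mackey p z using mackey_induction with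
    | zero => exact zero_mem _
    | add a b _ _ ha hb => exact add_mem ha hb
    | neg a _ ha => exact neg_mem ha
    | par z hz => exact hpar hz
    | cross x y =>
      induction ih x using AddSubgroup.closure_induction with
      | zero => simp
      | add a b _ _ ha hb => rw [map_add, add_mul, add_mul]; exact add_mem ha hb
      | neg a _ ha => rw [map_neg, neg_mul, neg_mul]; exact neg_mem ha
      | mem x hx =>
        obtain ⟨a, ha, r, i, y', rfl⟩ := hx
        obtain ⟨z, hz, h⟩ := emb_cyc_mul_mem p ha r i
        -- The coefficient y' lies in R(m), so it moves to the right of τ and joins y.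
        have h1 : emb p _ (bas p m a r i * emb p m y') * tl p m * emb p _ y =
            bas p (m + 1) a r i * emb p _ (emb p _ y' * y) +
              emb p _ (cyc p m a) * z * emb p _ (emb p _ y' * y) := by
          rw [show emb p _ (cyc p m a) * z = _ from h, map_mul, mul_assoc _ _ (tl p m),
            ← tl_emb_emb, map_mul]
          noncomm_ring
        rw [h1]
        refine add_mem (AddSubgroup.subset_closure ⟨a, by omega, r, i, _, rfl⟩) (hpar ?_)
        exact mul_mem (mul_mem (emb_mem_parabolic p _) hz) (emb_mem_parabolic p _)

end Alg
end Spanning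

/-! ### Independence: triangularity in the representation, faithfulness, and the basis theorem. -/

section Independence

namespace Generic

variable {k I : Type u} [CommRing k] {C : BorcherdsCartan I} {𝓀 : ℤ → AddSubgroup k}
  {p : Params C 𝓀} {K : Type u} [CommRing K] [Algebra k K] (G : Generic p K) {n : ℕ}

/-- The part of `τ_l` that permutes. -/
noncomputable def sOp (l : ℕ) (h : l + 1 < n) : Module.End k ((Fin n → I) → K) where
  toFun f μ := G.α (μ (lo l h)) (μ (hi l h)) l (l + 1) *
      G.perm (Equiv.swap l (l + 1)) (f (μ ∘ swp l h))
  map_add' f g := by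
    ext μ
    simp only [Pi.add_apply, map_add]
    ring
  map_smul' c f := by
    ext μ
    simp only [Pi.smul_apply, RingHom.id_apply, map_smul, mul_smul_comm]

/-- The part of `τ_l` that does not permute. -/
noncomputable def bOp (l : ℕ) (h : l + 1 < n) : Module.End k ((Fin n → I) → K) where
  toFun f μ := G.β (μ (lo l h)) (μ (hi l h)) l (l + 1) * f μ
  map_add' f g := by
    ext μ
    simp only [Pi.add_apply]
    ring
  map_smul' c f := by
    ext μ
    simp only [Pi.smul_apply, RingHom.id_apply, mul_smul_comm]

theorem tOp_eq (l : ℕ) (h : l + 1 < n) : G.tOp l h = G.sOp l h + G.bOp l h := rfl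

/-- It is an invertible permutation of colours and variables followed by multiplication by units. -/
theorem sOp_injective (l : ℕ) (h : l + 1 < n) : Function.Injective (G.sOp l h) := by
  rw [injective_iff_map_eq_zero]
  intro f hf
  ext μ
  have h1 : G.α ((μ ∘ swp l h) (lo l h)) ((μ ∘ swp l h) (hi l h)) l (l + 1) *
      G.perm (Equiv.swap l (l + 1)) (f ((μ ∘ swp l h) ∘ swp l h)) = 0 :=
    congrFun hf (μ ∘ swp l h)
  rw [comp_swp_swp] at h1
  have h2 := (G.isUnit_α _ _ (by omega)).mul_right_eq_zero.1 h1
  have h3 := congrArg (G.perm (Equiv.swap l (l + 1))) h2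
  rwa [perm_swap_swap, map_zero] at h3

theorem sOp_x (l : ℕ) (h : l + 1 < n) (a : ℕ) (f : (Fin n → I) → K) :
    G.sOp l h (scal (k := k) n (G.X a) f) =
      scal (k := k) n (G.X (Equiv.swap l (l + 1) a)) (G.sOp l h f) := by
  ext μ
  change _ * G.perm _ (_ * _) = _ * (_ * _)
  rw [map_mul, G.perm_X, mul_left_comm]

theorem bOp_x (l : ℕ) (h : l + 1 < n) (a : ℕ) (f : (Fin n → I) → K) :
    G.bOp l h (scal (k := k) n (G.X a) f) = scal (k := k) n (G.X a) (G.bOp l h f) := by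
  ext μ
  exact mul_left_comm _ _ _

variable [Fintype I]

open Alg

theorem rep_xl : G.rep (n + 1) (xl p n) = scal (n + 1) (G.X n) := G.rep_x _

open Classical in
theorem rep_eSum (φ : (Fin n → I) → Prop) (f : (Fin n → I) → K) (μ : Fin n → I) :
    G.rep n (eSum p φ) f μ = if φ μ then f μ else 0 := by
  rw [eSum, map_sum, LinearMap.sum_apply, Finset.sum_apply, Finset.sum_eq_single μ]
  · split_ifs
    · rw [rep_e, eOp_apply_self]
    · simp
  · intro ν _ h
    split_ifs
    · rw [rep_e, eOp_apply_of_ne (Ne.symm h)]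
    · simp
  · simp

/-- The expansion of `τ_a ⋯ τ_{n - 1}` according to the image of the last position. -/
theorem exists_rep_cyc {a : ℕ} (ha : a ≤ n) :
    ∃ U : ℕ → Module.End k ((Fin (n + 1) → I) → K),
      (∀ b f, U b (scal (k := k) (n + 1) (G.X n) f) = scal (k := k) (n + 1) (G.X b) (U b f)) ∧
      G.rep (n + 1) (cyc p n a) = ∑ b ∈ Finset.Icc a n, U b ∧ Function.Injective (U a) := by
  induction ha using Nat.decreasingInduction with
  | self =>
    refine ⟨fun b => if b = n then 1 else 0, fun b f => ?_, ?_, ?_⟩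
    · by_cases h : b = n
      · subst h; simp
      · simp [h]
    · simp [cyc_last]
    · simp only [if_true]
      exact Function.injective_id
  | of_succ a ha ih =>
    obtain ⟨U, hU, hs, hi⟩ := ih
    have h : a + 1 < n + 1 := Nat.succ_lt_succ ha
    -- Splitting τ_a into its two parts matters only for the term of a + 1: the permuting part moves
    -- x_{a+1} to x_a and the other part keeps it. For b > a + 1 all of τ_a commutes with x_b.
    refine ⟨fun b => if b = a then G.sOp a h * U (a + 1) else if b = a + 1 then
      G.bOp a h * U (a + 1) else G.tOp a h * U b, fun b f => ?_, ?_, ?_⟩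
    · by_cases h1 : b = a
      · subst h1
        dsimp only
        rw [if_pos rfl, Module.End.mul_apply, Module.End.mul_apply, hU, sOp_x,
          Equiv.swap_apply_right]
      · by_cases h2 : b = a + 1
        · subst h2
          dsimp only
          rw [if_neg h1, if_pos rfl, Module.End.mul_apply, Module.End.mul_apply, hU, bOp_x]
        · dsimp only
          rw [if_neg h1, if_neg h2, Module.End.mul_apply, Module.End.mul_apply, hU, tOp_eq,
            LinearMap.add_apply, LinearMap.add_apply, sOp_x, bOp_x, map_add,
            Equiv.swap_apply_of_ne_of_ne h1 h2]
    · rw [cyc_eq_t_mul p ha, map_mul, hs, rep_t, ← Finset.insert_Icc_add_one_left_eq_Icc ha.le,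
        ← Finset.insert_Icc_add_one_left_eq_Icc (show a + 1 ≤ n from ha),
        Finset.sum_insert (by simp), Finset.sum_insert (by simp), Finset.sum_insert (by simp),
        if_pos rfl, if_neg (Nat.succ_ne_self a), if_pos rfl, mul_add, tOp_eq, add_mul, add_assoc,
        Finset.mul_sum]
      congr 2
      refine Finset.sum_congr rfl fun b hb => ?_
      have hb' := (Finset.mem_Icc.1 hb).1
      rw [if_neg (by omega), if_neg (by omega)]
    · simp only [if_true]
      exact (G.sOp_injective a h).comp hi

/-- The operators `τ_a ⋯ τ_{n - 1}` are independent over the operators commuting with `x_n`. -/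
theorem rep_eq_zero_of_sum_cyc {Z : ℕ → Alg p (n + 1)} (hZ : ∀ a, Z a * xl p n = xl p n * Z a)
    (h : G.rep (n + 1) (∑ a ∈ Finset.range (n + 1), cyc p n a * Z a) = 0) :
    ∀ a ≤ n, G.rep (n + 1) (Z a) = 0 := by
  have hex : ∀ a, ∃ U : ℕ → Module.End k ((Fin (n + 1) → I) → K), a ≤ n →
      (∀ b f, U b (scal (k := k) (n + 1) (G.X n) f) = scal (k := k) (n + 1) (G.X b) (U b f)) ∧
      G.rep (n + 1) (cyc p n a) = ∑ b ∈ Finset.Icc a n, U b ∧ Function.Injective (U a) := by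
    intro a
    by_cases ha : a ≤ n
    · obtain ⟨U, hU⟩ := G.exists_rep_cyc ha
      exact ⟨U, fun _ => hU⟩
    · exact ⟨0, fun h => absurd h ha⟩
  choose U hU using hex
  have hpow : ∀ a ≤ n, ∀ b f r, U a b (scal (k := k) (n + 1) (G.X n ^ r) f) =
      scal (k := k) (n + 1) (G.X b ^ r) (U a b f) := by
    intro a ha b f r
    induction r with
    | zero => simp
    | succ r ih =>
      rw [pow_succ', pow_succ', map_mul, map_mul, Module.End.mul_apply, Module.End.mul_apply,
        (hU a ha).1, ih]
  have hZpow : ∀ a r f, G.rep (n + 1) (Z a) (scal (k := k) (n + 1) (G.X n ^ r) f) =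
      scal (k := k) (n + 1) (G.X n ^ r) (G.rep (n + 1) (Z a) f) := by
    intro a r f
    rw [map_pow, ← G.rep_xl, ← map_pow, ← Module.End.mul_apply, ← Module.End.mul_apply,
      ← map_mul, ← map_mul, (Commute.pow_right (hZ a) r).eq]
  -- Applying the relation to X_n^r f multiplies the component of b by X_b^r. As r is arbitrary, the
  -- Vandermonde argument shows that every component vanishes separately.
  have key : ∀ f μ, ∀ b ∈ Finset.range (n + 1),
      ∑ a ∈ Finset.range (b + 1), U a b (G.rep (n + 1) (Z a) f) μ = 0 := by
    intro f μ
    refine eq_zero_of_forall_sum_pow_mul (x := G.X) (fun a _ b _ hab => G.isUnit_sub hab)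
      fun r => ?_
    have h1 := congrFun (LinearMap.congr_fun h (scal (k := k) (n + 1) (G.X n ^ r) f)) μ
    rw [map_sum, LinearMap.sum_apply, Finset.sum_apply] at h1
    refine Eq.trans ?_ h1
    have h2 : ∀ a ∈ Finset.range (n + 1),
        G.rep (n + 1) (cyc p n a * Z a) (scal (k := k) (n + 1) (G.X n ^ r) f) μ =
        ∑ b ∈ Finset.Icc a n, G.X b ^ r * U a b (G.rep (n + 1) (Z a) f) μ := by
      intro a ha
      have ha' : a ≤ n := by simpa [Nat.lt_succ_iff] using ha
      rw [map_mul, Module.End.mul_apply, hZpow, (hU a ha').2.1, LinearMap.sum_apply,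
        Finset.sum_apply]
      refine Finset.sum_congr rfl fun b _ => ?_
      rw [hpow a ha', scal_apply]
    rw [Finset.sum_congr rfl h2]
    simp only [Finset.mul_sum]
    refine Finset.sum_comm' fun b a => ?_
    simp only [Finset.mem_range, Finset.mem_Icc]
    omega
  intro a ha
  -- In the component b = a only the indices up to a occur. The smaller ones vanish by induction,
  -- and the operator of the remaining one is injective.
  induction a using Nat.strong_induction_on with
  | _ a ih =>
    ext f μ
    have h1 : U a a (G.rep (n + 1) (Z a) f) = 0 := by
      ext μ
      have := key f μ a (Finset.mem_range.2 (by omega))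
      rw [Finset.sum_range_succ, Finset.sum_eq_zero, zero_add] at this
      · exact this
      · intro b hb
        rw [ih b (Finset.mem_range.1 hb) (by have := Finset.mem_range.1 hb; omega)]
        simp
    have := (hU a ha).2.2 (h1.trans (map_zero _).symm)
    rw [this]
    rfl

end Generic

namespace Alg

variable {k I : Type u} [CommRing k] [Fintype I] {C : BorcherdsCartan I} {𝓀 : ℤ → AddSubgroup k}
  (p : Params C 𝓀) {n m : ℕ}

variable (n) in
/-- The map `(y_κ) ↦ ∑ τ_a ⋯ τ_{n - 1} x_n ^ r e(n, i) y_κ`, over `κ = (a, r, i)`. -/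
noncomputable def expand : (Fin (n + 1) × ℕ × I →₀ Alg p n) →+ Alg p (n + 1) :=
  Finsupp.liftAddHom fun κ =>
    (AddMonoidHom.mulLeft (bas p n κ.1 κ.2.1 κ.2.2)).comp (emb p n : Alg p n →+ Alg p (n + 1))

theorem expand_single (κ : Fin (n + 1) × ℕ × I) (y : Alg p n) :
    expand p n (Finsupp.single κ y) = bas p n κ.1 κ.2.1 κ.2.2 * emb p n y := by
  simp [expand]

theorem expand_surjective : Function.Surjective (expand p n) := by
  intro z
  have hz := mem_closure_bas p z
  change z ∈ (expand p n).range
  refine (AddSubgroup.closure_le _).2 ?_ hz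
  rintro _ ⟨a, ha, r, i, y, rfl⟩
  exact ⟨Finsupp.single (⟨a, by omega⟩, r, i) y, expand_single p _ _⟩

theorem expand_eq_sum {y : Fin (n + 1) × ℕ × I →₀ Alg p n} {N : ℕ}
    (hN : ∀ κ ∈ y.support, κ.2.1 < N) :
    expand p n y = ∑ a : Fin (n + 1), cyc p n a *
      ∑ r ∈ Finset.range N, ∑ i, xl p n ^ r * eLast p n i * emb p n (y (a, r, i)) := by
  have : expand p n y = y.sum fun κ z => bas p n κ.1 κ.2.1 κ.2.2 * emb p n z := rfl
  rw [this, Finsupp.sum_of_support_subset y (s := Finset.univ ×ˢ Finset.range N ×ˢ Finset.univ)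
    (fun κ hκ => by simpa using hN κ (by simpa using hκ)) _ (by simp), Finset.sum_product]
  refine Finset.sum_congr rfl fun a _ => ?_
  rw [Finset.sum_product, Finset.mul_sum]
  refine Finset.sum_congr rfl fun r _ => ?_
  rw [Finset.mul_sum]
  refine Finset.sum_congr rfl fun i _ => ?_
  simp only [bas, mul_assoc]

/-- The inductive step of faithfulness and of independence at once: it is enough that the
represented operator vanishes. The indices are separated in the order a, i, r, and faithfulness for
R(n) then kills the coefficients. -/
theorem eq_zero_of_rep_expand {K : Type u} [CommRing K] [Algebra k K] (G : Generic p K)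
    (hn : ∀ y : Alg p n, G.rep n y = 0 → y = 0) {y : Fin (n + 1) × ℕ × I →₀ Alg p n}
    (hy : G.rep (n + 1) (expand p n y) = 0) : y = 0 := by
  classical
  obtain ⟨N, hN⟩ : ∃ N, ∀ κ ∈ y.support, κ.2.1 < N :=
    ⟨(y.support.sup fun κ => κ.2.1) + 1, fun κ hκ =>
      Nat.lt_succ_of_le (Finset.le_sup (f := fun κ : Fin (n + 1) × ℕ × I => κ.2.1) hκ)⟩
  -- The terms with a given a are collected; the factor beside τ_a ⋯ τ_{n-1} lies in R(n,1) and so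
  -- commutes with x_n. The value 0 beyond n is never used.
  let Z : ℕ → Alg p (n + 1) := fun a => if h : a < n + 1 then
    ∑ r ∈ Finset.range N, ∑ i, xl p n ^ r * eLast p n i * emb p n (y (⟨a, h⟩, r, i)) else 0
  have hZ : ∀ a, Z a * xl p n = xl p n * Z a := by
    intro a
    simp only [Z]
    split_ifs
    · simp only [Finset.sum_mul, Finset.mul_sum]
      refine Finset.sum_congr rfl fun r _ => Finset.sum_congr rfl fun i _ => ?_
      rw [mul_assoc, ← xl_emb, ← mul_assoc, mul_assoc (xl p n ^ r), eLast_xl, ← mul_assoc,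
        ← pow_succ, pow_succ']
      simp only [mul_assoc]
    · simp
  rw [expand_eq_sum p hN] at hy
  have h1 : ∑ a : Fin (n + 1), cyc p n a *
      ∑ r ∈ Finset.range N, ∑ i, xl p n ^ r * eLast p n i * emb p n (y (a, r, i)) =
      ∑ a ∈ Finset.range (n + 1), cyc p n a * Z a := by
    rw [Finset.sum_range]
    refine Finset.sum_congr rfl fun a _ => ?_
    simp only [Z, dif_pos a.2]
  rw [h1] at hy
  ext ⟨a, r, i⟩
  rw [Finsupp.zero_apply]
  by_cases hr : r < N
  · refine hn _ ?_
    have h2 := G.rep_eq_zero_of_sum_cyc hZ hy a (by omega)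
    simp only [Z, dif_pos a.2] at h2
    refine G.rep_eq_zero_of_sum (s := Finset.range N) (y := fun r => y (a, r, i)) ?_ r
      (Finset.mem_range.2 hr)
    intro f ν
    -- A function independent of the last colour, evaluated at a sequence ending in i: only e(n,i)
    -- survives and R(n) acts as on f.
    have h3 := congrFun (LinearMap.congr_fun h2 fun μ => f (μ ∘ Fin.castSucc)) (snoc ν i)
    rw [map_sum, LinearMap.sum_apply, Finset.sum_apply] at h3
    refine Eq.trans (Finset.sum_congr rfl fun r _ => ?_) h3
    rw [map_sum, LinearMap.sum_apply, Finset.sum_apply, Finset.sum_eq_single i]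
    · rw [map_mul, map_mul, map_pow, Module.End.mul_apply, Module.End.mul_apply, G.rep_xl,
        ← map_pow, Generic.scal_apply, eLast, G.rep_eSum, if_pos (snoc_last ν i), G.rep_emb]
      have h4 : (fun μ : Fin n → I => f (snoc μ i ∘ Fin.castSucc)) = f :=
        funext fun μ => congrArg f (funext fun a => by simp)
      rw [h4]
    · intro j _ hj
      rw [map_mul, map_mul, map_pow, Module.End.mul_apply, Module.End.mul_apply, G.rep_xl,
        ← map_pow, Generic.scal_apply, eLast, G.rep_eSum, if_neg (by rw [snoc_last]; exact hj.symm),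
        mul_zero]
    · simp
  · by_contra h
    exact hr (hN (a, r, i) (by simpa using h))

/-- Induction on n. R(0) consists of scalars, which embed in K; for the step, every element of
R(n+1) is an expansion with coefficients in R(n). -/
theorem rep_faithful {K : Type u} [CommRing K] [Algebra k K] (G : Generic p K) (y : Alg p n)
    (hy : G.rep n y = 0) : y = 0 := by
  induction n with
  | zero =>
    have h1 : ∀ y : Alg p 0, ∃ c, y = algebraMap k _ c := by
      intro y
      have he : ∀ ν : Fin 0 → I, e p ν = 1 := fun ν => by
        rw [← e_sum p, Fintype.sum_subsingleton _ ν]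
      have : y ∈ (⊥ : Subalgebra k (Alg p 0)) :=
        mem_of_generators p (fun ν => by rw [he]; exact one_mem _) (fun a => a.elim0)
          (fun l h => by omega) y
      obtain ⟨c, hc⟩ := Algebra.mem_bot.1 this
      exact ⟨c, hc.symm⟩
    obtain ⟨c, rfl⟩ := h1 y
    rw [AlgHom.commutes] at hy
    have h2 := congrFun (LinearMap.congr_fun hy fun _ => 1) (fun a => a.elim0)
    have h3 : c • (1 : K) = 0 := h2
    rw [← Algebra.algebraMap_eq_smul_one, ← map_zero (algebraMap k K)] at h3
    rw [G.injective h3, map_zero]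
  | succ n ih =>
    obtain ⟨z, rfl⟩ := expand_surjective p y
    rw [eq_zero_of_rep_expand p G ih hy, map_zero]

/-- Every element of `R(n + 1)` can be uniquely written as
`∑ τ_a ⋯ τ_{n - 1} x_n ^ r e(n, i) y_κ`, over `κ = (a, r, i)`. -/
theorem expand_bijective : Function.Bijective (expand p n) := by
  refine ⟨(injective_iff_map_eq_zero _).2 fun y hy => ?_, expand_surjective p⟩
  exact eq_zero_of_rep_expand p (generic p) (fun y => rep_faithful p (generic p) y)
    (by rw [hy, map_zero])

end Alg
end Independence

/-! ### The bimodule decomposition of R(m+2). -/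

section Mackey

variable {k I : Type u} [CommRing k] [Fintype I] {C : BorcherdsCartan I} {𝓀 : ℤ → AddSubgroup k}

instance (p : Params C 𝓀) (n : ℕ) :
    SMulCommClass (Alg p (n + 1)) (Alg p n)ᵐᵒᵖ (Reg p n) where
  smul_comm s a t :=
    (mul_assoc s (show Alg p (n + 1) from t) (Alg.emb p n a.unop)).symm

namespace SelfTensor

variable {p : Params C 𝓀} {n : ℕ}

theorem tmul_mul (x : Alg p (n + 1)) (a : Alg p n) (y : Alg p (n + 1)) :
    tmul (x * Alg.emb p n a) y = tmul x (Alg.emb p n a * y) :=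
  BalTensor.smul_tmul (S := Alg p (n + 1)) (Reg.of x) a (Reg.of y)

theorem smul_tmul (u x y : Alg p (n + 1)) : u • tmul x y = tmul (u * x) y := rfl

theorem mulRight_tmul (v x y : Alg p (n + 1)) : mulRight v (tmul x y) = tmul x (y * v) := rfl

/-- The biadditive map `(x, y) ↦ x ⊗ y`. -/
noncomputable def mkHom : Alg p (n + 1) →+ Alg p (n + 1) →+ SelfTensor p n :=
  BalTensor.mkHom (S := Alg p (n + 1)) (A := Alg p n) (B := Reg p n) (N := Reg p n)

theorem mkHom_apply (x y : Alg p (n + 1)) : mkHom x y = tmul x y := rfl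

theorem lift_exists {P : Type*} [AddCommGroup P] (f : Alg p (n + 1) →+ Alg p (n + 1) →+ P)
    (hf : ∀ x a y, f (x * Alg.emb p n a) y = f x (Alg.emb p n a * y)) :
    ∃ g : SelfTensor p n →+ P, ∀ x y, g (tmul x y) = f x y :=
  BalTensor.lift_exists (S := Alg p (n + 1)) (A := Alg p n) (B := Reg p n) (N := Reg p n) f hf

theorem induction {motive : SelfTensor p n → Prop} (zero : motive 0)
    (add : ∀ s t, motive s → motive t → motive (s + t)) (tmul : ∀ x y, motive (tmul x y))
    (s : SelfTensor p n) : motive s := by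
  obtain ⟨s, rfl⟩ := Submodule.mkQ_surjective _ s
  induction s using TensorProduct.induction_on with
  | zero => rw [map_zero]; exact zero
  | tmul x y => exact tmul x y
  | add x y hx hy => rw [map_add]; exact add _ _ hx hy

theorem mulRight_zero (v : Alg p (n + 1)) : mulRight v (0 : SelfTensor p n) = 0 :=
  map_zero (BalTensor.map _ _ _ _)

theorem mulRight_add (v : Alg p (n + 1)) (s t : SelfTensor p n) :
    mulRight v (s + t) = mulRight v s + mulRight v t :=
  map_add (BalTensor.map _ _ _ _) s t

variable (p n) in
/-- The map `(y_κ) ↦ ∑ τ_a ⋯ τ_{n - 1} x_n ^ r e(n, i) ⊗ y_κ`, over `κ = (a, r, i)`. -/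
noncomputable def expand : (Fin (n + 1) × ℕ × I →₀ Alg p (n + 1)) →+ SelfTensor p n :=
  Finsupp.liftAddHom fun κ => mkHom (Alg.bas p n κ.1 κ.2.1 κ.2.2)

theorem expand_single (κ : Fin (n + 1) × ℕ × I) (y : Alg p (n + 1)) :
    expand p n (Finsupp.single κ y) = tmul (Alg.bas p n κ.1 κ.2.1 κ.2.2) y :=
  Finsupp.liftAddHom_apply_single _ _ _

/-- Coefficients in R(n) move across the tensor sign. Injectivity is not needed here: the
triangularity of `mackeyHom` covers it. -/
theorem expand_surjective : Function.Surjective (expand p n) := by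
  intro s
  change s ∈ (expand p n).range
  induction s using induction with
  | zero => exact zero_mem _
  | add s t hs ht => exact add_mem hs ht
  | tmul x y =>
    obtain ⟨w, rfl⟩ := Alg.expand_surjective p x
    induction w using Finsupp.induction_linear with
    | zero =>
      rw [map_zero, ← mkHom_apply, map_zero]
      exact zero_mem _
    | add v w hv hw =>
      rw [map_add, ← mkHom_apply, map_add]
      exact add_mem hv hw
    | single κ a =>
      rw [Alg.expand_single, tmul_mul]
      exact ⟨Finsupp.single κ (Alg.emb p n a * y), expand_single _ _⟩

end SelfTensor

namespace Alg

variable (p : Params C 𝓀) {n : ℕ} (m : ℕ)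

/-- The biadditive map `(x, y) ↦ x τ y`. -/
noncomputable def crossHom : Alg p (m + 1) →+ Alg p (m + 1) →+ Alg p (m + 2) :=
  AddMonoidHom.mk' (fun x => AddMonoidHom.mk'
      (fun y => emb p (m + 1) x * tl p m * emb p (m + 1) y)
      (fun y z => by rw [map_add, mul_add]))
    (fun x y => by
      ext z
      change emb p (m + 1) (x + y) * tl p m * emb p (m + 1) z = _ * _ * _ + _ * _ * _
      rw [map_add, add_mul, add_mul])

theorem crossHom_mul (x : Alg p (m + 1)) (a : Alg p m) (y : Alg p (m + 1)) :
    crossHom p m (x * emb p m a) y = crossHom p m x (emb p m a * y) := by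
  change emb p (m + 1) (x * _) * tl p m * emb p (m + 1) y = _ * _ * emb p (m + 1) (_ * y)
  rw [map_mul, map_mul, mul_assoc (emb p (m + 1) x), ← tl_emb_emb]
  simp only [mul_assoc]

/-- The map `x ⊗ y ↦ x τ y`. -/
noncomputable def mackeyHom : SelfTensor p m →+ Alg p (m + 2) :=
  (SelfTensor.lift_exists (crossHom p m) (crossHom_mul p m)).choose

theorem mackeyHom_tmul (x y : Alg p (m + 1)) :
    mackeyHom p m (SelfTensor.tmul x y) = emb p (m + 1) x * tl p m * emb p (m + 1) y :=
  (SelfTensor.lift_exists (crossHom p m) (crossHom_mul p m)).choose_spec x y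

/-- The basis elements with a = n contain no crossing, and these alone generate R(n,1). -/
theorem exists_expand_of_mem_parabolic {z : Alg p (n + 1)} (hz : z ∈ parabolic p n) :
    ∃ w : Fin (n + 1) × ℕ × I →₀ Alg p n, expand p n w = z ∧
      ∀ κ, κ.1 ≠ Fin.last n → w κ = 0 := by
  have hz' := parabolic_le_bas p hz
  clear hz
  induction hz' using AddSubgroup.closure_induction with
  | zero => exact ⟨0, map_zero _, fun _ _ => rfl⟩
  | mem z hz =>
    obtain ⟨r, i, y, rfl⟩ := hz
    refine ⟨Finsupp.single (Fin.last n, r, i) y, expand_single p _ _, fun κ hκ => ?_⟩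
    rw [Finsupp.single_eq_of_ne]
    rintro rfl
    exact hκ rfl
  | add x y _ _ ihx ihy =>
    obtain ⟨v, hv, hv'⟩ := ihx
    obtain ⟨w, hw, hw'⟩ := ihy
    exact ⟨v + w, by rw [map_add, hv, hw], fun κ hκ => by
      rw [Finsupp.add_apply, hv' κ hκ, hw' κ hκ, add_zero]⟩
  | neg x _ ihx =>
    obtain ⟨v, hv, hv'⟩ := ihx
    exact ⟨-v, by rw [map_neg, hv], fun κ hκ => by rw [Finsupp.neg_apply, hv' κ hκ, neg_zero]⟩

/-- Modulo R(m+1,1) the map x ⊗ y ↦ x τ y is the inclusion of the indices a ≤ m in the basis of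
R(m+2); this is `emb_cyc_mul_mem` with coefficients. -/
theorem mackeyHom_sub_mem (y : Fin (m + 1) × ℕ × I →₀ Alg p (m + 1)) :
    mackeyHom p m (SelfTensor.expand p m y) -
      expand p (m + 1) (y.mapDomain fun κ => (κ.1.castSucc, κ.2)) ∈ parabolic p (m + 1) := by
  induction y using Finsupp.induction_linear with
  | zero => simp
  | add v w hv hw =>
    rw [map_add, map_add, Finsupp.mapDomain_add, map_add, add_sub_add_comm]
    exact add_mem hv hw
  | single κ z =>
    rw [SelfTensor.expand_single, Finsupp.mapDomain_single, expand_single, mackeyHom_tmul,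
      ← sub_mul]
    refine mul_mem ?_ (emb_mem_parabolic p _)
    obtain ⟨v, hv, hv'⟩ := emb_cyc_mul_mem p (Nat.le_of_lt_succ κ.1.2) κ.2.1 κ.2.2
    change _ - bas p (m + 1) κ.1 κ.2.1 κ.2.2 ∈ _
    rw [← hv']
    exact mul_mem (emb_mem_parabolic p _) hv

/-- The map `(x ⊗ y, z) ↦ x τ y + z`. -/
noncomputable def mackeySum : SelfTensor p m × parabolic p (m + 1) →+ Alg p (m + 2) :=
  (mackeyHom p m).coprod ((parabolic p (m + 1)).val : parabolic p (m + 1) →+ Alg p (m + 2))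

/-- Surjectivity is `mem_mackey`. For injectivity, a relation places an expansion over a ≤ m inside
R(m+1,1), whose expansions only use a = m + 1; uniqueness of coordinates makes all of them zero. -/
theorem mackeySum_bijective : Function.Bijective (mackeySum p m) := by
  constructor
  · rw [injective_iff_map_eq_zero]
    rintro ⟨s, z⟩ h
    replace h : mackeyHom p m s + z = 0 := h
    obtain ⟨y, rfl⟩ := SelfTensor.expand_surjective s
    have h1 := mackeyHom_sub_mem p m y
    rw [eq_neg_of_add_eq_zero_left h, ← neg_add', neg_mem_iff] at h1
    have h2 := sub_mem h1 z.2
    rw [add_sub_cancel_left] at h2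
    obtain ⟨w, hw, hw'⟩ := exists_expand_of_mem_parabolic p h2
    have h3 := (expand_bijective p).1 hw
    -- The same element has coordinates supported at a ≤ m and coordinates supported at the last
    -- index.
    have hy0 : y = 0 := by
      ext κ
      have hinj : Function.Injective fun κ : Fin (m + 1) × ℕ × I => (κ.1.castSucc, κ.2) :=
        fun a b hab => Prod.ext (Fin.castSucc_injective _ (Prod.ext_iff.1 hab).1)
          (Prod.ext_iff.1 hab).2
      rw [← Finsupp.mapDomain_apply hinj y κ, ← h3, hw' _ (Fin.castSucc_ne_last _)]
      rfl
    rw [hy0, map_zero, map_zero, zero_add] at h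
    rw [hy0, map_zero]
    exact Prod.ext rfl (Subtype.ext h)
  · intro z
    induction mem_mackey p z using mackey_induction with
    | zero => exact ⟨0, map_zero _⟩
    | add a b _ _ ha hb =>
      obtain ⟨a, rfl⟩ := ha
      obtain ⟨b, rfl⟩ := hb
      exact ⟨a + b, map_add _ _ _⟩
    | neg a _ ha =>
      obtain ⟨a, rfl⟩ := ha
      exact ⟨-a, map_neg _ _⟩
    | cross x y => exact ⟨(SelfTensor.tmul x y, 0), by simp [mackeySum, mackeyHom_tmul]⟩
    | par z hz => exact ⟨(0, ⟨z, hz⟩), by simp [mackeySum]⟩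

/-- `R(m + 2)` is the direct sum of `R(m + 1) ⊗ R(m + 1)` and `R(m + 1, 1)`. -/
noncomputable def mackeyEquiv : SelfTensor p m × parabolic p (m + 1) ≃+ Alg p (m + 2) :=
  AddEquiv.ofBijective _ (mackeySum_bijective p m)

variable {m}

theorem mackeyEquiv_apply (s : SelfTensor p m) (z : parabolic p (m + 1)) :
    mackeyEquiv p m (s, z) = mackeyHom p m s + z := rfl

theorem mackeyHom_smul (u : Alg p (m + 1)) (s : SelfTensor p m) :
    mackeyHom p m (u • s) = emb p (m + 1) u * mackeyHom p m s := by
  induction s using SelfTensor.induction with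
  | zero => simp
  | add s t hs ht => rw [smul_add, map_add, hs, ht, map_add, mul_add]
  | tmul x y =>
    rw [SelfTensor.smul_tmul, mackeyHom_tmul, mackeyHom_tmul, map_mul]
    simp only [mul_assoc]

theorem mackeyHom_mulRight (v : Alg p (m + 1)) (s : SelfTensor p m) :
    mackeyHom p m (s.mulRight v) = mackeyHom p m s * emb p (m + 1) v := by
  induction s using SelfTensor.induction with
  | zero => rw [SelfTensor.mulRight_zero, map_zero, zero_mul]
  | add s t hs ht => rw [SelfTensor.mulRight_add, map_add, hs, ht, map_add, add_mul]
  | tmul x y =>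
    rw [SelfTensor.mulRight_tmul, mackeyHom_tmul, mackeyHom_tmul, map_mul]
    simp only [mul_assoc]

theorem mackeyEquiv_smul (u : Alg p (m + 1)) (s : SelfTensor p m) (z : parabolic p (m + 1)) :
    mackeyEquiv p m (u • s, toParabolic p (m + 1) u * z) =
      emb p (m + 1) u * mackeyEquiv p m (s, z) := by
  rw [mackeyEquiv_apply, mackeyEquiv_apply, mackeyHom_smul, mul_add]
  rfl

theorem mackeyEquiv_mulRight (v : Alg p (m + 1)) (s : SelfTensor p m)
    (z : parabolic p (m + 1)) :
    mackeyEquiv p m (s.mulRight v, z * toParabolic p (m + 1) v) =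
      mackeyEquiv p m (s, z) * emb p (m + 1) v := by
  rw [mackeyEquiv_apply, mackeyEquiv_apply, mackeyHom_mulRight, add_mul]
  rfl

end Alg
end Mackey

/-! ### The parabolic component and its coordinates. -/

section Coefficients

variable {k I : Type u} [CommRing k] [Fintype I] {C : BorcherdsCartan I} {𝓀 : ℤ → AddSubgroup k}

namespace Alg

variable (p : Params C 𝓀) {n m : ℕ}

/-- Without the last crossing the last colour cannot change. This removes the second summand from
E_i F_j when i ≠ j. -/
theorem eLast_mul_of_mem_parabolic (i : I) {z : Alg p (n + 1)} (hz : z ∈ parabolic p n) :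
    eLast p n i * z = z * eLast p n i := by
  have h : parabolic p n ≤ Subalgebra.centralizer k {eLast p n i} := by
    refine Algebra.adjoin_le ?_
    rintro a ((⟨u, rfl⟩ | rfl) | ⟨j, rfl⟩) b rfl
    · exact eLast_comm p i u
    · exact eLast_xl p i
    · exact eSum_comm_eSum p _ _
  exact h hz _ rfl

/-- The projection of `R(n + 1)` to the summand `R(n, 1)`. -/
noncomputable def parProj : (n : ℕ) → Alg p (n + 1) →+ Alg p (n + 1)
  | 0 => AddMonoidHom.id _
  | m + 1 => ((parabolic p (m + 1)).val : parabolic p (m + 1) →+ Alg p (m + 2)).comp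
      ((AddMonoidHom.snd _ _).comp (mackeyEquiv p m).symm.toAddMonoidHom)

/-- For n = 0 the projection is the identity, rightly so because R(1) has no crossings. This lets
the case of β = 0 be treated uniformly. -/
theorem parProj_mem (z : Alg p (n + 1)) : parProj p n z ∈ parabolic p n := by
  cases n with
  | zero => exact mem_parabolic_zero p z
  | succ m => exact ((mackeyEquiv p m).symm z).2.2

theorem mackeyEquiv_symm_of_mem {z : Alg p (m + 2)} (hz : z ∈ parabolic p (m + 1)) :
    (mackeyEquiv p m).symm z = (0, ⟨z, hz⟩) := by
  rw [AddEquiv.symm_apply_eq, mackeyEquiv_apply, map_zero, zero_add]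

theorem mackeyEquiv_symm_cross (x y : Alg p (m + 1)) :
    (mackeyEquiv p m).symm (emb p (m + 1) x * tl p m * emb p (m + 1) y) =
      (SelfTensor.tmul x y, 0) := by
  rw [AddEquiv.symm_apply_eq, mackeyEquiv_apply, mackeyHom_tmul, ZeroMemClass.coe_zero, add_zero]

theorem mackeyEquiv_symm_mul (z : Alg p (m + 2)) (v : Alg p (m + 1)) :
    (mackeyEquiv p m).symm (z * emb p (m + 1) v) =
      (((mackeyEquiv p m).symm z).1.mulRight v,
        ((mackeyEquiv p m).symm z).2 * toParabolic p (m + 1) v) := by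
  rw [AddEquiv.symm_apply_eq, mackeyEquiv_mulRight, Prod.mk.eta, AddEquiv.apply_symm_apply]

theorem mackeyHom_add_parProj (z : Alg p (m + 2)) :
    mackeyHom p m ((mackeyEquiv p m).symm z).1 + parProj p (m + 1) z = z :=
  (mackeyEquiv p m).apply_symm_apply z

theorem parProj_of_mem {z : Alg p (n + 1)} (hz : z ∈ parabolic p n) : parProj p n z = z := by
  cases n with
  | zero => rfl
  | succ m =>
    change (((mackeyEquiv p m).symm z).2 : Alg p (m + 2)) = z
    rw [mackeyEquiv_symm_of_mem p hz]

theorem parProj_cross (x y : Alg p (m + 1)) :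
    parProj p (m + 1) (emb p (m + 1) x * tl p m * emb p (m + 1) y) = 0 := by
  change (((mackeyEquiv p m).symm _).2 : Alg p (m + 2)) = 0
  rw [mackeyEquiv_symm_cross]
  rfl

theorem parProj_mul (z : Alg p (n + 1)) (v : Alg p n) :
    parProj p n (z * emb p n v) = parProj p n z * emb p n v := by
  cases n with
  | zero => rfl
  | succ m =>
    change (((mackeyEquiv p m).symm _).2 : Alg p (m + 2)) = _
    rw [mackeyEquiv_symm_mul]
    rfl

/-- The coordinates with respect to the basis `τ_a ⋯ τ_{n - 1} x_n ^ r e(n, i)`. -/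
noncomputable def expandEquiv (n : ℕ) : (Fin (n + 1) × ℕ × I →₀ Alg p n) ≃+ Alg p (n + 1) :=
  AddEquiv.ofBijective (expand p n) (expand_bijective p)

/-- The basis elements stand on the left, so taking coordinates is right R(n)-linear; hence
coordinates pass to tensor products over R(n). -/
theorem expand_mapRange (y : Fin (n + 1) × ℕ × I →₀ Alg p n) (a : Alg p n) :
    expand p n (y.mapRange (· * a) (zero_mul a)) = expand p n y * emb p n a := by
  induction y using Finsupp.induction_linear with
  | zero => simp
  | add v w hv hw =>
    rw [Finsupp.mapRange_add (fun _ _ => add_mul _ _ _), map_add, map_add, hv, hw, add_mul]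
  | single κ z => rw [Finsupp.mapRange_single, expand_single, expand_single, map_mul, mul_assoc]

/-- The coefficients of the elements `x_n ^ r e(n, i)`. -/
noncomputable def parCoef (n : ℕ) (i : I) : Alg p (n + 1) →+ (ℕ →₀ Alg p n) :=
  (Finsupp.comapDomain.addMonoidHom (f := fun r : ℕ => (Fin.last n, r, i))
    (fun a b h => by simpa using h)).comp (expandEquiv p n).symm.toAddMonoidHom

theorem parCoef_expand (i : I) (y : Fin (n + 1) × ℕ × I →₀ Alg p n) (r : ℕ) :
    parCoef p n i (expand p n y) r = y (Fin.last n, r, i) := by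
  change (expandEquiv p n).symm (expandEquiv p n y) _ = _
  rw [AddEquiv.symm_apply_apply]

theorem parCoef_mul (i : I) (z : Alg p (n + 1)) (a : Alg p n) :
    parCoef p n i (z * emb p n a) = (parCoef p n i z).mapRange (· * a) (zero_mul a) := by
  obtain ⟨y, rfl⟩ := expand_surjective p z
  ext r
  rw [← expand_mapRange, parCoef_expand, Finsupp.mapRange_apply, Finsupp.mapRange_apply,
    parCoef_expand]

theorem parCoef_bas (i : I) (r : ℕ) (y : Alg p n) :
    parCoef p n i (bas p n n r i * emb p n y) = Finsupp.single r y := by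
  classical
  ext s
  have h := expand_single p (Fin.last n, r, i) y
  dsimp only [Fin.val_last] at h
  rw [← h, parCoef_expand, Finsupp.single_apply, Finsupp.single_apply]
  simp

theorem parCoef_bas_ne {i j : I} (hij : j ≠ i) (r : ℕ) (y : Alg p n) :
    parCoef p n i (bas p n n r j * emb p n y) = 0 := by
  classical
  ext s
  have h := expand_single p (Fin.last n, r, j) y
  dsimp only [Fin.val_last] at h
  rw [← h, parCoef_expand, Finsupp.single_apply]
  simp [hij]

/-- The coefficients for one colour i only recover the e(n,i)-component of z, hence the idempotent
on both sides. -/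
theorem sum_parCoef (i : I) {z : Alg p (n + 1)} (hz : z ∈ parabolic p n) :
    ((parCoef p n i z).sum fun r y => xl p n ^ r * emb p n y) * eLast p n i = z * eLast p n i := by
  let S : (ℕ →₀ Alg p n) →+ Alg p (n + 1) := Finsupp.liftAddHom fun r =>
    (AddMonoidHom.mulLeft (xl p n ^ r)).comp (emb p n : Alg p n →+ Alg p (n + 1))
  change S _ * _ = _
  have hz' := parabolic_le_bas p hz
  clear hz
  induction hz' using AddSubgroup.closure_induction with
  | zero => simp
  | add x y _ _ hx hy => rw [map_add, map_add, add_mul, hx, hy, add_mul]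
  | neg x _ hx => rw [map_neg, map_neg, neg_mul, hx, neg_mul]
  | mem z hz =>
    obtain ⟨r, j, y, rfl⟩ := hz
    by_cases h : j = i
    · subst h
      rw [parCoef_bas]
      have : S (Finsupp.single r y) = xl p n ^ r * emb p n y :=
        Finsupp.liftAddHom_apply_single _ _ _
      rw [this, bas, cyc_last, one_mul, mul_assoc _ (eLast p n j) (emb p n y), eLast_comm,
        mul_assoc, mul_assoc, mul_assoc, (eLast_idem p j).eq]
    · rw [parCoef_bas_ne p h, map_zero, zero_mul, mul_assoc, ← eLast_comm, bas, mul_assoc,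
        ← mul_assoc (eLast p n j), eLast_mul_ne p h, zero_mul, mul_zero]

end Alg

end Coefficients

/-! ### Induced modules in terms of elements of R(n+1). -/

section Induced

variable {k I : Type u} [CommRing k] [Fintype I] {C : BorcherdsCartan I} {𝓀 : ℤ → AddSubgroup k}
  (p : Params C 𝓀) {n : ℕ} {β δ : I →₀ ℕ} {j : I}

namespace Block

variable (n β) in
/-- The projection `R(n) → R(β)`, `r ↦ e(β) r`. -/
noncomputable def proj : Alg p n →+* Block p n β where
  toFun r := ⟨Alg.eBeta p n β * r, mem_iff.2 (by rw [← mul_assoc, (Alg.eBeta_idem p β).eq])⟩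
  map_one' := Subtype.ext (mul_one _)
  map_zero' := Subtype.ext (mul_zero _)
  map_add' _ _ := Subtype.ext (mul_add _ _ _)
  map_mul' a b := Subtype.ext (by
    change Alg.eBeta p n β * (a * b) = Alg.eBeta p n β * a * (Alg.eBeta p n β * b)
    rw [mul_assoc _ a, ← mul_assoc a, ← Alg.eBeta_central p β a, mul_assoc _ a, ← mul_assoc,
      ← mul_assoc, ← mul_assoc, (Alg.eBeta_idem p β).eq])

theorem proj_incl (r : Block p n β) : proj p n β (incl p n β r) = r := Subtype.ext (mul_incl r)

theorem proj_eBeta : proj p n β (Alg.eBeta p n β) = 1 := proj_incl p 1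

theorem proj_algebraMap (c : k) : proj p n β (algebraMap k _ c) = algebraMap k _ c :=
  Subtype.ext (Algebra.commutes _ _).symm

theorem incl_ofSucc (h : δ = β + root j) (r : Block p n β) :
    incl p (n + 1) δ ((ofSucc p h).toNonUnitalRingHom r) =
      Alg.emb p n (incl p n β r) * Alg.eLast p n j := rfl

theorem incl_idem (h : δ = β + root j) :
    incl p (n + 1) δ (ofSucc p h : GrHom (deg p n β) _).idem =
      Alg.emb p n (Alg.eBeta p n β) * Alg.eLast p n j := rfl

/-- The map `z ↦ e(δ) z e(β, j)` from `R(n + 1)` to `R(δ) e(β, j)`. -/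
noncomputable def toIdeal (h : δ = β + root j) :
    Alg p (n + 1) →+ (ofSucc p h : GrHom (deg p n β) (deg p (n + 1) δ)).leftIdeal where
  toFun z := ⟨proj p (n + 1) δ z * (ofSucc p h : GrHom (deg p n β) _).idem, by
    change _ * (ofSucc p h : GrHom (deg p n β) _).idem = _
    rw [mul_assoc, GrHom.idem_mul_idem]⟩
  map_zero' := Subtype.ext (by
    change proj p (n + 1) δ 0 * _ = 0
    rw [map_zero, zero_mul])
  map_add' a b := Subtype.ext (by
    change proj p (n + 1) δ (a + b) * _ = proj p (n + 1) δ a * _ + proj p (n + 1) δ b * _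
    rw [map_add, add_mul])

variable (h : δ = β + root j)

/-- The left factor e(δ) is superfluous: it is central and absorbed by e(β, j). -/
theorem incl_toIdeal (z : Alg p (n + 1)) : incl p (n + 1) δ (toIdeal p h z).1 =
    z * (Alg.emb p n (Alg.eBeta p n β) * Alg.eLast p n j) := by
  change Alg.eBeta p (n + 1) δ * z * (Alg.emb p n (Alg.eBeta p n β) * Alg.eLast p n j) = _
  rw [← eBeta_mul_eLast p h, Alg.eBeta_central, mul_assoc z, ← mul_assoc (Alg.eBeta p (n + 1) δ),
    (Alg.eBeta_idem p δ).eq]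

theorem toIdeal_incl (s : (ofSucc p h : GrHom (deg p n β) (deg p (n + 1) δ)).leftIdeal) :
    toIdeal p h (incl p (n + 1) δ s.1) = s := by
  refine Subtype.ext ?_
  change proj p (n + 1) δ (incl p (n + 1) δ s.1) * (ofSucc p h : GrHom (deg p n β) _).idem = s
  rw [proj_incl]
  exact s.2

theorem toIdeal_ext {y z : Alg p (n + 1)} (hyz :
    y * (Alg.emb p n (Alg.eBeta p n β) * Alg.eLast p n j) =
      z * (Alg.emb p n (Alg.eBeta p n β) * Alg.eLast p n j)) : toIdeal p h y = toIdeal p h z :=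
  Subtype.ext (Subtype.ext (by
    change incl p (n + 1) δ (toIdeal p h y).1 = incl p (n + 1) δ (toIdeal p h z).1
    rw [incl_toIdeal, incl_toIdeal, hyz]))

theorem smul_toIdeal (u : Block p (n + 1) δ) (z : Alg p (n + 1)) :
    u • toIdeal p h z = toIdeal p h (incl p (n + 1) δ u * z) :=
  Subtype.ext (by
    change u * (proj p (n + 1) δ z * _) = proj p (n + 1) δ (incl p (n + 1) δ u * z) * _
    rw [map_mul, proj_incl, mul_assoc])

theorem op_smul_toIdeal (a : Alg p n) (z : Alg p (n + 1)) :
    op (proj p n β a) • toIdeal p h z = toIdeal p h (z * Alg.emb p n a) :=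
  Subtype.ext (Subtype.ext (by
    change incl p (n + 1) δ (toIdeal p h z).1 *
        (Alg.emb p n (Alg.eBeta p n β * a) * Alg.eLast p n j) =
      incl p (n + 1) δ (toIdeal p h (z * Alg.emb p n a)).1
    rw [incl_toIdeal, incl_toIdeal, mul_assoc z, mul_assoc (Alg.emb p n (Alg.eBeta p n β)),
      ← mul_assoc (Alg.eLast p n j), Alg.eLast_comm, mul_assoc (Alg.emb p n _) (Alg.eLast p n j),
      (Alg.eLast_idem p j).eq, ← mul_assoc (Alg.emb p n _), ← map_mul, ← mul_assoc,
      ← mul_assoc, (Alg.eBeta_idem p β).eq, Alg.eBeta_central, map_mul]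
    simp only [mul_assoc]))

theorem toIdeal_mul_eLast (z : Alg p (n + 1)) :
    toIdeal p h (z * Alg.eLast p n j) = toIdeal p h z :=
  toIdeal_ext p h (by
    rw [mul_assoc, ← mul_assoc (Alg.eLast p n j), Alg.eLast_comm, mul_assoc (Alg.emb p n _),
      (Alg.eLast_idem p j).eq])

theorem toIdeal_mul_eLast_ne {i : I} (hij : i ≠ j) (z : Alg p (n + 1)) :
    toIdeal p h (z * Alg.eLast p n i) = 0 := by
  rw [← map_zero (toIdeal p h)]
  refine toIdeal_ext p h ?_
  rw [mul_assoc, ← mul_assoc (Alg.eLast p n i), Alg.eLast_comm, mul_assoc (Alg.emb p n _),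
    Alg.eLast_mul_ne p hij, mul_zero, mul_zero, zero_mul]

end Block

variable (n) in
/-- The module underlying `F_j N`. -/
abbrev Ind (h : δ = β + root j) (N : Type*) [AddCommGroup N] [Module (Block p n β) N] : Type _ :=
  BalTensor (Block p (n + 1) δ) (Block p n β)
    (Block.ofSucc p h : GrHom (Block.deg p n β) (Block.deg p (n + 1) δ)).leftIdeal N

namespace Ind

variable (h : δ = β + root j) {N : Type*} [AddCommGroup N] [Module (Block p n β) N]

/-- The element `e(δ) z e(β, j) ⊗ x`. -/
noncomputable def mk (z : Alg p (n + 1)) (x : N) : Ind p n h N :=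
  BalTensor.tmul (Block.toIdeal p h z) x

/-- The biadditive map `(z, x) ↦ e(δ) z e(β, j) ⊗ x`. -/
noncomputable def mkHom : Alg p (n + 1) →+ N →+ Ind p n h N :=
  (BalTensor.mkHom (S := Block p (n + 1) δ) (A := Block p n β)).comp (Block.toIdeal p h)

theorem mkHom_apply (z : Alg p (n + 1)) (x : N) : mkHom p h z x = mk p h z x := rfl

theorem mk_mul (z : Alg p (n + 1)) (a : Alg p n) (x : N) :
    mk p h (z * Alg.emb p n a) x = mk p h z (Block.proj p n β a • x) := by
  rw [mk, ← Block.op_smul_toIdeal, BalTensor.smul_tmul, mk]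

theorem mk_incl (s : (Block.ofSucc p h : GrHom (Block.deg p n β) (Block.deg p (n + 1) δ)).leftIdeal)
    (x : N) : mk p h (Block.incl p (n + 1) δ s.1) x = BalTensor.tmul s x := by
  rw [mk, Block.toIdeal_incl]

theorem smul_mk (u : Block p (n + 1) δ) (z : Alg p (n + 1)) (x : N) :
    u • mk p h z x = mk p h (Block.incl p (n + 1) δ u * z) x := by
  rw [mk, mk, ← Block.smul_toIdeal]
  rfl

theorem induction {motive : Ind p n h N → Prop} (zero : motive 0)
    (add : ∀ s t, motive s → motive t → motive (s + t)) (mk : ∀ z x, motive (mk p h z x))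
    (s : Ind p n h N) : motive s := by
  obtain ⟨s, rfl⟩ := Submodule.mkQ_surjective _ s
  induction s using TensorProduct.induction_on with
  | zero => rw [map_zero]; exact zero
  | tmul x y =>
    have := mk (Block.incl p (n + 1) δ x.1) y
    rwa [mk_incl] at this
  | add x y hx hy => rw [map_add]; exact add _ _ hx hy

/-- A map out of F_j N can thus be given on all of R(n+1). The idempotent e(n,j) has to be absorbed
explicitly, whereas e(β) is moved to N, where it acts as the identity. -/
theorem lift_exists {P : Type*} [AddCommGroup P] (f : Alg p (n + 1) →+ N →+ P)
    (hf : ∀ z a x, f (z * Alg.emb p n a) x = f z (Block.proj p n β a • x))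
    (hl : ∀ z x, f (z * Alg.eLast p n j) x = f z x) :
    ∃ g : Ind p n h N →+ P, ∀ z x, g (mk p h z x) = f z x := by
  obtain ⟨g, hg⟩ := BalTensor.lift_exists (S := Block p (n + 1) δ) (A := Block p n β)
    (B := (Block.ofSucc p h : GrHom (Block.deg p n β) (Block.deg p (n + 1) δ)).leftIdeal)
    (f.comp ((Block.incl p (n + 1) δ : Block p (n + 1) δ →+ Alg p (n + 1)).comp
      (Submodule.subtype _).toAddMonoidHom)) (fun b a x => by
        change f (Block.incl p (n + 1) δ b.1 * (Alg.emb p n (Block.incl p n β a) *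
          Alg.eLast p n j)) x = f (Block.incl p (n + 1) δ b.1) (a • x)
        rw [← mul_assoc, hl, hf, Block.proj_incl])
  refine ⟨g, fun z x => (hg _ _).trans ?_⟩
  change f (Block.incl p (n + 1) δ (Block.toIdeal p h z).1) x = _
  rw [Block.incl_toIdeal, ← mul_assoc, hl, hf, Block.proj_eBeta, one_smul]

end Ind
end Induced

/-- A biadditive map. -/
def biadd {A N P : Type*} [AddCommGroup A] [AddCommGroup N] [AddCommGroup P] (f : A → N → P)
    (h₁ : ∀ a a' x, f (a + a') x = f a x + f a' x) (h₂ : ∀ a x x', f a (x + x') = f a x + f a x') :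
    A →+ N →+ P :=
  AddMonoidHom.mk' (fun a => AddMonoidHom.mk' (f a) (h₂ a))
    fun a a' => AddMonoidHom.ext fun x => h₁ a a' x

namespace GrHom

variable {A S : Type u} [Ring A] [Ring S] {𝒜 : ℤ → AddSubgroup A} {𝒮 : ℤ → AddSubgroup S}
  (φ : GrHom 𝒜 𝒮) {M : Type*} [AddCommGroup M] [Module S M]

variable (M) in
/-- The projection `M → ε M`, for `ε = φ(1)`. -/
def toCut : M →+ φ.cut M :=
  AddMonoidHom.mk' (fun m => ⟨φ.idem • m, by
    change φ.idem • φ.idem • m = _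
    rw [smul_smul, idem_mul_idem]⟩) fun a b => Subtype.ext (smul_add _ _ _)

theorem coe_toCut (m : M) : (φ.toCut M m : M) = φ.idem • m := rfl

theorem toCut_coe (m : φ.cut M) : φ.toCut M m = m := Subtype.ext m.2

theorem coe_smul (a : A) (m : φ.cut M) :
    ((a • m : φ.cut M) : M) = φ.toNonUnitalRingHom a • (m : M) := rfl

end GrHom

/-! ### The maps between F_j E_i N and E_i F_j N. -/

section Maps

variable {k I : Type u} [CommRing k] [Fintype I] {C : BorcherdsCartan I} {𝓀 : ℤ → AddSubgroup k}
  (p : Params C 𝓀) {n m : ℕ} {β γ δ ε : I →₀ ℕ} {i j : I}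

namespace Block

theorem ofSucc_proj (h : δ = β + root i) (a : Alg p n) :
    (ofSucc p h).toNonUnitalRingHom (proj p n β a) =
      proj p (n + 1) δ (Alg.emb p n a * Alg.eLast p n i) :=
  Subtype.ext (by
    change Alg.emb p n (Alg.eBeta p n β * a) * Alg.eLast p n i =
      Alg.eBeta p (n + 1) δ * (Alg.emb p n a * Alg.eLast p n i)
    rw [← mul_assoc, Alg.eBeta_central p δ, mul_assoc, eBeta_mul_eLast p h, ← mul_assoc,
      ← map_mul, Alg.eBeta_central])

theorem idem_eq_proj (h : δ = β + root i) :
    (ofSucc p h : GrHom (deg p n β) _).idem = proj p (n + 1) δ (Alg.eLast p n i) := by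
  rw [GrHom.idem, ← map_one (proj p n β), ofSucc_proj, map_one, one_mul]

theorem eLast_smul_cut (h : δ = β + root i) {M : Type*} [AddCommGroup M]
    [Module (Block p (n + 1) δ) M] (x : (ofSucc p h : GrHom (deg p n β) _).cut M) :
    proj p (n + 1) δ (Alg.eLast p n i) • (x : M) = x := by
  rw [← idem_eq_proj p h]
  exact x.2

theorem eLast_smul_toCut (h : δ = β + root i) {M : Type*} [AddCommGroup M]
    [Module (Block p (n + 1) δ) M] (a : Alg p n) (x : M) :
    proj p n β a • (ofSucc p h : GrHom (deg p n β) _).toCut M x =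
      (ofSucc p h : GrHom (deg p n β) _).toCut M (proj p (n + 1) δ (Alg.emb p n a) • x) :=
  Subtype.ext (by
    rw [GrHom.coe_smul, GrHom.coe_toCut, GrHom.coe_toCut, ofSucc_proj, idem_eq_proj, smul_smul,
      smul_smul, ← map_mul, ← map_mul, mul_assoc, (Alg.eLast_idem p i).eq, Alg.eLast_comm])

end Block

namespace Ind

section

variable (h : δ = β + root j) {N : Type*} [AddCommGroup N] [Module (Block p n β) N]

noncomputable instance : AddCommGroup (Ind p n h N) := inferInstance

noncomputable instance : AddZeroClass (Ind p n h N) := inferInstance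

noncomputable instance : AddCommMonoid (Ind p n h N) := inferInstance

noncomputable instance : Module (Block p (n + 1) δ) (Ind p n h N) := inferInstance

theorem mk_zero (x : N) : mk p h (0 : Alg p (n + 1)) x = 0 := by
  rw [← mkHom_apply, map_zero, AddMonoidHom.zero_apply]

theorem mk_add (y z : Alg p (n + 1)) (x : N) : mk p h (y + z) x = mk p h y x + mk p h z x := by
  rw [← mkHom_apply, map_add]
  rfl

theorem mk_sub (y z : Alg p (n + 1)) (x : N) : mk p h (y - z) x = mk p h y x - mk p h z x := by
  rw [← mkHom_apply, map_sub]
  rfl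

theorem add_mk (z : Alg p (n + 1)) (x y : N) : mk p h z (x + y) = mk p h z x + mk p h z y :=
  map_add (mkHom p h z) x y

theorem mk_mul_eLast (z : Alg p (n + 1)) (x : N) :
    mk p h (z * Alg.eLast p n j) x = mk p h z x := by
  rw [mk, Block.toIdeal_mul_eLast, mk]

theorem mk_mul_eLast_ne (hij : i ≠ j) (z : Alg p (n + 1)) (x : N) :
    mk p h (z * Alg.eLast p n i) x = 0 := by
  rw [mk, Block.toIdeal_mul_eLast_ne p h hij, ← Block.toIdeal_mul_eLast_ne p h hij 0, zero_mul]
  exact mk_zero p h x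

theorem mk_eBeta_mul (z : Alg p (n + 1)) (x : N) :
    mk p h (Alg.eBeta p (n + 1) δ * z) x = mk p h z x := by
  have : Block.toIdeal p h (Alg.eBeta p (n + 1) δ * z) = Block.toIdeal p h z := by
    have h1 := Block.smul_toIdeal p h 1 z
    rw [one_smul] at h1
    exact h1.symm
  rw [mk, this, mk]

/-- The action of `e(γ, i)`. -/
theorem idem_smul_mk (h' : δ = γ + root i) (z : Alg p (n + 1)) (x : N) :
    (Block.ofSucc p h' : GrHom (Block.deg p n γ) _).idem • mk p h z x =
      mk p h (Alg.eLast p n i * z) x := by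
  rw [smul_mk, Block.incl_idem, ← Block.eBeta_mul_eLast p h', mul_assoc, mk_eBeta_mul]

theorem idem_smul_mk_of_mem {z : Alg p (n + 1)} (hz : z ∈ parabolic p n) (x : N) :
    (Block.ofSucc p h : GrHom (Block.deg p n β) _).idem • mk p h z x = mk p h z x := by
  rw [idem_smul_mk, Alg.eLast_mul_of_mem_parabolic p j hz, mk_mul_eLast]

/-- Through the centrality of e(n,i) in R(n,1), the two orthogonal idempotents e(n,i) and e(n,j)
meet. -/
theorem idem_smul_mk_of_mem_ne (h' : δ = γ + root i) (hij : i ≠ j) {z : Alg p (n + 1)}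
    (hz : z ∈ parabolic p n) (x : N) :
    (Block.ofSucc p h' : GrHom (Block.deg p n γ) _).idem • mk p h z x = 0 := by
  rw [idem_smul_mk, Alg.eLast_mul_of_mem_parabolic p i hz, mk_mul_eLast_ne p h hij]

end

section Cross

variable (hβ : β = ε + root i) (hγ : γ = ε + root j) (hj : δ = β + root j) (hi : δ = γ + root i)
  (N : Type*) [AddCommGroup N] [Module (Block p (m + 1) β) N]

/-- The module underlying `E_i N`. -/
abbrev Res (p : Params C 𝓀) (m : ℕ) (hβ : β = ε + root i) (N : Type*) [AddCommGroup N]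
    [Module (Block p (m + 1) β) N] : Type _ :=
  (Block.ofSucc p hβ : GrHom (Block.deg p m ε) (Block.deg p (m + 1) β)).cut N

variable {N} in
theorem mk_mul_eLast_cut (z : Alg p (m + 2)) (x : Res p m hβ N) :
    mk p hj (z * Alg.emb p _ (Alg.eLast p m i)) (x : N) = mk p hj z (x : N) := by
  rw [mk_mul, Block.eLast_smul_cut]

/-- Well defined because τ commutes with R(m), e(m,j) τ = τ e(m+1,j) is absorbed by F_j, and
elements of E_i N already satisfy e(m,i) x = x. -/
theorem exists_cross : ∃ c : Ind p m hγ (Res p m hβ N) →+ Ind p (m + 1) hj N,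
    ∀ z x, c (mk p hγ z x) = mk p hj (Alg.emb p _ z * Alg.tl p m) (x : N) := by
  refine lift_exists p hγ
    (biadd (fun z (x : Res p m hβ N) => mk p hj (Alg.emb p _ z * Alg.tl p m) (x : N))
      (fun z z' x => by rw [map_add, add_mul, mk_add])
      (fun z x x' => by rw [AddSubgroup.coe_add, add_mk])) ?_ ?_
  · intro z a x
    change mk p hj (Alg.emb p _ (z * _) * Alg.tl p m) (x : N) =
      mk p hj (Alg.emb p _ z * Alg.tl p m) _
    rw [GrHom.coe_smul, Block.ofSucc_proj, ← mk_mul, map_mul, map_mul, ← mul_assoc,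
      mk_mul_eLast_cut, mul_assoc, mul_assoc, Alg.tl_emb_emb]
  · intro z x
    change mk p hj (Alg.emb p _ (z * _) * Alg.tl p m) (x : N) =
      mk p hj (Alg.emb p _ z * Alg.tl p m) _
    rw [map_mul, mul_assoc, ← Alg.tl_eLast, ← mul_assoc, mk_mul_eLast]

/-- The map `z ⊗ x ↦ z τ ⊗ x`. -/
noncomputable def crossAdd : Ind p m hγ (Res p m hβ N) →+ Ind p (m + 1) hj N :=
  (exists_cross p hβ hγ hj N).choose

variable {N} in
theorem crossAdd_mk (z : Alg p (m + 1)) (x : Res p m hβ N) :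
    crossAdd p hβ hγ hj N (mk p hγ z x) = mk p hj (Alg.emb p _ z * Alg.tl p m) (x : N) :=
  (exists_cross p hβ hγ hj N).choose_spec z x

variable {N} in
theorem crossAdd_smul (u : Block p (m + 1) γ) (t : Ind p m hγ (Res p m hβ N)) :
    crossAdd p hβ hγ hj N (u • t) =
      (Block.ofSucc p hi).toNonUnitalRingHom u • crossAdd p hβ hγ hj N t := by
  induction t using induction p hγ with
  | zero => rw [smul_zero, map_zero, smul_zero]
  | add s t hs ht => rw [smul_add, map_add, hs, ht, map_add, smul_add]
  | mk z x =>
    rw [smul_mk, crossAdd_mk, crossAdd_mk, smul_mk, Block.incl_ofSucc, mul_assoc,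
      ← mul_assoc (Alg.eLast p _ i), Alg.eLast_comm, mul_assoc (Alg.emb p _ z), Alg.eLast_tl,
      ← mul_assoc (Alg.emb p _ z), ← mul_assoc, mk_mul_eLast_cut, map_mul, mul_assoc]

/-- The map `F_j E_i N → E_i F_j N`, `z ⊗ x ↦ z τ ⊗ x`. -/
noncomputable def cross : Ind p m hγ (Res p m hβ N) →ₗ[Block p (m + 1) γ]
    (Block.ofSucc p hi : GrHom (Block.deg p (m + 1) γ) _).cut (Ind p (m + 1) hj N) where
  toFun t := ⟨crossAdd p hβ hγ hj N t, by
    change (Block.ofSucc p hi).toNonUnitalRingHom 1 • _ = _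
    rw [← crossAdd_smul, one_smul]⟩
  map_add' _ _ := Subtype.ext (map_add _ _ _)
  map_smul' u t := Subtype.ext (crossAdd_smul p hβ hγ hj hi u t)

/-- The biadditive map `(x, y) ↦ (v ↦ x ⊗ y v)`. -/
noncomputable def sandwich : Alg p (m + 1) →+ Alg p (m + 1) →+ N →+ Ind p m hγ (Res p m hβ N) :=
  biadd (fun x y => AddMonoidHom.mk'
      (fun v => mk p hγ x ((Block.ofSucc p hβ).toCut N (Block.proj p (m + 1) β y • v)))
      (fun v v' => by rw [smul_add, map_add, add_mk]))
    (fun x x' y => by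
      ext v
      exact mk_add p hγ x x' _)
    (fun x y y' => by
      ext v
      change mk p hγ x ((Block.ofSucc p hβ).toCut N (Block.proj p (m + 1) β (y + y') • v)) = _
      rw [map_add, add_smul, map_add, add_mk]
      rfl)

variable {N} in
theorem sandwich_apply (x y : Alg p (m + 1)) (v : N) : sandwich p hβ hγ N x y v =
    mk p hγ x ((Block.ofSucc p hβ).toCut N (Block.proj p (m + 1) β y • v)) := rfl

/-- An element of R(m) commutes with e(m,i), so it may act on N before or after the projection to
E_i N. -/
theorem exists_split : ∃ G : SelfTensor p m →+ N →+ Ind p m hγ (Res p m hβ N),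
    ∀ x y, G (SelfTensor.tmul x y) = sandwich p hβ hγ N x y := by
  refine SelfTensor.lift_exists (sandwich p hβ hγ N) fun x a y => ?_
  ext v
  rw [sandwich_apply, sandwich_apply, mk_mul, Block.eLast_smul_toCut, smul_smul, map_mul]

/-- The map `(x ⊗ y, v) ↦ x ⊗ y v`. -/
noncomputable def split : SelfTensor p m →+ N →+ Ind p m hγ (Res p m hβ N) :=
  (exists_split p hβ hγ N).choose

variable {N} in
theorem split_tmul (x y : Alg p (m + 1)) (v : N) : split p hβ hγ N (SelfTensor.tmul x y) v =
    mk p hγ x ((Block.ofSucc p hβ).toCut N (Block.proj p (m + 1) β y • v)) := by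
  rw [split, (exists_split p hβ hγ N).choose_spec, sandwich_apply]

variable {N} in
theorem split_mulRight (s : SelfTensor p m) (a : Alg p (m + 1)) (v : N) :
    split p hβ hγ N (s.mulRight a) v = split p hβ hγ N s (Block.proj p (m + 1) β a • v) := by
  induction s using SelfTensor.induction with
  | zero => rw [SelfTensor.mulRight_zero, map_zero, AddMonoidHom.zero_apply,
      AddMonoidHom.zero_apply]
  | add s t hs ht => rw [SelfTensor.mulRight_add, map_add, map_add, AddMonoidHom.add_apply,
      AddMonoidHom.add_apply, hs, ht]
  | tmul x y => rw [SelfTensor.mulRight_tmul, split_tmul, split_tmul, map_mul, smul_smul]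

/-- The map `(z, v) ↦ s v`, where `s` is the first component of `z`. -/
noncomputable def uncrossHom : Alg p (m + 2) →+ N →+ Ind p m hγ (Res p m hβ N) :=
  (split p hβ hγ N).comp ((AddMonoidHom.fst _ _).comp (Alg.mackeyEquiv p m).symm.toAddMonoidHom)

variable {N} in
theorem uncrossHom_apply (z : Alg p (m + 2)) (v : N) :
    uncrossHom p hβ hγ N z v = split p hβ hγ N ((Alg.mackeyEquiv p m).symm z).1 v := rfl

variable {N} in
theorem uncrossHom_cross (x y : Alg p (m + 1)) (v : N) :
    uncrossHom p hβ hγ N (Alg.emb p _ x * Alg.tl p m * Alg.emb p _ y) v =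
    mk p hγ x ((Block.ofSucc p hβ).toCut N (Block.proj p (m + 1) β y • v)) := by
  rw [uncrossHom_apply, Alg.mackeyEquiv_symm_cross, split_tmul]

variable {N} in
theorem uncrossHom_of_mem {z : Alg p (m + 2)} (hz : z ∈ parabolic p (m + 1)) (v : N) :
    uncrossHom p hβ hγ N z v = 0 := by
  rw [uncrossHom_apply, Alg.mackeyEquiv_symm_of_mem p hz, map_zero, AddMonoidHom.zero_apply]

variable {N} in
theorem uncrossHom_add (y z : Alg p (m + 2)) (v : N) :
    uncrossHom p hβ hγ N (y + z) v = uncrossHom p hβ hγ N y v + uncrossHom p hβ hγ N z v :=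
  congrArg (fun f : N →+ Ind p m hγ (Res p m hβ N) => f v) (map_add (uncrossHom p hβ hγ N) y z)

variable {N} in
theorem uncrossHom_add_of_mem (y : Alg p (m + 2)) {z : Alg p (m + 2)}
    (hz : z ∈ parabolic p (m + 1)) (v : N) :
    uncrossHom p hβ hγ N (y + z) v = uncrossHom p hβ hγ N y v := by
  rw [uncrossHom_add, uncrossHom_of_mem p hβ hγ hz, add_zero]

variable {N} in
theorem uncrossHom_mul (z : Alg p (m + 2)) (a : Alg p (m + 1)) (v : N) :
    uncrossHom p hβ hγ N (z * Alg.emb p _ a) v =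
      uncrossHom p hβ hγ N z (Block.proj p (m + 1) β a • v) := by
  rw [uncrossHom_apply, Alg.mackeyEquiv_symm_mul, split_mulRight, uncrossHom_apply]

variable {N} in
theorem uncrossHom_cross_mul_eLast (x y : Alg p (m + 1)) (v : N) :
    uncrossHom p hβ hγ N (Alg.emb p _ x * Alg.tl p m * Alg.emb p _ y * Alg.eLast p _ j) v =
      uncrossHom p hβ hγ N (Alg.emb p _ x * Alg.tl p m * Alg.emb p _ y) v := by
  have h : Alg.emb p _ x * Alg.tl p m * Alg.emb p _ y * Alg.eLast p _ j =
      Alg.emb p _ (x * Alg.eLast p m j) * Alg.tl p m * Alg.emb p _ y := by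
    rw [mul_assoc, ← Alg.eLast_comm, ← mul_assoc, mul_assoc (Alg.emb p _ x),
      Alg.tl_eLast, ← mul_assoc (Alg.emb p _ x), ← map_mul]
  rw [h, uncrossHom_cross, uncrossHom_cross, mk_mul_eLast]

variable {N} in
theorem uncrossHom_mackeyHom_mul_eLast (s : SelfTensor p m) (v : N) :
    uncrossHom p hβ hγ N (Alg.mackeyHom p m s * Alg.eLast p _ j) v =
      uncrossHom p hβ hγ N (Alg.mackeyHom p m s) v := by
  induction s using SelfTensor.induction with
  | zero => rw [map_zero, zero_mul]
  | add s t hs ht => rw [map_add, add_mul, uncrossHom_add, uncrossHom_add, hs, ht]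
  | tmul x y => rw [Alg.mackeyHom_tmul, uncrossHom_cross_mul_eLast]

variable {N} in
-- Right multiplication by e(m+1,j) respects both summands of R(m+2): it preserves the parabolic one
-- and turns x τ y into x e(m,j) τ y, where e(m,j) is absorbed by F_j.
theorem uncrossHom_mul_eLast (z : Alg p (m + 2)) (v : N) :
    uncrossHom p hβ hγ N (z * Alg.eLast p _ j) v = uncrossHom p hβ hγ N z v := by
  have key : ∀ s : SelfTensor p m, ∀ w ∈ parabolic p (m + 1),
      uncrossHom p hβ hγ N ((Alg.mackeyHom p m s + w) * Alg.eLast p _ j) v =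
        uncrossHom p hβ hγ N (Alg.mackeyHom p m s + w) v := by
    intro s w hw
    have hw' := mul_mem hw (Alg.eLast_mem_parabolic p j)
    rw [add_mul, uncrossHom_add_of_mem p hβ hγ _ hw, uncrossHom_add_of_mem p hβ hγ _ hw',
      uncrossHom_mackeyHom_mul_eLast]
  have h := key ((Alg.mackeyEquiv p m).symm z).1 _ (Alg.parProj_mem p z)
  rwa [Alg.mackeyHom_add_parProj] at h

theorem exists_uncross : ∃ c : Ind p (m + 1) hj N →+ Ind p m hγ (Res p m hβ N),
    ∀ z v, c (mk p hj z v) = uncrossHom p hβ hγ N z v :=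
  lift_exists p hj (uncrossHom p hβ hγ N) (uncrossHom_mul p hβ hγ) (uncrossHom_mul_eLast p hβ hγ)

/-- The map `z ⊗ v ↦ s v`, where `s` is the first component of `z`. -/
noncomputable def uncross : Ind p (m + 1) hj N →+ Ind p m hγ (Res p m hβ N) :=
  (exists_uncross p hβ hγ hj N).choose

variable {N}

theorem uncross_mk (z : Alg p (m + 2)) (v : N) :
    uncross p hβ hγ hj N (mk p hj z v) = uncrossHom p hβ hγ N z v :=
  (exists_uncross p hβ hγ hj N).choose_spec z v

theorem uncross_cross (t : Ind p m hγ (Res p m hβ N)) :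
    uncross p hβ hγ hj N (crossAdd p hβ hγ hj N t) = t := by
  induction t using induction p hγ with
  | zero => rw [map_zero, map_zero]
  | add s t hs ht => rw [map_add, map_add, hs, ht]
  | mk z x =>
    rw [crossAdd_mk, uncross_mk, ← mul_one (_ * _), ← map_one (Alg.emb p (m + 1)),
      uncrossHom_cross, map_one, one_smul, GrHom.toCut_coe]

/-- The projection of y v to E_i N inserts e(m,i) before y; moved through τ and then past x, it
becomes e(m+1,i) on the far left, the projection defining E_i. -/
theorem cross_split_tmul (x y : Alg p (m + 1)) (v : N) :
    crossAdd p hβ hγ hj N (split p hβ hγ N (SelfTensor.tmul x y) v) =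
      mk p hj (Alg.eLast p _ i * (Alg.emb p _ x * Alg.tl p m * Alg.emb p _ y)) v := by
  have h : Alg.eLast p _ i * (Alg.emb p _ x * Alg.tl p m * Alg.emb p _ y) =
      Alg.emb p _ x * Alg.tl p m * Alg.emb p _ (Alg.eLast p m i * y) := by
    rw [map_mul, ← mul_assoc, ← mul_assoc, ← mul_assoc, Alg.eLast_comm,
      mul_assoc (Alg.emb p _ x), Alg.eLast_tl, ← mul_assoc (Alg.emb p _ x)]
  have h' : (((Block.ofSucc p hβ).toCut N (Block.proj p (m + 1) β y • v) : Res p m hβ N) : N) =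
      Block.proj p (m + 1) β (Alg.eLast p m i * y) • v := by
    rw [GrHom.coe_toCut, Block.idem_eq_proj, smul_smul, map_mul]
  rw [split_tmul, crossAdd_mk, h', h, mk_mul]

theorem cross_split (s : SelfTensor p m) (v : N) :
    crossAdd p hβ hγ hj N (split p hβ hγ N s v) =
      mk p hj (Alg.eLast p _ i * Alg.mackeyHom p m s) v := by
  induction s using SelfTensor.induction with
  | zero => rw [map_zero, map_zero, AddMonoidHom.zero_apply, map_zero, mul_zero, mk_zero]
  | add s t hs ht =>
    rw [map_add, map_add, AddMonoidHom.add_apply, map_add, hs, ht, mul_add, mk_add]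
  | tmul x y => rw [cross_split_tmul, Alg.mackeyHom_tmul]

/-- Going there and back forgets exactly the parabolic component and projects with e(γ, i). For i ≠
j that component is zero after projection; for i = j it is what N ⊗ k[t] has to supply. -/
theorem cross_uncross (z : Alg p (m + 2)) (v : N) :
    crossAdd p hβ hγ hj N (uncross p hβ hγ hj N (mk p hj z v)) =
      (Block.ofSucc p hi : GrHom (Block.deg p (m + 1) γ) _).idem •
        (mk p hj z v - mk p hj (Alg.parProj p (m + 1) z) v) := by
  rw [uncross_mk, uncrossHom_apply, cross_split, ← mk_sub, idem_smul_mk,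
    eq_sub_of_add_eq (Alg.mackeyHom_add_parProj p z)]

end Cross

end Ind

end Maps

/-! ### The summand N ⊗ k[t]. -/

section PolyMap

variable {k I : Type u} [CommRing k] [Fintype I] {C : BorcherdsCartan I} {𝓀 : ℤ → AddSubgroup k}
  (p : Params C 𝓀) {n m : ℕ} {β γ δ ε : I →₀ ℕ} {i j : I}

namespace Alg

open Polynomial in
theorem aeval_xl_mem_parabolic (q : k[X]) : aeval (xl p n) q ∈ parabolic p n :=
  (Algebra.adjoin_le (S := parabolic p n) (by rintro _ rfl; exact xl_mem_parabolic p))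
    (aeval_mem_adjoin_singleton k (xl p n))

open Polynomial in
theorem aeval_xl_emb (q : k[X]) (y : Alg p n) :
    aeval (xl p n) q * emb p n y = emb p n y * aeval (xl p n) q := by
  have h : Algebra.adjoin k {xl p n} ≤ Subalgebra.centralizer k {emb p n y} :=
    Algebra.adjoin_le (by rintro _ rfl _ rfl; exact (xl_emb p y).symm)
  exact (h (aeval_mem_adjoin_singleton k (xl p n)) _ rfl).symm

theorem cross_mul_eLast (x y : Alg p (m + 1)) :
    emb p _ x * tl p m * emb p _ y * eLast p _ j =
      emb p _ (x * eLast p m j) * tl p m * emb p _ y := by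
  rw [mul_assoc, ← eLast_comm, ← mul_assoc, mul_assoc (emb p _ x), tl_eLast,
    ← mul_assoc (emb p _ x), ← map_mul]

theorem parProj_mackeyHom_mul_eLast (s : SelfTensor p m) :
    parProj p (m + 1) (mackeyHom p m s * eLast p _ j) = 0 := by
  induction s using SelfTensor.induction with
  | zero => rw [map_zero, zero_mul, map_zero]
  | add s t hs ht => rw [map_add, add_mul, map_add, hs, ht, add_zero]
  | tmul x y => rw [mackeyHom_tmul, cross_mul_eLast, parProj_cross]

/-- Both summands are stable under right multiplication by e(n,j), although e(n,j) is not in R(n).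
-/
theorem parProj_mul_eLast (z : Alg p (n + 1)) (j : I) :
    parProj p n (z * eLast p n j) = parProj p n z * eLast p n j := by
  cases n with
  | zero => rfl
  | succ m =>
    have h := congrArg (fun z => parProj p (m + 1) (z * eLast p _ j)) (mackeyHom_add_parProj p z)
    rw [← h, add_mul, map_add, parProj_mackeyHom_mul_eLast, zero_add,
      parProj_of_mem p (mul_mem (parProj_mem p z) (eLast_mem_parabolic p j))]

theorem parCoef_mul_eLast {w : Alg p (n + 1)} (hw : w ∈ parabolic p n) (i : I) :
    parCoef p n i (w * eLast p n i) = parCoef p n i w := by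
  have hw' := parabolic_le_bas p hw
  clear hw
  induction hw' using AddSubgroup.closure_induction with
  | zero => rw [zero_mul]
  | add x y _ _ hx hy => rw [add_mul, map_add, map_add, hx, hy]
  | neg x _ hx => rw [neg_mul, map_neg, map_neg, hx]
  | mem z hz =>
    obtain ⟨r, j, y, rfl⟩ := hz
    rw [mul_assoc, ← eLast_comm, ← mul_assoc]
    by_cases h : j = i
    · subst h
      rw [bas, mul_assoc (cyc p n n * xl p n ^ r), (eLast_idem p j).eq]
    · rw [parCoef_bas_ne p h, bas, mul_assoc (cyc p n n * xl p n ^ r), eLast_mul_ne p h, mul_zero, zero_mul,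
        map_zero]

end Alg

namespace Ind

open Polynomial

variable (h : δ = β + root i) (N : Type*) [AddCommGroup N] [Module (Block p n β) N]

/-- The indeterminate acts as x_n, and scalars of k balance since they come from R(n). -/
theorem exists_poly : ∃ c : PolyTensor k (Block p n β) N →+ Ind p n h N,
    ∀ x q, c (PolyTensor.tmul k (Block p n β) x q) = mk p h (aeval (Alg.xl p n) q) x := by
  refine PolyTensor.lift_exists k (Block p n β)
    (biadd (fun x q => mk p h (aeval (Alg.xl p n) q) x)
      (fun x x' q => add_mk p h _ x x') (fun x q q' => by rw [map_add, mk_add])) fun x c q => ?_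
  change mk p h (aeval (Alg.xl p n) q) _ = mk p h (aeval (Alg.xl p n) (c • q)) x
  rw [← Block.proj_algebraMap, ← mk_mul, AlgHom.commutes, map_smul, Algebra.smul_def,
    Algebra.commutes]

/-- The map `x ⊗ t ^ r ↦ x_n ^ r ⊗ x`. -/
noncomputable def polyAdd : PolyTensor k (Block p n β) N →+ Ind p n h N :=
  (exists_poly p h N).choose

variable {N}

theorem polyAdd_tmul (x : N) (q : k[X]) :
    polyAdd p h N (PolyTensor.tmul k (Block p n β) x q) = mk p h (aeval (Alg.xl p n) q) x :=
  (exists_poly p h N).choose_spec x q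

theorem polyAdd_smul (u : Block p n β) (t : PolyTensor k (Block p n β) N) :
    polyAdd p h N (u • t) = (Block.ofSucc p h).toNonUnitalRingHom u • polyAdd p h N t := by
  induction t using TensorProduct.induction_on with
  | zero =>
    refine Eq.trans (congrArg (polyAdd p h N) (TensorProduct.smul_zero u)) ?_
    rw [map_zero, smul_zero]
  | add s t hs ht =>
    refine Eq.trans (congrArg (polyAdd p h N) (TensorProduct.smul_add u s t)) ?_
    rw [map_add, hs, ht, map_add, smul_add]
  | tmul x q =>
    change polyAdd p h N (PolyTensor.tmul k (Block p n β) (u • (show N from x)) q) =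
      _ • polyAdd p h N (PolyTensor.tmul k (Block p n β) (show N from x) q)
    rw [polyAdd_tmul, polyAdd_tmul, smul_mk, Block.incl_ofSucc, mul_assoc,
      Alg.eLast_mul_of_mem_parabolic p i (Alg.aeval_xl_mem_parabolic p q), ← mul_assoc,
      mk_mul_eLast, ← Alg.aeval_xl_emb, mk_mul, Block.proj_incl]

/-- The map `N ⊗ k[t] → E_i F_i N`, `x ⊗ t ^ r ↦ x_n ^ r ⊗ x`. -/
noncomputable def poly : PolyTensor k (Block p n β) N →ₗ[Block p n β]
    (Block.ofSucc p h : GrHom (Block.deg p n β) _).cut (Ind p n h N) where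
  toFun t := ⟨polyAdd p h N t, by
    change (Block.ofSucc p h).toNonUnitalRingHom 1 • _ = _
    rw [← polyAdd_smul, one_smul]⟩
  map_add' _ _ := Subtype.ext (map_add _ _ _)
  map_smul' u t := Subtype.ext (polyAdd_smul p h u t)

variable (n β N) in
/-- The map `((y_r), x) ↦ ∑ y_r x ⊗ t ^ r`. -/
noncomputable def coefSum : (ℕ →₀ Alg p n) →+ N →+ PolyTensor k (Block p n β) N :=
  Finsupp.liftAddHom fun r => biadd
    (fun y x => PolyTensor.tmul k (Block p n β) (Block.proj p n β y • x) (X ^ r))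
    (fun y y' x => by
      rw [map_add, add_smul]
      exact congrArg (fun f : k[X] →+ _ => f (X ^ r)) (map_add (PolyTensor.mkHom k _) _ _))
    (fun y x x' => by
      rw [smul_add]
      exact congrArg (fun f : k[X] →+ _ => f (X ^ r)) (map_add (PolyTensor.mkHom k _) _ _))

theorem coefSum_single (r : ℕ) (y : Alg p n) (x : N) :
    coefSum p n β N (Finsupp.single r y) x =
      PolyTensor.tmul k (Block p n β) (Block.proj p n β y • x) (X ^ r) := by
  rw [coefSum, Finsupp.liftAddHom_apply_single]
  rfl

theorem coefSum_add (c d : ℕ →₀ Alg p n) (x : N) :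
    coefSum p n β N (c + d) x = coefSum p n β N c x + coefSum p n β N d x := by
  rw [map_add]
  rfl

theorem coefSum_zero (x : N) : coefSum p n β N (0 : ℕ →₀ Alg p n) x = 0 := by
  rw [map_zero]
  rfl

theorem coefSum_mul (c : ℕ →₀ Alg p n) (a : Alg p n) (x : N) :
    coefSum p n β N (c.mapRange (· * a) (zero_mul a)) x =
      coefSum p n β N c (Block.proj p n β a • x) := by
  induction c using Finsupp.induction_linear with
  | zero => rw [Finsupp.mapRange_zero, coefSum_zero, coefSum_zero]
  | add c d hc hd =>
    rw [Finsupp.mapRange_add (fun _ _ => add_mul _ _ _), coefSum_add, coefSum_add, hc, hd]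
  | single r y => rw [Finsupp.mapRange_single, coefSum_single, coefSum_single, map_mul, smul_smul]

theorem polyAdd_coefSum (c : ℕ →₀ Alg p n) (x : N) :
    polyAdd p h N (coefSum p n β N c x) =
      mk p h (c.sum fun r y => Alg.xl p n ^ r * Alg.emb p n y) x := by
  induction c using Finsupp.induction_linear with
  | zero => rw [coefSum_zero, map_zero, Finsupp.sum_zero_index, mk_zero]
  | add c d hc hd =>
    rw [coefSum_add, map_add, hc, hd, ← mk_add,
      Finsupp.sum_add_index' (fun _ => by rw [map_zero, mul_zero])
        (fun _ _ _ => by rw [map_add, mul_add])]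
  | single r y =>
    rw [coefSum_single, polyAdd_tmul, ← mk_mul, map_pow, aeval_X,
      Finsupp.sum_single_index (by rw [map_zero, mul_zero])]

variable (N) in
theorem exists_coef : ∃ c : Ind p n h N →+ PolyTensor k (Block p n β) N,
    ∀ z x, c (mk p h z x) = coefSum p n β N (Alg.parCoef p n i (Alg.parProj p n z)) x := by
  refine lift_exists p h
    ((coefSum p n β N).comp ((Alg.parCoef p n i).comp (Alg.parProj p n))) ?_ ?_
  · intro z a x
    change coefSum p n β N (Alg.parCoef p n i (Alg.parProj p n (z * _))) x =
      coefSum p n β N (Alg.parCoef p n i (Alg.parProj p n z)) _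
    rw [Alg.parProj_mul, Alg.parCoef_mul, coefSum_mul]
  · intro z x
    change coefSum p n β N (Alg.parCoef p n i (Alg.parProj p n (z * _))) x =
      coefSum p n β N (Alg.parCoef p n i (Alg.parProj p n z)) _
    rw [Alg.parProj_mul_eLast, Alg.parCoef_mul_eLast p (Alg.parProj_mem p z)]

variable (N) in
/-- The map `z ⊗ v ↦ ∑ y_r v ⊗ t ^ r`, where `∑ x_n ^ r y_r` is the second component of `z`. -/
noncomputable def coef : Ind p n h N →+ PolyTensor k (Block p n β) N := (exists_coef p h N).choose

theorem coef_mk (z : Alg p (n + 1)) (x : N) : coef p h N (mk p h z x) =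
    coefSum p n β N (Alg.parCoef p n i (Alg.parProj p n z)) x :=
  (exists_coef p h N).choose_spec z x

/-- Only the e(n,i)-component of the parabolic part of z matters in F_i N, and its coordinates
recover it. -/
theorem polyAdd_coef (z : Alg p (n + 1)) (x : N) :
    polyAdd p h N (coef p h N (mk p h z x)) = mk p h (Alg.parProj p n z) x := by
  rw [coef_mk, polyAdd_coefSum, ← mk_mul_eLast, Alg.sum_parCoef p i (Alg.parProj_mem p z),
    mk_mul_eLast]

theorem parCoef_monomial (r : ℕ) (c : k) :
    Alg.parCoef p n i (aeval (Alg.xl p n) (monomial r c)) =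
      Finsupp.single r (algebraMap k (Alg p n) c) := by
  have h1 : aeval (Alg.xl p n) (monomial r c) =
      Alg.xl p n ^ r * Alg.emb p n (algebraMap k (Alg p n) c) := by
    rw [aeval_monomial, AlgHom.commutes, Algebra.commutes]
  have h2 : aeval (Alg.xl p n) (monomial r c) * Alg.eLast p n i =
      Alg.bas p n n r i * Alg.emb p n (algebraMap k (Alg p n) c) := by
    rw [h1, Alg.bas, Alg.cyc_last, one_mul, mul_assoc, mul_assoc, Alg.eLast_comm]
  rw [← Alg.parCoef_mul_eLast p (Alg.aeval_xl_mem_parabolic p _), h2, Alg.parCoef_bas]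

/-- By additivity t^r suffices, and x_n^r e(n,i) is a basis element over R(n). Here the freeness of
R(n,1) enters. -/
theorem coef_poly (t : PolyTensor k (Block p n β) N) : coef p h N (polyAdd p h N t) = t := by
  induction t using TensorProduct.induction_on with
  | zero => rw [map_zero, map_zero]
  | add s t hs ht => rw [map_add, map_add, hs, ht]
  | tmul x q =>
    change coef p h N (polyAdd p h N (PolyTensor.tmul k (Block p n β) (show N from x) q)) =
      PolyTensor.mkHom k (Block p n β) (show N from x) q
    generalize (show N from x) = x
    induction q using Polynomial.induction_on' with
    | add q q' hq hq' =>
      rw [map_add, ← hq, ← hq', polyAdd_tmul, polyAdd_tmul, polyAdd_tmul, map_add, mk_add, map_add]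
    | monomial r c =>
      rw [polyAdd_tmul, coef_mk, Alg.parProj_of_mem p (Alg.aeval_xl_mem_parabolic p _),
        parCoef_monomial, coefSum_single, Block.proj_algebraMap, PolyTensor.balance,
        smul_X_eq_monomial]
      rfl

/-- If `α_i` does not occur in `β`, then `e(β, i) R(n) τ R(n) e(β, i)` vanishes. -/
theorem idem_smul_mk_mackeyHom {h : δ = β + root i} {N : Type*} [AddCommGroup N]
    [Module (Block p (m + 1) β) N] (hi : β i = 0) (s : SelfTensor p m) (x : N) :
    (Block.ofSucc p h : GrHom (Block.deg p (m + 1) β) _).idem •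
      mk p h (Alg.mackeyHom p m s) x = 0 := by
  -- No sequence of weight β ends in i.
  have h0 : Block.proj p (m + 1) β (Alg.eLast p m i) = 0 := by
    refine Subtype.ext (Alg.ext_e fun ν => ?_)
    change Alg.eBeta p (m + 1) β * Alg.eLast p m i * _ = 0 * _
    classical
    rw [zero_mul, Alg.eBeta, Alg.eLast, Alg.eSum_mul_eSum, Alg.eSum_mul_e, if_neg]
    rintro ⟨rfl, rfl⟩
    rw [Alg.wt_succ] at hi
    simp at hi
  induction s using SelfTensor.induction with
  | zero => rw [map_zero, mk_zero, smul_zero]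
  | add s t hs ht => rw [map_add, mk_add, smul_add, hs, ht, add_zero]
  | tmul y z =>
    rw [Alg.mackeyHom_tmul, idem_smul_mk, ← mul_assoc, ← mul_assoc, Alg.eLast_comm,
      mul_assoc (Alg.emb p _ y), Alg.eLast_tl, ← mul_assoc (Alg.emb p _ y),
      mul_assoc (_ * _), ← map_mul, mk_mul, map_mul, h0, zero_mul, zero_smul (Block p (m + 1) β) x,
      ← mkHom_apply, map_zero]

/-- The non-parabolic part of z is killed by e(β, i), so E_i F_i N only sees the parabolic part. -/
theorem idem_smul_mk_parProj (hi : β i = 0) (z : Alg p (n + 1)) (x : N) :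
    mk p h (Alg.parProj p n z) x =
      (Block.ofSucc p h : GrHom (Block.deg p n β) _).idem • mk p h z x := by
  rw [← idem_smul_mk_of_mem p h (Alg.parProj_mem p z)]
  cases n with
  | zero => rfl
  | succ m =>
    rw [← sub_eq_zero, ← smul_sub, ← mk_sub, ← neg_sub z, ← eq_sub_of_add_eq
      (Alg.mackeyHom_add_parProj p z), ← map_neg, idem_smul_mk_mackeyHom p hi]

section

variable (hβ : β = ε + root i) (hγ : γ = ε + root j) (hj : δ = β + root j)
  {N : Type*} [AddCommGroup N] [Module (Block p (m + 1) β) N]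

/-- Together with `uncross_poly` this says that the two summands do not interfere: x τ has no
parabolic component and powers of x_n have no component in R τ R. -/
theorem coef_cross (hγ : γ = ε + root i) (hi : δ = β + root i)
    (t : Ind p m hγ (Res p m hβ N)) : coef p hi N (crossAdd p hβ hγ hi N t) = 0 := by
  induction t using induction p hγ with
  | zero => rw [map_zero, map_zero]
  | add s t hs ht => rw [map_add, map_add, hs, ht, add_zero]
  | mk z x =>
    rw [crossAdd_mk, coef_mk, ← mul_one (_ * _), ← map_one (Alg.emb p (m + 1)),
      Alg.parProj_cross, map_zero, coefSum_zero]

theorem uncross_poly (hγ : γ = ε + root i) (hi : δ = β + root i)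
    (t : PolyTensor k (Block p (m + 1) β) N) :
    uncross p hβ hγ hi N (polyAdd p hi N t) = 0 := by
  induction t using TensorProduct.induction_on with
  | zero => rw [map_zero, map_zero]
  | add s t hs ht => rw [map_add, map_add, hs, ht, add_zero]
  | tmul x q =>
    change uncross p hβ hγ hi N (polyAdd p hi N
      (PolyTensor.tmul k (Block p (m + 1) β) (show N from x) q)) = 0
    rw [polyAdd_tmul, uncross_mk, uncrossHom_of_mem p hβ hγ (Alg.aeval_xl_mem_parabolic p q)]

end

end Ind

end PolyMap

/-! ### Bijective morphisms of graded modules. -/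

section Iso

variable {A : Type*} [Ring A] {𝒜 : ℤ → AddSubgroup A}

/-- The homogeneous components of f(m) are the images of those of m; if f(m) is homogeneous,
injectivity kills all other components of m. -/
theorem GrMod.mem_deg_of_map {M N : GrMod.{w} 𝒜} (f : M ⟶ N)
    (hf : Function.Injective f.toLin) {d : ℤ} {m : M.carrier} (h : f.toLin m ∈ N.deg d) :
    m ∈ M.deg d := by
  classical
  obtain ⟨δ, hδ⟩ := exists_coaction M.isInternal
  obtain ⟨ε, hε⟩ := exists_coaction N.isInternal
  have key : (∀ c, δ m c ∈ M.deg c) ∧ (∀ c, ε (f.toLin m) c = f.toLin (δ m c)) ∧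
      (δ m).sum (fun _ x => x) = m := by
    clear h
    induction mem_iSup_of_isInternal M.isInternal m using AddSubgroup.iSup_induction' with
    | h1 => simp
    | hadd x y _ _ hx hy =>
      refine ⟨fun c => ?_, fun c => ?_, ?_⟩
      · rw [map_add, Finsupp.add_apply]
        exact add_mem (hx.1 c) (hy.1 c)
      · rw [map_add, map_add, map_add, Finsupp.add_apply, Finsupp.add_apply, map_add,
          hx.2.1, hy.2.1]
      · rw [map_add, Finsupp.sum_add_index' (fun _ => rfl) (fun _ _ _ => rfl), hx.2.2, hy.2.2]
    | hp e x hx =>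
      rw [hδ e x hx, hε e _ (f.map_deg hx)]
      refine ⟨fun c => ?_, fun c => ?_, Finsupp.sum_single_index rfl⟩
      · rw [Finsupp.single_apply]
        split_ifs with hc
        · exact hc ▸ hx
        · exact zero_mem _
      · rw [Finsupp.single_apply, Finsupp.single_apply]
        split_ifs
        · rfl
        · exact (map_zero _).symm
  obtain ⟨h1, h2, h3⟩ := key
  rw [hε d _ h] at h2
  have h4 : δ m = Finsupp.single d (δ m d) := by
    ext c
    by_cases hc : d = c
    · subst hc
      rw [Finsupp.single_eq_same]
    · rw [Finsupp.single_eq_of_ne' hc]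
      refine hf ?_
      rw [← h2, Finsupp.single_eq_of_ne' hc, map_zero]
  rw [h4, Finsupp.sum_single_index rfl] at h3
  rw [← h3]
  exact h1 d

/-- A bijective morphism of graded modules is an isomorphism. -/
noncomputable def GrMod.isoOfBijective {M N : GrMod.{w} 𝒜} (f : M ⟶ N)
    (hf : Function.Bijective f.toLin) : M ≅ N where
  hom := f
  inv := ⟨(LinearEquiv.ofBijective f.toLin hf).symm.toLinearMap, fun {d n} hn => by
    refine GrMod.mem_deg_of_map f hf.1 ?_
    have : f.toLin ((LinearEquiv.ofBijective f.toLin hf).symm n) = n :=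
      (LinearEquiv.ofBijective f.toLin hf).apply_symm_apply n
    change f.toLin ((LinearEquiv.ofBijective f.toLin hf).symm n) ∈ _
    rwa [this]⟩
  hom_inv_id := GrMod.Hom.ext (LinearMap.ext fun m =>
    (LinearEquiv.ofBijective f.toLin hf).symm_apply_apply m)
  inv_hom_id := GrMod.Hom.ext (LinearMap.ext fun m =>
    (LinearEquiv.ofBijective f.toLin hf).apply_symm_apply m)

end Iso

/-! ### Degrees, bijectivity, naturality and the isomorphisms of functors. -/

section Degrees

variable {k I : Type u} [CommRing k] [Fintype I] {C : BorcherdsCartan I} {𝓀 : ℤ → AddSubgroup k}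
  (p : Params C 𝓀) {n m : ℕ} {β γ δ ε : I →₀ ℕ} {i j : I}

namespace Alg

theorem mul_eSum_mem {d : ℤ} (z : Alg p n) (φ : (Fin n → I) → Prop)
    (h : ∀ ν, φ ν → z * e p ν ∈ deg p n d) : z * eSum p φ ∈ deg p n d := by
  classical
  rw [eSum, Finset.mul_sum]
  refine sum_mem fun ν _ => ?_
  split_ifs with hν
  · exact h ν hν
  · rw [mul_zero]
    exact zero_mem _

/-- The degree of τ depends on the two colours it crosses, so it is homogeneous only after both are
fixed. -/
theorem tl_mul_mem (i j : I) :
    tl p m * (emb p _ (eLast p m i) * eLast p _ j) ∈ deg p (m + 2) (-C.form i j) := by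
  rw [eLast, eLast, emb_eSum, eSum_mul_eSum]
  refine mul_eSum_mem p _ _ ?_
  rintro ν ⟨rfl, rfl⟩
  exact mem_deg p (HomEl.t m _ ν)

theorem xl_mul_mem (i : I) : xl p n * eLast p n i ∈ deg p (n + 1) (2 * C.d i) := by
  rw [eLast]
  refine mul_eSum_mem p _ _ ?_
  rintro ν rfl
  exact mem_deg p (HomEl.x _ ν)

theorem xl_pow_mul_mem (i : I) (r : ℕ) :
    xl p n ^ r * eLast p n i ∈ deg p (n + 1) (2 * C.d i * r) := by
  induction r with
  | zero => simpa using eLast_mem p i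
  | succ r ih =>
    have h : xl p n ^ (r + 1) * eLast p n i =
        xl p n * eLast p n i * (xl p n ^ r * eLast p n i) := by
      rw [mul_assoc (xl p n), ← mul_assoc (eLast p n i), eLast_xl_pow, mul_assoc (xl p n ^ r),
        (eLast_idem p i).eq, pow_succ', mul_assoc]
    rw [h, show 2 * C.d i * ((r + 1 : ℕ) : ℤ) = 2 * C.d i + 2 * C.d i * r by push_cast; ring]
    exact mul_mem_deg p (xl_mul_mem p i) ih

open Polynomial in
theorem aeval_xl_mul_mem (i : I) {c : ℤ} {q : k[X]} (hq : q ∈ polyDeg 𝓀 (2 * C.d i) c) :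
    aeval (xl p n) q * eLast p n i ∈ deg p (n + 1) c := by
  rw [aeval_eq_sum_range, Finset.sum_mul]
  refine sum_mem fun r _ => ?_
  have h := mul_mem_deg p (mem_deg p (HomEl.scalar (hq r))) (xl_pow_mul_mem p (n := n) i r)
  rwa [sub_add_cancel, ← mul_assoc, ← Algebra.smul_def] at h

end Alg

namespace Ind

open Polynomial

section

variable {N : Type*} [AddCommGroup N]

/-- The grading of the module underlying `F_j N`. -/
noncomputable def deg (h : δ = β + root j) [Module (Block p n β) N] (degN : ℤ → AddSubgroup N) :
    ℤ → AddSubgroup (Ind p n h N) :=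
  tensorDeg (Block.ofSucc p h : GrHom (Block.deg p n β) (Block.deg p (n + 1) δ)).leftIdealDeg degN
    BalTensor.tmul

/-- Only z e(n,j) has to be homogeneous, since the tensor does not see the rest of z. This matters
because neither τ nor x_n is homogeneous by itself. -/
theorem mk_mem (h : δ = β + root j) [Module (Block p n β) N] {degN : ℤ → AddSubgroup N} {a c : ℤ}
    {z : Alg p (n + 1)} (hz : z * Alg.eLast p n j ∈ Alg.deg p (n + 1) a) {x : N}
    (hx : x ∈ degN c) : mk p h z x ∈ deg p h degN (a + c) := by
  refine AddSubgroup.subset_closure ⟨a, c, Block.toIdeal p h z, ?_, x, hx, rfl, rfl⟩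
  change Block.incl p (n + 1) δ (Block.toIdeal p h z).1 ∈ Alg.deg p (n + 1) a
  rw [Block.incl_toIdeal, ← Alg.eLast_comm, ← mul_assoc, ← add_zero a]
  exact Alg.mul_mem_deg p hz (Alg.emb_mem_deg p (Alg.eBeta_mem p β))

theorem map_mem_of_mem_deg (h : δ = β + root j) [Module (Block p n β) N]
    {degN : ℤ → AddSubgroup N} {d : ℤ} {P : Type*} [AddCommGroup P] (f : Ind p n h N →+ P)
    (S : AddSubgroup P)
    (H : ∀ a c z x, z ∈ Alg.deg p (n + 1) a → x ∈ degN c → a + c = d → f (mk p h z x) ∈ S)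
    {t : Ind p n h N} (ht : t ∈ deg p h degN d) : f t ∈ S := by
  induction ht using AddSubgroup.closure_induction with
  | zero => rw [map_zero]; exact zero_mem _
  | add x y _ _ hx hy => rw [map_add]; exact add_mem hx hy
  | neg x _ hx => rw [map_neg]; exact neg_mem hx
  | mem t ht =>
    obtain ⟨a, c, b, hb, x, hx, hd, rfl⟩ := ht
    rw [← mk_incl]
    exact H a c _ x hb hx hd

theorem crossAdd_mem (hβ : β = ε + root i) (hγ : γ = ε + root j) (hj : δ = β + root j)
    [Module (Block p (m + 1) β) N] {degN : ℤ → AddSubgroup N} {d : ℤ}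
    {t : Ind p m hγ (Res p m hβ N)}
    (ht : t ∈ deg p hγ (fun c => (degN c).comap (AddSubgroup.subtype _)) d) :
    crossAdd p hβ hγ hj N t ∈ deg p hj degN (d - C.form i j) := by
  refine map_mem_of_mem_deg p hγ (crossAdd p hβ hγ hj N) _ (fun a c z x hz hx hd => ?_) ht
  -- The idempotent e(m,i) is inserted, being invisible on E_i N, so that both colours crossed by τ
  -- are fixed.
  rw [crossAdd_mk, ← mk_mul_eLast_cut,
    show d - C.form i j = a + -C.form i j + c by rw [← hd]; ring]
  refine mk_mem p hj ?_ hx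
  rw [mul_assoc, mul_assoc]
  exact Alg.mul_mem_deg p (Alg.emb_mem_deg p hz) (Alg.tl_mul_mem p i j)

theorem polyAdd_mem (h : δ = β + root i) [Module (Block p n β) N] {degN : ℤ → AddSubgroup N}
    {d : ℤ} {t : PolyTensor k (Block p n β) N}
    (ht : t ∈ tensorDeg degN (polyDeg 𝓀 (2 * C.d i)) (PolyTensor.tmul k (Block p n β)) d) :
    polyAdd p h N t ∈ deg p h degN d := by
  induction ht using AddSubgroup.closure_induction with
  | zero => rw [map_zero]; exact zero_mem _
  | add x y _ _ hx hy => rw [map_add]; exact add_mem hx hy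
  | neg x _ hx => rw [map_neg]; exact neg_mem hx
  | mem t ht =>
    obtain ⟨a, c, x, hx, q, hq, rfl, rfl⟩ := ht
    rw [polyAdd_tmul, add_comm]
    exact mk_mem p h (Alg.aeval_xl_mul_mem p i hq) hx

variable (hβ : β = ε + root i) (hγ : γ = ε + root j) (hj : δ = β + root j) (hi : δ = γ + root i)
  [Module (Block p (m + 1) β) N]

/-- The inverse is `uncross`: the parabolic component that it forgets is annihilated by e(γ, i)
because i ≠ j. -/
theorem cross_bijective (hij : i ≠ j) : Function.Bijective (cross (m := m) p hβ hγ hj hi N) := by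
  refine ⟨fun s t hst => ?_, fun t => ?_⟩
  · have h : crossAdd p hβ hγ hj N s = crossAdd p hβ hγ hj N t := congrArg Subtype.val hst
    rw [← uncross_cross p hβ hγ hj s, h, uncross_cross]
  · refine ⟨uncross p hβ hγ hj N t.1, Subtype.ext (Eq.trans ?_ t.2)⟩
    change crossAdd p hβ hγ hj N (uncross p hβ hγ hj N t.1) = _
    generalize t.1 = t
    induction t using induction p hj with
    | zero => rw [map_zero, map_zero, smul_zero]
    | add s t hs ht => rw [map_add, map_add, hs, ht, smul_add]
    | mk z x =>
      rw [cross_uncross p hβ hγ hj hi, smul_sub,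
        idem_smul_mk_of_mem_ne p hj hi hij (Alg.parProj_mem p z), sub_zero]

/-- The inverse is the pair of `uncross` and `coef`. Each of them vanishes on the other summand, and
what the first one forgets is the parabolic component restored by the second. -/
theorem cross_coprod_poly_bijective (hγ : β = ε + root i) (hj : δ = β + root i) :
    Function.Bijective ((cross (m := m) p hβ hγ hj hj N).coprod (poly p hj)) := by
  refine ⟨fun s t hst => ?_, fun t => ?_⟩
  · have h : crossAdd p hβ hβ hj N s.1 + polyAdd p hj N s.2 =
        crossAdd p hβ hβ hj N t.1 + polyAdd p hj N t.2 := congrArg Subtype.val hst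
    have h1 := congrArg (uncross p hβ hβ hj N) h
    have h2 := congrArg (coef p hj N) h
    rw [map_add, map_add, uncross_cross, uncross_cross, uncross_poly, uncross_poly, add_zero,
      add_zero] at h1
    rw [map_add, map_add, coef_cross, coef_cross, coef_poly, coef_poly, zero_add, zero_add] at h2
    exact Prod.ext h1 h2
  · refine ⟨(uncross p hβ hβ hj N t.1, coef p hj N t.1), Subtype.ext (Eq.trans ?_ t.2)⟩
    change crossAdd p hβ hβ hj N (uncross p hβ hβ hj N t.1) + polyAdd p hj N (coef p hj N t.1) = _
    generalize t.1 = t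
    induction t using induction p hj with
    | zero => rw [map_zero, map_zero, map_zero, map_zero, smul_zero, add_zero]
    | add s t hs ht =>
      rw [map_add, map_add, map_add, map_add, add_add_add_comm, hs, ht, smul_add]
    | mk z x =>
      rw [cross_uncross p hβ hβ hj hj, polyAdd_coef, smul_sub,
        idem_smul_mk_of_mem p hj (Alg.parProj_mem p z), sub_add_cancel]

end

/-- The inverse is `coef`; the crossing part contributes nothing since α_i does not occur in β. -/
theorem poly_bijective {N : Type*} [AddCommGroup N] [Module (Block p n β) N]
    (h : δ = β + root i) (hi : β i = 0) : Function.Bijective (poly (n := n) p h (N := N)) := by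
  refine ⟨fun s t hst => ?_, fun t => ?_⟩
  · have h1 : polyAdd p h N s = polyAdd p h N t := congrArg Subtype.val hst
    rw [← coef_poly p h s, h1, coef_poly]
  · refine ⟨coef p h N t.1, Subtype.ext (Eq.trans ?_ t.2)⟩
    change polyAdd p h N (coef p h N t.1) = _
    generalize t.1 = t
    induction t using induction p h with
    | zero => rw [map_zero, map_zero, smul_zero]
    | add s t hs ht => rw [map_add, map_add, hs, ht, smul_add]
    | mk z x => rw [polyAdd_coef, idem_smul_mk_parProj p h hi]

section Naturality

theorem map_mk (h : δ = β + root j) {N N' : Type*} [AddCommGroup N] [Module (Block p n β) N]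
    [AddCommGroup N'] [Module (Block p n β) N'] (f : N →ₗ[Block p n β] N') (z : Alg p (n + 1))
    (x : N) : BalTensor.map (Block p (n + 1) δ) (Block p n β)
      (Block.ofSucc p h : GrHom (Block.deg p n β) _).leftIdeal f (mk p h z x) = mk p h z (f x) :=
  rfl

/-- The map g plays the role of E_i f and is only required to agree with f on E_i N. -/
theorem crossAdd_map (hβ : β = ε + root i) (hγ : γ = ε + root j) (hj : δ = β + root j)
    {N N' : Type*} [AddCommGroup N] [Module (Block p (m + 1) β) N]
    [AddCommGroup N'] [Module (Block p (m + 1) β) N'] (f : N →ₗ[Block p (m + 1) β] N')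
    (g : Res p m hβ N →ₗ[Block p m ε] Res p m hβ N') (hg : ∀ x, (g x : N') = f x)
    (t : Ind p m hγ (Res p m hβ N)) :
    crossAdd p hβ hγ hj N' (BalTensor.map _ _ _ g t) =
      BalTensor.map _ _ _ f (crossAdd p hβ hγ hj N t) := by
  induction t using induction p hγ with
  | zero => rw [map_zero, map_zero, map_zero, map_zero]
  | add s t hs ht => rw [map_add, map_add, map_add, map_add, hs, ht]
  | mk z x => rw [map_mk, crossAdd_mk, crossAdd_mk, map_mk, hg]

theorem polyAdd_map (h : δ = β + root i) {N N' : Type*} [AddCommGroup N] [Module (Block p n β) N]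
    [AddCommGroup N'] [Module (Block p n β) N'] (f : N →ₗ[Block p n β] N')
    (t : PolyTensor k (Block p n β) N) :
    polyAdd p h N' (PolyTensor.map k f t) = BalTensor.map _ _ _ f (polyAdd p h N t) := by
  induction t using TensorProduct.induction_on with
  | zero => rw [map_zero, map_zero, map_zero, map_zero]
  | add s t hs ht => rw [map_add, map_add, map_add, map_add, hs, ht]
  | tmul x q =>
    change polyAdd p h N' (PolyTensor.tmul k (Block p n β) (f x) q) =
      BalTensor.map _ _ _ f (polyAdd p h N (PolyTensor.tmul k (Block p n β) (show N from x) q))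
    rw [polyAdd_tmul, polyAdd_tmul, map_mk]

end Naturality

section Functors

variable [GradedRing 𝓀]

/-- The morphism `q_i ^ (-a_ij) F_j E_i N → E_i F_j N`. -/
noncomputable def crossHom (hβ : β = ε + root i) (hγ : γ = ε + root j) (hj : δ = β + root j)
    (hi : δ = γ + root i) (N : Mod.{u, w} p (m + 1) β) :
    (E.{u, w} p m ε i hβ ⋙ F.{u, w} p m ε j hγ ⋙
      qShift.{u, w} p (m + 1) γ (C.d i * -C.a i j)).obj N ⟶
    (F.{u, w} p (m + 1) β j hj ⋙ E.{u, w} p (m + 1) γ i hi).obj N :=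
  GrMod.Hom.mk
    (M := (E.{u, w} p m ε i hβ ⋙ F.{u, w} p m ε j hγ ⋙
      qShift.{u, w} p (m + 1) γ (C.d i * -C.a i j)).obj N)
    (N := (F.{u, w} p (m + 1) β j hj ⋙ E.{u, w} p (m + 1) γ i hi).obj N)
    (cross p hβ hγ hj hi N.carrier) fun {d t} ht => by
      have h := crossAdd_mem p hβ hγ hj (degN := N.deg) (d := d - C.d i * -C.a i j) ht
      -- Degree d of the shifted module is degree d + (α_i|α_j) of F_j E_i N, and τ lowers degrees
      -- by (α_i|α_j).
      rw [show d - C.d i * -C.a i j - C.form i j = d by rw [BorcherdsCartan.form]; ring] at h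
      exact h

/-- The morphism `N ⊗ k[t] → E_i F_i N`. -/
noncomputable def polyHom (h : δ = β + root i) (N : Mod.{u, w} p n β) :
    (tensorPoly.{u, w} p n β (2 * C.d i)).obj N ⟶
    (F.{u, w} p n β i h ⋙ E.{u, w} p n β i h).obj N :=
  GrMod.Hom.mk (M := (tensorPoly.{u, w} p n β (2 * C.d i)).obj N)
    (N := (F.{u, w} p n β i h ⋙ E.{u, w} p n β i h).obj N)
    (poly p h (N := N.carrier)) fun ht => polyAdd_mem p h (degN := N.deg) ht

/-- `q_i ^ (-a_ij) F_j E_i ≅ E_i F_j` for `i ≠ j`. -/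
noncomputable def crossIso (hβ : β = ε + root i) (hγ : γ = ε + root j) (hj : δ = β + root j)
    (hi : δ = γ + root i) (hij : i ≠ j) :
    E.{u, w} p m ε i hβ ⋙ F.{u, w} p m ε j hγ ⋙
      qShift.{u, w} p (m + 1) γ (C.d i * -C.a i j) ≅
    F.{u, w} p (m + 1) β j hj ⋙ E.{u, w} p (m + 1) γ i hi :=
  NatIso.ofComponents
    (fun N => GrMod.isoOfBijective (crossHom p hβ hγ hj hi N)
      (cross_bijective p hβ hγ hj hi hij)) fun {N N'} f => by
    exact GrMod.Hom.ext (LinearMap.ext fun t => Subtype.ext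
      (crossAdd_map p hβ hγ hj f.toLin _ (fun _ => rfl) t))

/-- `N ⊗ k[t] ≅ E_i F_i N` if `α_i` does not occur in `β`. -/
noncomputable def polyIso (h : δ = β + root i) (hi : β i = 0) :
    tensorPoly.{u, w} p n β (2 * C.d i) ≅ F.{u, w} p n β i h ⋙ E.{u, w} p n β i h :=
  NatIso.ofComponents
    (fun N => GrMod.isoOfBijective (polyHom p h N) (poly_bijective p h hi)) fun {N N'} f => by
    exact GrMod.Hom.ext (LinearMap.ext fun t => Subtype.ext (polyAdd_map p h f.toLin t))

/-- The morphism `q_i ^ (-a_ii) F_i E_i N ⊕ N ⊗ k[t] → E_i F_i N`. -/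
noncomputable def sumHom (hβ : β = ε + root i) (hi : δ = β + root i)
    (N : Mod.{u, w} p (m + 1) β) :
    (directSum
      (E.{u, w} p m ε i hβ ⋙ F.{u, w} p m ε i hβ ⋙
        qShift.{u, w} p (m + 1) β (C.d i * -C.a i i))
      (tensorPoly.{u, w} p (m + 1) β (2 * C.d i))).obj N ⟶
    (F.{u, w} p (m + 1) β i hi ⋙ E.{u, w} p (m + 1) β i hi).obj N :=
  GrMod.Hom.mk
    (M := ((E.{u, w} p m ε i hβ ⋙ F.{u, w} p m ε i hβ ⋙
      qShift.{u, w} p (m + 1) β (C.d i * -C.a i i)).obj N).sum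
        ((tensorPoly.{u, w} p (m + 1) β (2 * C.d i)).obj N))
    (N := (F.{u, w} p (m + 1) β i hi ⋙ E.{u, w} p (m + 1) β i hi).obj N)
    ((cross p hβ hβ hi hi N.carrier).coprod (poly p hi)) fun ht =>
      add_mem ((crossHom p hβ hβ hi hi N).map_deg (AddSubgroup.mem_prod.1 ht).1)
        ((polyHom p hi N).map_deg (AddSubgroup.mem_prod.1 ht).2)

/-- `q_i ^ (-a_ii) F_i E_i ⊕ Id ⊗ k[t] ≅ E_i F_i`. -/
noncomputable def sumIso (hβ : β = ε + root i) (hi : δ = β + root i) :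
    directSum
      (E.{u, w} p m ε i hβ ⋙ F.{u, w} p m ε i hβ ⋙
        qShift.{u, w} p (m + 1) β (C.d i * -C.a i i))
      (tensorPoly.{u, w} p (m + 1) β (2 * C.d i)) ≅
    F.{u, w} p (m + 1) β i hi ⋙ E.{u, w} p (m + 1) β i hi :=
  NatIso.ofComponents
    (fun N => GrMod.isoOfBijective (sumHom p hβ hi N)
      (cross_coprod_poly_bijective p hβ hβ hi)) fun {N N'} f => by
    refine GrMod.Hom.ext (LinearMap.ext fun t => Subtype.ext ?_)
    refine (congrArg₂ (· + ·) (crossAdd_map p hβ hβ hi f.toLin _ (fun _ => rfl) t.1)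
      (polyAdd_map p hi f.toLin t.2)).trans ?_
    exact (map_add (BalTensor.map _ _ _ f.toLin) _ _).symm

end Functors

end Ind

end Degrees

end KLR

theorem mainTheorem7 {k I : Type u} [CommRing k] [Fintype I] (𝓀 : ℤ → AddSubgroup k)
    [GradedRing 𝓀] (h𝓀 : ∀ d < 0, 𝓀 d = ⊥) (C : KLR.BorcherdsCartan I) (p : KLR.Params C 𝓀) :
    -- `E_i F_j ≅ q_i ^ (-a_ij) F_j E_i` on `Mod R(β)`, `β = ε + α_i`, for `i ≠ j`
    (∀ (i j : I), i ≠ j → ∀ (n : ℕ) (ε : I →₀ ℕ), ε.degree = n →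
      Nonempty
        (KLR.F.{u, w} p (n + 1) (ε + KLR.root i) j rfl ⋙
            KLR.E.{u, w} p (n + 1) (ε + KLR.root j) i (add_right_comm _ _ _) ≅
          KLR.E.{u, w} p n ε i rfl ⋙ KLR.F.{u, w} p n ε j rfl ⋙
            KLR.qShift.{u, w} p (n + 1) (ε + KLR.root j) (C.d i * -C.a i j))) ∧
    -- `E_i F_i ≅ q_i ^ (-a_ii) F_i E_i ⊕ Id ⊗ k[t_i]` on `Mod R(β)`, `β = ε + α_i`
    (∀ (i : I) (n : ℕ) (ε : I →₀ ℕ), ε.degree = n →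
      Nonempty
        (KLR.F.{u, w} p (n + 1) (ε + KLR.root i) i rfl ⋙
            KLR.E.{u, w} p (n + 1) (ε + KLR.root i) i rfl ≅
          KLR.directSum
            (KLR.E.{u, w} p n ε i rfl ⋙ KLR.F.{u, w} p n ε i rfl ⋙
              KLR.qShift.{u, w} p (n + 1) (ε + KLR.root i) (C.d i * -C.a i i))
            (KLR.tensorPoly.{u, w} p (n + 1) (ε + KLR.root i) (2 * C.d i)))) ∧
    -- the same on `Mod R(β)` if `α_i` does not occur in `β`, where `F_i E_i = 0`
    (∀ (i : I) (n : ℕ) (β : I →₀ ℕ), β.degree = n → β i = 0 →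
      Nonempty
        (KLR.F.{u, w} p n β i rfl ⋙ KLR.E.{u, w} p n β i rfl ≅
          KLR.tensorPoly.{u, w} p n β (2 * C.d i))) ∧
    -- `R(n) ⊗_{R(n-1)} R(n) ⊕ R(n, 1) ≅ R(n + 1)` as `(R(n), R(n))`-bimodules, `n = m + 1`
    (∀ m : ℕ, ∃ f : KLR.SelfTensor p m × KLR.parabolic p (m + 1) ≃+ KLR.Alg p (m + 2),
      (∀ (x y : KLR.Alg p (m + 1)) (z : KLR.parabolic p (m + 1)),
        f (KLR.SelfTensor.tmul x y, z) =
          KLR.Alg.emb p (m + 1) x * KLR.Alg.t p m (Nat.lt_succ_self (m + 1)) *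
            KLR.Alg.emb p (m + 1) y + z) ∧
      (∀ (u : KLR.Alg p (m + 1)) (s : KLR.SelfTensor p m) (z : KLR.parabolic p (m + 1)),
        f (u • s, KLR.toParabolic p (m + 1) u * z) = KLR.Alg.emb p (m + 1) u * f (s, z)) ∧
      (∀ (v : KLR.Alg p (m + 1)) (s : KLR.SelfTensor p m) (z : KLR.parabolic p (m + 1)),
        f (KLR.SelfTensor.mulRight v s, z * KLR.toParabolic p (m + 1) v) =
          f (s, z) * KLR.Alg.emb p (m + 1) v)) := by
  refine ⟨fun i j hij n ε _ => ⟨(KLR.Ind.crossIso.{u, w} p rfl rfl rfl (add_right_comm _ _ _) hij).symm⟩,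
    fun i n ε _ => ⟨(KLR.Ind.sumIso.{u, w} p rfl rfl).symm⟩,
    fun i n β _ hi => ⟨(KLR.Ind.polyIso.{u, w} p rfl hi).symm⟩,
    fun m => ⟨KLR.Alg.mackeyEquiv p m, fun x y z => ?_,
      fun u s z => KLR.Alg.mackeyEquiv_smul p u s z,
      fun v s z => KLR.Alg.mackeyEquiv_mulRight p v s z⟩⟩
  rw [KLR.Alg.mackeyEquiv_apply, KLR.Alg.mackeyHom_tmul]
  rfl
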